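/- **Setting.** $G$ is a finite simple undirected graph with $n$ vertices and $m\ge n$ edges, average degree $\overline d=2m/n$; $d_v$ is the degree of $v$, and for real $x$, $N(x)$ is the number of vertices of degree at least $x$. The sequence $\{N(d)\}_{d\ge 1}$ is the complementary cumulative degree histogram (ccdh) of $G$. A sequence $\{\widetilde N(d)\}$ is an $(\varepsilon,\varepsilon)$-approximation to the ccdh if for every integer $d\ge1$, $$(1-\varepsilon)N((1+\varepsilon)d)\le \widetilde N(d)\le(1+\varepsilon)N((1-\varepsilon)d).$$ For $\gamma>2$ and $\tau>0$, the degree distribution of $G$ is *bounded below by a power law with exponent $\gamma$ (and constant $\tau$)* if $N(d)\ge\lfloor \tau n/d^{\gamma-1}\rfloor$ for every integer $d\ge1$. **Query models.** In the Standard Model (SM) an algorithm may query a uniformly random vertex, a uniformly random neighbor of a given vertex, and the degree of a given vertex. In the Hidden Degrees Model (HDM) degree queries are not allowed. Every query costs one; internal coin tosses are free. (A neighbor query at an isolated vertex reports that there is no neighbor.) **SADDLES.** The algorithm has parameters $r,q,\ell\in\mathbb N$ and a real cutoff. It performs $\ell$ rounds. In each round it draws a multiset $R$ of $r$ uniformly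 random vertices $v$ and obtains values $\hat d_v$; put $\hat d_R=\sum_{v\in R}\hat d_v$. Then $q$ times it picks $v\in R$ with probability $\hat d_v/\hat d_R$, a uniformly random neighbor $u$ of $v$, and obtains $\hat d_u$ (if $\hat d_R=0$, or if there is no neighbor, this draw contributes $0$ below). For every $d$ let $X_d$ be the number of $v\in R$ (with multiplicity) with $\hat d_v\ge d$; the estimate of the round is $\frac nr X_d$ if $X_d\ge$ cutoff, and otherwise $\frac nr\cdot\frac{\hat d_R}{q}\sum_u \mathbf 1[\hat d_u\ge d]/\hat d_u$, the sum being over the $q$ drawn neighbors. The output for $d$ is the median of the $\ell$ estimates. In the SM, $\hat d_v=d_v$ is obtained by a degree query. In the HDM, $\hat d_v$ is the output of a subroutine $\mathrm{DEG}(v)$, called at most once for every vertex, the result being stored; $\mathrm{DEG}(v)$ makes only neighbor queries at $v$, and its output lies in $[(1-\varepsilon/10)d_v,(1+\varepsilon/10)d_v]$ with probability greater than $1-1/n^3$ on every graph with $n$ vertices. **Theorem 1.2.** Let $\gamma>2$, $\tau>0$ and $K>0$. There are constants $C>0$ and $k\in\mathbb N$ depending only on $\gamma,\tau,K$ such that for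 every $n\ge 1$ and $\varepsilon>0$ there is such a subroutine $\mathrm{DEG}$, and for every $m\ge n$ there are parameters $r,q,\ell$ and a cutoff, such that for every graph $G$ with $n$ vertices and $m$ edges whose degree distribution is bounded below by a power law with exponent $\gamma$ and constant $\tau$, in both models SADDLES outputs an $(\varepsilon,\varepsilon)$-approximation to the ccdh of $G$ with probability at least $1-n^{-K}$, and it makes * SM: always at most $C(1+\tfrac1\varepsilon)^k(\log n)^k\left(n^{1-\frac1\gamma}+n^{1-\frac1{\gamma-1}}\,\overline d\right)$ queries; * HDM: in expectation at most $C(1+\tfrac1\varepsilon)^k(\log n)^k\; n^{1-\frac1{2(\gamma-1)}}\,\overline d$ queries. -/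

import Mathlib

open scoped NNReal ENNReal

universe u v w

noncomputable section

/-! ### The complementary cumulative degree histogram -/

/-- The ccdh of `G`: `ccdh G x` is the number `N(x)` of vertices of degree at least `x`. -/
def ccdh {V : Type u} [Fintype V] (G : SimpleGraph V) [DecidableRel G.Adj] (x : ℝ) : ℕ :=
  (Finset.univ.filter fun v : V => x ≤ (G.degree v : ℝ)).card

/-- `Nt` is an `(ε, ε)`-estimate of the ccdh of `G`: for every degree `d ≥ 1`,
`(1 - ε) N((1 + ε) d) ≤ Nt d ≤ (1 + ε) N((1 - ε) d)`. -/
def IsCcdhEstimate {V : Type u} [Fintype V] (G : SimpleGraph V) [DecidableRel G.Adj]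
    (ε : ℝ) (Nt : ℕ → ℝ) : Prop :=
  ∀ d : ℕ, 1 ≤ d →
    (1 - ε) * (ccdh G ((1 + ε) * d) : ℝ) ≤ Nt d ∧
    Nt d ≤ (1 + ε) * (ccdh G ((1 - ε) * d) : ℝ)

/-- The degree distribution of `G` is bounded below by a power law with exponent `γ` and
constant `τ`: `N(d) ≥ ⌊τ n / d ^ (γ - 1)⌋` for every degree `d ≥ 1`. -/
def PowerLawBelow {V : Type u} [Fintype V] (G : SimpleGraph V) [DecidableRel G.Adj]
    (γ τ : ℝ) : Prop :=
  ∀ d : ℕ, 1 ≤ d →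
    ⌊τ * (Fintype.card V : ℝ) / (d : ℝ) ^ (γ - 1)⌋₊ ≤ ccdh G (d : ℝ)

/-- The average degree of `G`. -/
def avgDegree {V : Type u} [Fintype V] (G : SimpleGraph V) [DecidableRel G.Adj] : ℝ :=
  (∑ v : V, (G.degree v : ℝ)) / (Fintype.card V : ℝ)

/-! ### The query model -/

/-- Randomized algorithms that access a graph on the vertex set `V` only through queries.
* `ret a`: stop with output `a`;
* `vertex k`: query a uniformly random vertex, continue with `k` applied to the answer;
* `neighbor v k`: query a uniformly random neighbor of `v`
  (the answer is `none` if `v` is isolated);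
* `degree v k`: query the degree of `v`;
* `sample p k`: draw from the explicitly known distribution `p`, using internal coins only. -/
inductive QueryAlg (V : Type u) (α : Type v) : Type (max u v)
  | ret (a : α) : QueryAlg V α
  | vertex (k : V → QueryAlg V α) : QueryAlg V α
  | neighbor (v : V) (k : Option V → QueryAlg V α) : QueryAlg V α
  | degree (v : V) (k : ℝ≥0 → QueryAlg V α) : QueryAlg V α
  | sample (p : PMF V) (k : V → QueryAlg V α) : QueryAlg V α

/-- The answer to a neighbor query at `v`: a uniformly random neighbor, `none` if there is none. -/
def neighborAnswer {V : Type u} [Fintype V] (G : SimpleGraph V) [DecidableRel G.Adj] (v : V) :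
    PMF (Option V) :=
  if h : (G.neighborFinset v).Nonempty then (PMF.uniformOfFinset _ h).map some
  else PMF.pure none

/-- Increase the query counter by one. -/
def tick {α : Type v} (x : α × ℕ) : α × ℕ := (x.1, x.2 + 1)

namespace QueryAlg

variable {V : Type u} {α : Type v} {β : Type w}

/-- Sequential composition: run the first algorithm, pass its output to the second one. -/
def bind : QueryAlg V α → (α → QueryAlg V β) → QueryAlg V β
  | ret a, f => f a
  | vertex k, f => vertex fun v => (k v).bind f
  | neighbor v k, f => neighbor v fun o => (k o).bind f
  | degree v k, f => degree v fun x => (k x).bind f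
  | sample p k, f => sample p fun v => (k v).bind f

/-- Run an algorithm `t` times with fresh randomness, collecting the outputs. -/
def iterate (A : QueryAlg V α) : ℕ → QueryAlg V (List α)
  | 0 => ret []
  | t + 1 => A.bind fun a => (A.iterate t).bind fun l => ret (a :: l)

/-- The joint distribution of the output and of the number of queries (vertex, neighbor and
degree queries) when the algorithm is run on `G`. Internal coins are free. -/
def run [Fintype V] [Nonempty V] (G : SimpleGraph V) [DecidableRel G.Adj] :
    QueryAlg V α → PMF (α × ℕ)
  | ret a => PMF.pure (a, 0)
  | vertex k => (PMF.uniformOfFintype V).bind fun v => ((k v).run G).map tick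
  | neighbor v k => (neighborAnswer G v).bind fun o => ((k o).run G).map tick
  | degree v k => ((k (G.degree v : ℝ≥0)).run G).map tick
  | sample p k => p.bind fun v => (k v).run G

/-- The algorithm is legal in the Hidden Degrees Model: it makes no degree queries. -/
def NoDegreeQueries : QueryAlg V α → Prop
  | ret _ => True
  | vertex k => ∀ v, (k v).NoDegreeQueries
  | neighbor _ k => ∀ o, (k o).NoDegreeQueries
  | degree _ _ => False
  | sample _ k => ∀ v, (k v).NoDegreeQueries

/-- All queries of the algorithm are neighbor queries at the vertex `v`. -/
def OnlyNeighborsOf (v : V) : QueryAlg V α → Prop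
  | ret _ => True
  | vertex _ => False
  | neighbor w k => w = v ∧ ∀ o, (k o).OnlyNeighborsOf v
  | degree _ _ => False
  | sample _ k => ∀ w, (k w).OnlyNeighborsOf v

open Classical in
/-- Replace every degree query at a vertex `v` by a call to the subroutine `deg v`. The result
of the first call for `v` is stored in the table `c`, so that later calls for `v` return the same
value and make no further queries. -/
def simulateDegrees (deg : V → QueryAlg V ℝ≥0) :
    QueryAlg V α → (V → Option ℝ≥0) → QueryAlg V α
  | ret a, _ => ret a
  | vertex k, c => vertex fun v => (k v).simulateDegrees deg c
  | neighbor v k, c => neighbor v fun o => (k o).simulateDegrees deg c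
  | degree v k, c =>
    match c v with
    | some x => (k x).simulateDegrees deg c
    | none => (deg v).bind fun x => (k x).simulateDegrees deg (Function.update c v (some x))
  | sample p k, c => sample p fun v => (k v).simulateDegrees deg c

/-- The probability that the output of the algorithm on `G` satisfies `P`. -/
def prob [Fintype V] [Nonempty V] (G : SimpleGraph V) [DecidableRel G.Adj]
    (A : QueryAlg V α) (P : α → Prop) : ℝ≥0∞ :=
  (A.run G).toOuterMeasure {x | P x.1}

/-- The expected number of queries of the algorithm on `G`. -/
def expectedQueries [Fintype V] [Nonempty V] (G : SimpleGraph V) [DecidableRel G.Adj]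
    (A : QueryAlg V α) : ℝ≥0∞ :=
  ∑' x : α × ℕ, A.run G x * (x.2 : ℝ≥0∞)

/-- The number of queries of the algorithm on `G` is at most `B`, whatever the random choices. -/
def QueriesAtMost [Fintype V] [Nonempty V] (G : SimpleGraph V) [DecidableRel G.Adj]
    (A : QueryAlg V α) (B : ℝ) : Prop :=
  ∀ x ∈ (A.run G).support, (x.2 : ℝ) ≤ B

end QueryAlg

/-! ### SADDLES -/

open QueryAlg

/-- The median of a list of reals (the mean of the two middle values for even length). -/
def listMedian (l : List ℝ) : ℝ :=
  let s := (l : Multiset ℝ).sort (· ≤ ·)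
  (s.getD ((l.length - 1) / 2) 0 + s.getD (l.length / 2) 0) / 2

/-- A vertex sample: a uniformly random vertex together with its degree. -/
def vertexSample (V : Type u) : QueryAlg V (V × ℝ≥0) :=
  vertex fun v => degree v fun x => ret (v, x)

/-- The distribution on a list `R` of vertices `v` with degree values `x`, in which an entry
`(v, x)` is selected with probability proportional to `x`. -/
def degreeWeighted {V : Type u} (R : List (V × ℝ≥0))
    (h : ∑' i : Fin R.length, ((R.get i).2 : ℝ≥0∞) ≠ 0) : PMF V :=
  (PMF.normalize (fun i : Fin R.length => ((R.get i).2 : ℝ≥0∞)) h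
    (by rw [tsum_fintype]; exact ENNReal.sum_ne_top.2 fun _ _ => ENNReal.coe_ne_top)).map
    fun i => (R.get i).1

open Classical in
/-- An edge sample: select `v` from `R` with probability proportional to its degree value, then a
uniformly random neighbor `u` of `v`; return the degree of `u`. If there is nothing to select
(all sampled vertices are isolated), return `0`. -/
def edgeSample {V : Type u} (R : List (V × ℝ≥0)) : QueryAlg V ℝ≥0 :=
  if h : ∑' i : Fin R.length, ((R.get i).2 : ℝ≥0∞) ≠ 0 then
    sample (degreeWeighted R h) fun v => neighbor v fun o =>
      match o with
      | some u => degree u fun y => ret y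
      | none => ret 0
  else ret 0

/-- The estimate of `N(d)` from the vertex samples `R` and the degrees `Y` of the `q` sampled edge
endpoints. If at least `cutoff` of the `r` sampled vertices have degree at least `d`, the rescaled
number of those; otherwise `(n / r) (d_R / q) ∑ Y_d`, where `d_R` is the sum of the degrees in
`R` and an endpoint of degree `y` contributes `Y_d = 1 / y` if `y ≥ d`, and `0` otherwise. -/
def roundEstimate {V : Type u} (n r q : ℕ) (cutoff : ℝ) (R : List (V × ℝ≥0)) (Y : List ℝ≥0)
    (d : ℕ) : ℝ :=
  let X : ℝ := (R.map fun p => if (d : ℝ≥0) ≤ p.2 then (1 : ℝ) else 0).sum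
  if cutoff ≤ X then (n : ℝ) / r * X
  else (n : ℝ) / r * ((R.map fun p => (p.2 : ℝ)).sum / q) *
    (Y.map fun y => if (d : ℝ≥0) ≤ y then 1 / (y : ℝ) else 0).sum

/-- One round of SADDLES: `r` vertex samples, then `q` edge samples, then the estimates. -/
def saddlesRound (V : Type u) [Fintype V] (r q : ℕ) (cutoff : ℝ) : QueryAlg V (ℕ → ℝ) :=
  ((vertexSample V).iterate r).bind fun R =>
    ((edgeSample R).iterate q).bind fun Y =>
      ret fun d => roundEstimate (Fintype.card V) r q cutoff R Y d

/-- SADDLES in the Standard Model: `ℓ` independent rounds, and the median of the `ℓ` estimates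
for every `d`. -/
def saddlesSM (V : Type u) [Fintype V] (r q ℓ : ℕ) (cutoff : ℝ) : QueryAlg V (ℕ → ℝ) :=
  ((saddlesRound V r q cutoff).iterate ℓ).bind fun L =>
    ret fun d => listMedian (L.map fun Nt => Nt d)

/-- SADDLES in the Hidden Degrees Model: every degree is estimated by the subroutine `deg`,
called at most once for each vertex. -/
def saddlesHDM (V : Type u) [Fintype V] (deg : V → QueryAlg V ℝ≥0) (r q ℓ : ℕ) (cutoff : ℝ) :
    QueryAlg V (ℕ → ℝ) :=
  (saddlesSM V r q ℓ cutoff).simulateDegrees deg fun _ => none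

/-- `deg` is a degree estimator with precision `α` for graphs on `V`: `deg v` makes only neighbor
queries at `v`, and on every graph its output lies in `(1 ± α) d_v` with probability greater
than `1 - 1 / n ^ 3`. -/
def IsDegreeEstimator (V : Type u) [Fintype V] [Nonempty V] (α : ℝ)
    (deg : V → QueryAlg V ℝ≥0) : Prop :=
  (∀ v, (deg v).OnlyNeighborsOf v) ∧
  ∀ (G : SimpleGraph V) [DecidableRel G.Adj] (v : V),
    1 - ((Fintype.card V : ℝ≥0∞) ^ 3)⁻¹ <
      (deg v).prob G fun x =>
        (1 - α) * (G.degree v : ℝ) ≤ (x : ℝ) ∧ (x : ℝ) ≤ (1 + α) * (G.degree v : ℝ)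

end

/-!
SADDLES estimates `N(d)` in two ways. If many of the `r` sampled vertices have degree at least `d`,
their rescaled number is concentrated. Otherwise `d` is large, and the edge estimate is used: an
edge end `u` with `D u ≥ d` carries weight `1 / D u`, so by double counting the weights of all
ordered edges add up to about `N(d)`, while no single edge weighs more than `1 / d`. Chebyshev's
inequality shows that `r` vertices and `q` edges suffice for a failure probability of `1 / 8` per
round as soon as `r d` is large compared with `n` and `q d N(d)` is large compared with the degree
sum (`ev_saddlesRound_le`). The median of logarithmically many rounds then fails with polynomially
small probability, for all `d ≤ 2 n` at once (`ev_median_le`, `ev_saddlesSM_le`); no vertex has a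
larger degree value, and there the estimate is exactly `0`.

The power law enters through two bounds. If few among `n ^ (1 - 1 / γ)` sampled vertices have degree
at least `d`, then `d` is of order at least `n ^ (1 / γ)` (`vertex_sample_size`). And `d N(d)` is of
order at least `n ^ (1 / (γ - 1))` for every `d` with `N(d) ≠ 0` (`fatness_le`): up to that threshold
by the power law, beyond it because `N(d) ≥ 1`. These give the sample sizes, and with them the query
bound of the Standard Model.

In the Hidden Degrees Model, `collisionDegree` finds the degree `d` of a vertex by testing random
neighbors for membership in a random set of neighbors of doubling size. By the birthday argument,
enough collisions appear once the set has order `√d` elements, so that the expected cost is of order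
`√d` up to logarithms (`meanQueries_degreeSearch_le`). Since the results of the calls are stored, a
run with this subroutine is distributed as a run with a table of degree values drawn beforehand
(`ev_simulateDegrees`). Hence correctness reduces to the case of an accurate table, and the expected
cost is the sum over the vertices of the cost of one call times the probability that the degree is
asked for (`meanQueries_simulateDegrees_le`). An edge sample hits `v` with probability proportional
to `degree v`, provided that the degree sum of the vertex sample is not much smaller than its mean.
This lower tail does not follow from a variance bound, as a few vertices may carry most of the
degrees; it is exponentially small because the number of neighbors of `v` of degree at least
`degree v` is at most the square root of the degree sum `M`, and these numbers add up to at least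
half of `M` (`ev_degreeSum_lower_tail`). Bounding the probability `min 1 x` of a call by `√x` makes
the cost `√(degree v)` of a call combine with it to a multiple of `degree v` (`sum_cost_mul_le`).

All probabilities are handled as real-valued expectations `QueryAlg.ev G D A f`, in which the degree
queries are answered from a table `D`, either of true or of estimated degrees.
-/

set_option linter.unusedSectionVars false

/-! ### Expectations as finite sums -/

namespace PMF

variable {ι : Type u} [Fintype ι]

/-- The expectation of a real function under a distribution on a finite type, as a finite sum. -/
noncomputable def mean (p : PMF ι) (F : ι → ℝ) : ℝ := ∑ a, (p a).toReal * F a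

lemma sum_toReal (p : PMF ι) : ∑ a, (p a).toReal = 1 := by
  rw [← ENNReal.toReal_sum (fun a _ => p.apply_ne_top a), ← tsum_fintype (L := .unconditional _), p.tsum_coe]
  rfl

lemma mean_const (p : PMF ι) (c : ℝ) : p.mean (fun _ => c) = c := by
  simp [mean, ← Finset.sum_mul, p.sum_toReal]

lemma mean_add (p : PMF ι) (F F' : ι → ℝ) :
    p.mean (fun a => F a + F' a) = p.mean F + p.mean F' := by
  simp [mean, mul_add, Finset.sum_add_distrib]

lemma mean_mul_left (p : PMF ι) (c : ℝ) (F : ι → ℝ) :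
    p.mean (fun a => c * F a) = c * p.mean F := by
  simp [mean, Finset.mul_sum, mul_left_comm]

lemma mean_mono (p : PMF ι) {F F' : ι → ℝ} (h : ∀ a, p a ≠ 0 → F a ≤ F' a) :
    p.mean F ≤ p.mean F' := by
  refine Finset.sum_le_sum fun a _ => ?_
  by_cases ha : p a = 0
  · simp [ha]
  · exact mul_le_mul_of_nonneg_left (h a ha) ENNReal.toReal_nonneg

lemma mean_nonneg (p : PMF ι) {F : ι → ℝ} (h : ∀ a, 0 ≤ F a) : 0 ≤ p.mean F :=
  Finset.sum_nonneg fun a _ => mul_nonneg ENNReal.toReal_nonneg (h a)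

lemma tsum_mul_ofReal (p : PMF ι) {F : ι → ℝ} (h : ∀ a, 0 ≤ F a) :
    ∑' a, p a * ENNReal.ofReal (F a) = ENNReal.ofReal (p.mean F) := by
  rw [tsum_fintype, mean, ENNReal.ofReal_sum_of_nonneg
    fun a _ => mul_nonneg ENNReal.toReal_nonneg (h a)]
  refine Finset.sum_congr rfl fun a _ => ?_
  rw [ENNReal.ofReal_mul ENNReal.toReal_nonneg, ENNReal.ofReal_toReal (p.apply_ne_top a)]

lemma mean_uniformOfFintype [Nonempty ι] (F : ι → ℝ) :
    (PMF.uniformOfFintype ι).mean F = (∑ a, F a) / Fintype.card ι := by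
  simp [mean, div_eq_inv_mul, Finset.mul_sum]

lemma tsum_pure_mul {κ : Type v} (a : κ) (F : κ → ℝ≥0∞) :
    ∑' x, PMF.pure a x * F x = F a := by
  rw [tsum_eq_single a]
  · simp
  · intro b hb
    simp [PMF.pure_apply, hb]

lemma tsum_bind_mul {κ : Type v} {κ' : Type w} (p : PMF κ) (g : κ → PMF κ') (F : κ' → ℝ≥0∞) :
    ∑' x, p.bind g x * F x = ∑' a, p a * ∑' x, g a x * F x := by
  simp_rw [PMF.bind_apply, ← ENNReal.tsum_mul_right, ← ENNReal.tsum_mul_left]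
  rw [ENNReal.tsum_comm]
  simp_rw [mul_assoc]

lemma tsum_map_mul {κ : Type v} {κ' : Type w} (p : PMF κ) (g : κ → κ') (F : κ' → ℝ≥0∞) :
    ∑' x, p.map g x * F x = ∑' a, p a * F (g a) := by
  rw [PMF.map, tsum_bind_mul]
  simp only [Function.comp, tsum_pure_mul]

end PMF

/-- The mean of a function of the answer to a neighbor query at a non-isolated vertex. -/
lemma neighborAnswer_mean {V : Type u} [Fintype V] (G : SimpleGraph V) [DecidableRel G.Adj]
    {v : V} (hv : G.degree v ≠ 0) (F : Option V → ℝ) :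
    (neighborAnswer G v).mean F = (∑ u ∈ G.neighborFinset v, F (some u)) / G.degree v := by
  classical
  have h : (G.neighborFinset v).Nonempty := by
    rw [← Finset.card_pos, G.card_neighborFinset_eq_degree]; omega
  rw [neighborAnswer, dif_pos h, PMF.mean, Fintype.sum_option]
  have h0 : (PMF.map some (PMF.uniformOfFinset _ h)) none = 0 := by
    simp [PMF.map_apply]
  have h1 : ∀ u, (PMF.map some (PMF.uniformOfFinset _ h)) (some u) =
      PMF.uniformOfFinset _ h u := by
    intro u
    rw [PMF.map_apply, tsum_eq_single u]
    · simp
    · intro b hb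
      simp [Ne.symm hb]
  rw [h0, Finset.sum_div, ← Finset.sum_subset (Finset.subset_univ (G.neighborFinset v))]
  · simp only [ENNReal.toReal_zero, zero_mul, zero_add]
    refine Finset.sum_congr rfl fun u hu => ?_
    rw [h1, PMF.uniformOfFinset_apply_of_mem h hu, G.card_neighborFinset_eq_degree]
    simp [div_eq_inv_mul]
  · intro u _ hu
    rw [h1, PMF.uniformOfFinset_apply_of_notMem h hu]
    simp

lemma neighborAnswer_ne_zero {V : Type u} [Fintype V] (G : SimpleGraph V) [DecidableRel G.Adj]
    {v : V} (hv : G.degree v ≠ 0) {o : Option V} (ho : neighborAnswer G v o ≠ 0) :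
    ∃ u ∈ G.neighborFinset v, o = some u := by
  have h : (G.neighborFinset v).Nonempty := by
    rw [← Finset.card_pos, G.card_neighborFinset_eq_degree]; omega
  rw [neighborAnswer, dif_pos h, ← PMF.mem_support_iff, PMF.mem_support_map_iff] at ho
  obtain ⟨u, hu, rfl⟩ := ho
  exact ⟨u, by simpa using hu, rfl⟩

lemma neighborAnswer_of_degree_eq_zero {V : Type u} [Fintype V] (G : SimpleGraph V)
    [DecidableRel G.Adj] {v : V} (hv : G.degree v = 0) : neighborAnswer G v = PMF.pure none := by
  have h : ¬ (G.neighborFinset v).Nonempty := by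
    rw [← Finset.card_pos, G.card_neighborFinset_eq_degree]; omega
  rw [neighborAnswer, dif_neg h]

/-! ### Expectations of query algorithms -/

namespace QueryAlg

variable {V : Type u} {α : Type v} {β : Type w} [Fintype V] [Nonempty V]
variable (G : SimpleGraph V) [DecidableRel G.Adj] (D : V → ℝ≥0)

/-- The expectation of `f` of the output when the algorithm runs on `G` and degree queries are
answered from the table `D`. All distributions involved have finite support, so this is a
real-valued finite sum. -/
noncomputable def ev : QueryAlg V α → (α → ℝ) → ℝ
  | ret a, f => f a
  | vertex k, f => (PMF.uniformOfFintype V).mean fun v => (k v).ev f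
  | neighbor v k, f => (neighborAnswer G v).mean fun o => (k o).ev f
  | degree v k, f => (k (D v)).ev f
  | sample p k, f => p.mean fun v => (k v).ev f

/-- The expected number of queries when degree queries are answered from the table `D`. -/
noncomputable def meanQueries : QueryAlg V α → ℝ
  | ret _ => 0
  | vertex k => 1 + (PMF.uniformOfFintype V).mean fun v => (k v).meanQueries
  | neighbor v k => 1 + (neighborAnswer G v).mean fun o => (k o).meanQueries
  | degree v k => 1 + (k (D v)).meanQueries
  | sample p k => p.mean fun v => (k v).meanQueries

/-- Every output that occurs with positive probability satisfies `P`. -/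
def Reach : QueryAlg V α → (α → Prop) → Prop
  | ret a, P => P a
  | vertex k, P => ∀ v, (k v).Reach P
  | neighbor v k, P => ∀ o, neighborAnswer G v o ≠ 0 → (k o).Reach P
  | degree v k, P => (k (D v)).Reach P
  | sample p k, P => ∀ v, p v ≠ 0 → (k v).Reach P

/-- Every run makes at most `b` queries, whatever the answers. -/
def QueriesLE : QueryAlg V α → ℕ → Prop
  | ret _, _ => True
  | vertex k, b => 1 ≤ b ∧ ∀ v, (k v).QueriesLE (b - 1)
  | neighbor _ k, b => 1 ≤ b ∧ ∀ o, (k o).QueriesLE (b - 1)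
  | degree _ k, b => 1 ≤ b ∧ ∀ x, (k x).QueriesLE (b - 1)
  | sample _ k, b => ∀ v, (k v).QueriesLE b

variable {G D}

lemma ev_bind (A : QueryAlg V α) (g : α → QueryAlg V β) (f : β → ℝ) :
    (A.bind g).ev G D f = A.ev G D fun a => (g a).ev G D f := by
  induction A with
  | ret a => rfl
  | vertex k ih => simp only [bind, ev, ih]
  | neighbor v k ih => simp only [bind, ev, ih]
  | degree v k ih => simp only [bind, ev, ih]
  | sample p k ih => simp only [bind, ev, ih]

lemma ev_mono_of_reach (A : QueryAlg V α) {f g : α → ℝ} (h : A.Reach G D fun a => f a ≤ g a) :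
    A.ev G D f ≤ A.ev G D g := by
  induction A with
  | ret a => exact h
  | vertex k ih => exact PMF.mean_mono _ fun v _ => ih v (h v)
  | neighbor v k ih => exact PMF.mean_mono _ fun o ho => ih o (h o ho)
  | degree v k ih => exact ih _ h
  | sample p k ih => exact PMF.mean_mono _ fun v hv => ih v (h v hv)

lemma reach_of_forall (A : QueryAlg V α) {P : α → Prop} (h : ∀ a, P a) : A.Reach G D P := by
  induction A with
  | ret a => exact h a
  | vertex k ih => exact fun v => ih v
  | neighbor v k ih => exact fun o _ => ih o
  | degree v k ih => exact ih _
  | sample p k ih => exact fun v _ => ih v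

lemma Reach.mono {A : QueryAlg V α} {P Q : α → Prop} (h : A.Reach G D P)
    (hPQ : ∀ a, P a → Q a) : A.Reach G D Q := by
  induction A with
  | ret a => exact hPQ a h
  | vertex k ih => exact fun v => ih v (h v)
  | neighbor v k ih => exact fun o ho => ih o (h o ho)
  | degree v k ih => exact ih _ h
  | sample p k ih => exact fun v hv => ih v (h v hv)

lemma Reach.bind {A : QueryAlg V α} {g : α → QueryAlg V β} {P : α → Prop} {Q : β → Prop}
    (h : A.Reach G D P) (hg : ∀ a, P a → (g a).Reach G D Q) : (A.bind g).Reach G D Q := by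
  induction A with
  | ret a => exact hg a h
  | vertex k ih => exact fun v => ih v (h v)
  | neighbor v k ih => exact fun o ho => ih o (h o ho)
  | degree v k ih => exact ih _ h
  | sample p k ih => exact fun v hv => ih v (h v hv)

lemma ev_mono (A : QueryAlg V α) {f g : α → ℝ} (h : ∀ a, f a ≤ g a) :
    A.ev G D f ≤ A.ev G D g :=
  A.ev_mono_of_reach (A.reach_of_forall h)

lemma ev_const (A : QueryAlg V α) (c : ℝ) : A.ev G D (fun _ => c) = c := by
  induction A with
  | ret a => rfl
  | vertex k ih => simp only [ev, ih, PMF.mean_const]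
  | neighbor v k ih => simp only [ev, ih, PMF.mean_const]
  | degree v k ih => simp only [ev, ih]
  | sample p k ih => simp only [ev, ih, PMF.mean_const]

lemma ev_add (A : QueryAlg V α) (f g : α → ℝ) :
    A.ev G D (fun a => f a + g a) = A.ev G D f + A.ev G D g := by
  induction A with
  | ret a => rfl
  | vertex k ih => simp only [ev, ih, PMF.mean_add]
  | neighbor v k ih => simp only [ev, ih, PMF.mean_add]
  | degree v k ih => simp only [ev, ih]
  | sample p k ih => simp only [ev, ih, PMF.mean_add]

lemma ev_mul_left (A : QueryAlg V α) (c : ℝ) (f : α → ℝ) :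
    A.ev G D (fun a => c * f a) = c * A.ev G D f := by
  induction A with
  | ret a => rfl
  | vertex k ih => simp only [ev, ih, PMF.mean_mul_left]
  | neighbor v k ih => simp only [ev, ih, PMF.mean_mul_left]
  | degree v k ih => simp only [ev, ih]
  | sample p k ih => simp only [ev, ih, PMF.mean_mul_left]

lemma ev_mul_right (A : QueryAlg V α) (c : ℝ) (f : α → ℝ) :
    A.ev G D (fun a => f a * c) = A.ev G D f * c := by
  simp only [mul_comm _ c, ev_mul_left]

lemma ev_div (A : QueryAlg V α) (c : ℝ) (f : α → ℝ) :
    A.ev G D (fun a => f a / c) = A.ev G D f / c := by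
  simp only [div_eq_mul_inv, ev_mul_right]

lemma ev_sub (A : QueryAlg V α) (f g : α → ℝ) :
    A.ev G D (fun a => f a - g a) = A.ev G D f - A.ev G D g := by
  have := A.ev_add (G := G) (D := D) (fun a => f a - g a) g
  simp only [sub_add_cancel] at this
  linarith

lemma ev_nonneg (A : QueryAlg V α) {f : α → ℝ} (h : ∀ a, 0 ≤ f a) : 0 ≤ A.ev G D f := by
  rw [← A.ev_const (G := G) (D := D) 0]
  exact A.ev_mono h

lemma ev_le_of_reach (A : QueryAlg V α) {f : α → ℝ} {c : ℝ}
    (h : A.Reach G D fun a => f a ≤ c) : A.ev G D f ≤ c :=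
  (A.ev_mono_of_reach h).trans_eq (A.ev_const c)

lemma ev_sum {ι : Type*} (A : QueryAlg V α) (s : Finset ι) (f : ι → α → ℝ) :
    A.ev G D (fun a => ∑ i ∈ s, f i a) = ∑ i ∈ s, A.ev G D (f i) := by
  classical
  induction s using Finset.induction_on with
  | empty => simp [ev_const]
  | insert i s hi ih => simp [Finset.sum_insert hi, ev_add, ih]

lemma ev_mean {ι : Type*} [Fintype ι] (A : QueryAlg V α) (p : PMF ι) (f : ι → α → ℝ) :
    A.ev G D (fun a => p.mean fun i => f i a) = p.mean fun i => A.ev G D (f i) := by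
  simp only [PMF.mean, ev_sum, ev_mul_left]

/-- Fubini's theorem for two independent algorithms. -/
lemma ev_comm {D' : V → ℝ≥0} (A : QueryAlg V α) (B : QueryAlg V β) (f : α → β → ℝ) :
    A.ev G D (fun a => B.ev G D' fun b => f a b) =
      B.ev G D' fun b => A.ev G D fun a => f a b := by
  induction A with
  | ret a => rfl
  | vertex k ih => simp only [ev, ih, ev_mean]
  | neighbor v k ih => simp only [ev, ih, ev_mean]
  | degree v k ih => simp only [ev, ih]
  | sample p k ih => simp only [ev, ih, ev_mean]

lemma meanQueries_nonneg (A : QueryAlg V α) : 0 ≤ A.meanQueries G D := by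
  induction A with
  | ret a => exact le_rfl
  | vertex k ih => exact add_nonneg zero_le_one (PMF.mean_nonneg _ ih)
  | neighbor v k ih => exact add_nonneg zero_le_one (PMF.mean_nonneg _ ih)
  | degree v k ih => exact add_nonneg zero_le_one (ih _)
  | sample p k ih => exact PMF.mean_nonneg _ ih

lemma meanQueries_bind (A : QueryAlg V α) (g : α → QueryAlg V β) :
    (A.bind g).meanQueries G D =
      A.meanQueries G D + A.ev G D fun a => (g a).meanQueries G D := by
  induction A with
  | ret a => simp [bind, meanQueries, ev]
  | vertex k ih => simp only [bind, meanQueries, ev, ih, PMF.mean_add, add_assoc]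
  | neighbor v k ih => simp only [bind, meanQueries, ev, ih, PMF.mean_add, add_assoc]
  | degree v k ih => simp only [bind, meanQueries, ev, ih, add_assoc]
  | sample p k ih => simp only [bind, meanQueries, ev, ih, PMF.mean_add]

lemma QueriesLE.mono {A : QueryAlg V α} {a b : ℕ} (h : A.QueriesLE a) (hab : a ≤ b) :
    A.QueriesLE b := by
  induction A generalizing a b with
  | ret x => trivial
  | vertex k ih => exact ⟨h.1.trans hab, fun v => ih v (h.2 v) (Nat.sub_le_sub_right hab 1)⟩
  | neighbor v k ih => exact ⟨h.1.trans hab, fun v => ih v (h.2 v) (Nat.sub_le_sub_right hab 1)⟩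
  | degree v k ih => exact ⟨h.1.trans hab, fun v => ih v (h.2 v) (Nat.sub_le_sub_right hab 1)⟩
  | sample p k ih => exact fun v => ih v (h v) hab

lemma QueriesLE.bind {A : QueryAlg V α} {g : α → QueryAlg V β} {a b : ℕ}
    (h : A.QueriesLE a) (hg : ∀ x, (g x).QueriesLE b) : (A.bind g).QueriesLE (a + b) := by
  induction A generalizing a with
  | ret x => exact (hg x).mono (Nat.le_add_left _ _)
  | vertex k ih =>
    refine ⟨h.1.trans (Nat.le_add_right _ _), fun v => ?_⟩
    rw [Nat.sub_add_comm h.1]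
    exact ih v (h.2 v)
  | neighbor v k ih =>
    refine ⟨h.1.trans (Nat.le_add_right _ _), fun v => ?_⟩
    rw [Nat.sub_add_comm h.1]
    exact ih v (h.2 v)
  | degree v k ih =>
    refine ⟨h.1.trans (Nat.le_add_right _ _), fun v => ?_⟩
    rw [Nat.sub_add_comm h.1]
    exact ih v (h.2 v)
  | sample p k ih => exact fun v => ih v (h v)

lemma QueriesLE.iterate {A : QueryAlg V α} {a : ℕ} (h : A.QueriesLE a) (t : ℕ) :
    (A.iterate t).QueriesLE (t * a) := by
  induction t with
  | zero => trivial
  | succ t ih =>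
    rw [Nat.succ_mul, Nat.add_comm (t * a)]
    exact h.bind fun x => (ih.bind (g := fun l => ret (x :: l)) (b := 0) fun l => trivial)

/-! ### The link with the distribution of runs -/

variable (G)

/-- The table of the true degrees. -/
def degreeTable : V → ℝ≥0 := fun v => (G.degree v : ℝ≥0)

lemma tsum_run_mul_ofReal (A : QueryAlg V α) {f : α → ℝ} (hf : ∀ a, 0 ≤ f a) :
    ∑' x, A.run G x * ENNReal.ofReal (f x.1) = ENNReal.ofReal (A.ev G (degreeTable G) f) := by
  induction A with
  | ret a => simp only [run, PMF.tsum_pure_mul, ev]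
  | vertex k ih =>
    simp only [run, PMF.tsum_bind_mul, PMF.tsum_map_mul, tick, ih, ev]
    exact PMF.tsum_mul_ofReal _ fun v => ev_nonneg _ hf
  | neighbor v k ih =>
    simp only [run, PMF.tsum_bind_mul, PMF.tsum_map_mul, tick, ih, ev]
    exact PMF.tsum_mul_ofReal _ fun v => ev_nonneg _ hf
  | degree v k ih => simp only [run, PMF.tsum_map_mul, tick, ih, ev, degreeTable]
  | sample p k ih =>
    simp only [run, PMF.tsum_bind_mul, ih, ev]
    exact PMF.tsum_mul_ofReal _ fun v => ev_nonneg _ hf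

open Classical in
lemma prob_eq_ofReal_ev (A : QueryAlg V α) (P : α → Prop) :
    A.prob G P = ENNReal.ofReal (A.ev G (degreeTable G) fun a => if P a then 1 else 0) := by
  rw [← tsum_run_mul_ofReal G A fun a => by split_ifs <;> norm_num, prob,
    PMF.toOuterMeasure_apply]
  refine tsum_congr fun x => ?_
  by_cases hx : P x.1 <;> simp [Set.indicator, hx]

lemma expectedQueries_eq (A : QueryAlg V α) :
    A.expectedQueries G = ENNReal.ofReal (A.meanQueries G (degreeTable G)) := by
  have key : ∀ (B : QueryAlg V α), ∑' x, ((B.run G).map tick) x * (x.2 : ℝ≥0∞) =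
      1 + ∑' x, B.run G x * (x.2 : ℝ≥0∞) := by
    intro B
    rw [PMF.tsum_map_mul]
    simp only [tick, Nat.cast_add, Nat.cast_one, mul_add, mul_one]
    rw [ENNReal.tsum_add, (B.run G).tsum_coe, add_comm]
  have one_add : ∀ {x : ℝ}, 0 ≤ x → ENNReal.ofReal (1 + x) = 1 + ENNReal.ofReal x := by
    intro x hx
    rw [ENNReal.ofReal_add zero_le_one hx, ENNReal.ofReal_one]
  have step : ∀ {ι : Type u} [Fintype ι] (p : PMF ι) (F : ι → ℝ), (∀ a, 0 ≤ F a) →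
      ∑' a, p a * (1 + ENNReal.ofReal (F a)) = ENNReal.ofReal (1 + p.mean F) := by
    intro ι _ p F hF
    simp only [mul_add, mul_one]
    rw [ENNReal.tsum_add, p.tsum_coe, PMF.tsum_mul_ofReal p hF,
      one_add (PMF.mean_nonneg p hF)]
  rw [expectedQueries]
  induction A with
  | ret a => simp [run, meanQueries]
  | vertex k ih =>
    simp only [run, PMF.tsum_bind_mul, key, ih, meanQueries]
    exact step _ _ fun v => meanQueries_nonneg _
  | neighbor v k ih =>
    simp only [run, PMF.tsum_bind_mul, key, ih, meanQueries]
    exact step _ _ fun v => meanQueries_nonneg _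
  | degree v k ih =>
    simp only [run, key, ih, meanQueries]
    exact (one_add (meanQueries_nonneg _)).symm
  | sample p k ih =>
    simp only [run, PMF.tsum_bind_mul, ih, meanQueries]
    exact PMF.tsum_mul_ofReal _ fun v => meanQueries_nonneg _

lemma QueriesLE.queriesAtMost {A : QueryAlg V α} {b : ℕ} (h : A.QueriesLE b) :
    A.QueriesAtMost G b := by
  have key : ∀ x ∈ (A.run G).support, x.2 ≤ b := by
    induction A generalizing b with
    | ret a =>
      intro x hx
      simp only [run, PMF.support_pure, Set.mem_singleton_iff] at hx
      simp [hx]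
    | vertex k ih =>
      intro x hx
      simp only [run, PMF.mem_support_bind_iff, PMF.mem_support_map_iff] at hx
      obtain ⟨v, _, y, hy, rfl⟩ := hx
      have := ih v (h.2 v) y hy
      have := h.1
      simp only [tick]; omega
    | neighbor v k ih =>
      intro x hx
      simp only [run, PMF.mem_support_bind_iff, PMF.mem_support_map_iff] at hx
      obtain ⟨v, _, y, hy, rfl⟩ := hx
      have := ih v (h.2 v) y hy
      have := h.1
      simp only [tick]; omega
    | degree v k ih =>
      intro x hx
      simp only [run, PMF.mem_support_map_iff] at hx
      obtain ⟨y, hy, rfl⟩ := hx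
      have := ih _ (h.2 _) y hy
      have := h.1
      simp only [tick]; omega
    | sample p k ih =>
      intro x hx
      simp only [run, PMF.mem_support_bind_iff] at hx
      obtain ⟨v, _, hy⟩ := hx
      exact ih v (h v) x hy
  exact fun x hx => by exact_mod_cast key x hx

end QueryAlg

/-! ### Independent repetitions -/

namespace QueryAlg

variable {V : Type u} {α : Type v} {β : Type w} [Fintype V] [Nonempty V]
variable {G : SimpleGraph V} [DecidableRel G.Adj] {D : V → ℝ≥0}

lemma ev_iterate_succ (A : QueryAlg V α) (t : ℕ) (F : List α → ℝ) :
    (A.iterate (t + 1)).ev G D F =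
      A.ev G D fun a => (A.iterate t).ev G D fun l => F (a :: l) := by
  simp only [iterate, ev_bind, ev]

lemma reach_iterate (A : QueryAlg V α) {P : α → Prop} (h : A.Reach G D P) (t : ℕ) :
    (A.iterate t).Reach G D fun l => l.length = t ∧ ∀ a ∈ l, P a := by
  induction t with
  | zero => exact ⟨rfl, by simp⟩
  | succ t ih =>
    refine h.bind fun a ha => ih.bind fun l hl => ?_
    refine ⟨by simp [hl.1], ?_⟩
    simpa using ⟨ha, hl.2⟩

lemma ev_iterate_sum (A : QueryAlg V α) (t : ℕ) (g : α → ℝ) :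
    ((A.iterate t).ev G D fun l => (l.map g).sum) = t * A.ev G D g := by
  induction t with
  | zero => simp [iterate, ev]
  | succ t ih =>
    rw [ev_iterate_succ]
    simp only [List.map_cons, List.sum_cons, ev_add, ev_const, ih]
    push_cast; ring

lemma ev_iterate_prod (A : QueryAlg V α) (t : ℕ) (g : α → ℝ) :
    ((A.iterate t).ev G D fun l => (l.map g).prod) = A.ev G D g ^ t := by
  induction t with
  | zero => simp [iterate, ev]
  | succ t ih =>
    rw [ev_iterate_succ]
    simp only [List.map_cons, List.prod_cons, ev_mul_left, ih, ev_mul_right]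
    ring

/-- The variance of a sum of independent copies is at most the sum of the second moments. -/
lemma ev_iterate_sq_le (A : QueryAlg V α) (t : ℕ) (g : α → ℝ) :
    ((A.iterate t).ev G D fun l => ((l.map g).sum - t * A.ev G D g) ^ 2) ≤
      t * A.ev G D fun a => g a ^ 2 := by
  set μ := A.ev G D g with hμ
  have hv : (A.ev G D fun a => (g a - μ) ^ 2) ≤ A.ev G D fun a => g a ^ 2 := by
    have : (A.ev G D fun a => (g a - μ) ^ 2) = (A.ev G D fun a => g a ^ 2) - μ ^ 2 := by
      have e : ∀ a, (g a - μ) ^ 2 = g a ^ 2 + ((-2 * μ) * g a + μ ^ 2) := fun a => by ring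
      simp only [e, ev_add, ev_mul_left, ev_const, ← hμ]
      ring
    rw [this]
    nlinarith [sq_nonneg μ]
  suffices h : ((A.iterate t).ev G D fun l => ((l.map g).sum - t * μ) ^ 2) =
      t * A.ev G D fun a => (g a - μ) ^ 2 by
    rw [h]
    exact mul_le_mul_of_nonneg_left hv (Nat.cast_nonneg t)
  induction t with
  | zero => simp [iterate, ev]
  | succ t ih =>
    rw [ev_iterate_succ]
    have e : ∀ a (l : List α), (((a :: l).map g).sum - ((t + 1 : ℕ) : ℝ) * μ) ^ 2 =
        (g a - μ) ^ 2 + ((2 * (g a - μ)) * ((l.map g).sum - t * μ) +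
          ((l.map g).sum - t * μ) ^ 2) := by
      intro a l
      simp only [List.map_cons, List.sum_cons]
      push_cast; ring
    simp only [e, ev_add, ev_mul_left, ev_const, ev_sub, ev_iterate_sum, ih, ← hμ, sub_self,
      mul_zero]
    push_cast; ring

end QueryAlg

/-! ### Lists and medians -/

lemma List.prod_map_ite_one_right {α : Type u} (P : α → Prop) [DecidablePred P] (x : ℝ) (l : List α) :
    (l.map fun a => if P a then x else 1).prod = x ^ (l.filter fun a => P a).length := by
  induction l with
  | nil => simp
  | cons a l ih =>
    by_cases h : P a
    · simp [h, ih, pow_succ']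
    · simp [h, ih]

/-- In a sorted list, an entry below `lo` forces all earlier entries below `lo`; if fewer than
half of the entries leave `[lo, hi]`, the two middle entries lie in `[lo, hi]`. -/
lemma listMedian_mem {l : List ℝ} {lo hi : ℝ}
    (h : 2 * (l.filter fun x => ¬ (lo ≤ x ∧ x ≤ hi)).length < l.length) :
    lo ≤ listMedian l ∧ listMedian l ≤ hi := by
  classical
  set s := (l : Multiset ℝ).sort (· ≤ ·) with hs
  have hperm : s.Perm l := by
    rw [← Multiset.coe_eq_coe, hs, Multiset.sort_eq]
  have hsorted : s.Pairwise (· ≤ ·) := Multiset.pairwise_sort _ _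
  have hlen : s.length = l.length := hperm.length_eq
  have hfil : (s.filter fun x => ¬ (lo ≤ x ∧ x ≤ hi)).length =
      (l.filter fun x => ¬ (lo ≤ x ∧ x ≤ hi)).length := (hperm.filter _).length_eq
  have hmono : ∀ i j (hi' : i < s.length) (hj : j < s.length), i ≤ j → s[i] ≤ s[j] := by
    intro i j hi' hj hij
    rcases hij.eq_or_lt with rfl | hlt
    · exact le_rfl
    · exact List.pairwise_iff_getElem.1 hsorted i j hi' hj hlt
  have key : ∀ i (hi' : i < s.length), s.length ≤ 2 * (i + 1) → 2 * i ≤ s.length →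
      lo ≤ s[i] ∧ s[i] ≤ hi := by
    intro i hi' h1 h2
    constructor
    · by_contra hlo
      push Not at hlo
      have hsub : (s.take (i + 1)).filter (fun x => ¬ (lo ≤ x ∧ x ≤ hi)) = s.take (i + 1) := by
        rw [List.filter_eq_self]
        intro x hx
        obtain ⟨j, hj, rfl⟩ := List.mem_iff_getElem.1 hx
        rw [List.length_take] at hj
        have := hmono j i (by omega) hi' (by omega)
        simp only [List.getElem_take, decide_eq_true_eq]
        intro hc
        linarith [hc.1]
      have hle := ((List.take_sublist (i + 1) s).filter
        fun x => ¬ (lo ≤ x ∧ x ≤ hi)).length_le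
      rw [hsub, List.length_take] at hle
      omega
    · by_contra hhi
      push Not at hhi
      have hsub : (s.drop i).filter (fun x => ¬ (lo ≤ x ∧ x ≤ hi)) = s.drop i := by
        rw [List.filter_eq_self]
        intro x hx
        obtain ⟨j, hj, rfl⟩ := List.mem_iff_getElem.1 hx
        rw [List.length_drop] at hj
        have := hmono i (i + j) hi' (by omega) (by omega)
        simp only [List.getElem_drop, decide_eq_true_eq]
        intro hc
        linarith [hc.2]
      have hle := ((List.drop_sublist i s).filter
        fun x => ¬ (lo ≤ x ∧ x ≤ hi)).length_le
      rw [hsub, List.length_drop] at hle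
      omega
  have hpos : 0 < l.length := by omega
  have e1 : s.getD ((l.length - 1) / 2) 0 = s[(l.length - 1) / 2]'(by omega) := by
    rw [List.getD_eq_getElem]
  have e2 : s.getD (l.length / 2) 0 = s[l.length / 2]'(by omega) := by
    rw [List.getD_eq_getElem]
  have k1 := key ((l.length - 1) / 2) (by omega) (by omega) (by omega)
  have k2 := key (l.length / 2) (by omega) (by omega) (by omega)
  have hmed : listMedian l = (s[(l.length - 1) / 2]'(by omega) + s[l.length / 2]'(by omega)) / 2 := by
    rw [← e1, ← e2]; rfl
  rw [hmed]
  constructor <;> linarith [k1.1, k1.2, k2.1, k2.2]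

namespace QueryAlg

variable {V : Type u} {α : Type v} [Fintype V] [Nonempty V]
variable {G : SimpleGraph V} [DecidableRel G.Adj] {D : V → ℝ≥0}

open Classical in
/-- The median of `ℓ` independent estimates misses an interval with probability exponentially
small in `ℓ`, if a single estimate misses it with probability at most `1 / 8`. The bound is
Markov's inequality for `4 ^ b`, where `b` is the number of misses. -/
lemma ev_median_le (A : QueryAlg V α) (ℓ : ℕ) (g : α → ℝ) (lo hi : ℝ)
    (h : (A.ev G D fun a => if lo ≤ g a ∧ g a ≤ hi then 0 else 1) ≤ 1 / 8) :
    ((A.iterate ℓ).ev G D fun L =>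
      if lo ≤ listMedian (L.map g) ∧ listMedian (L.map g) ≤ hi then 0 else 1) ≤
      (11 / 16) ^ ℓ := by
  have h1 : ((A.iterate ℓ).ev G D fun L =>
      if lo ≤ listMedian (L.map g) ∧ listMedian (L.map g) ≤ hi then 0 else 1) ≤
      (A.iterate ℓ).ev G D fun L =>
        ((1 / 2 : ℝ) ^ ℓ) * (L.map fun a => if ¬ (lo ≤ g a ∧ g a ≤ hi) then (4 : ℝ) else 1).prod := by
    refine ev_mono_of_reach _ ((reach_iterate A (P := fun _ => True)
      (reach_of_forall _ fun _ => trivial) ℓ).mono ?_)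
    rintro L ⟨hL, -⟩
    rw [List.prod_map_ite_one_right]
    split_ifs with hm
    · positivity
    · have h2 : ℓ ≤ 2 * (L.filter fun a => ¬ (lo ≤ g a ∧ g a ≤ hi)).length := by
        by_contra hc
        rw [not_le] at hc
        refine hm (listMedian_mem ?_)
        rw [List.filter_map, List.length_map, List.length_map, hL]
        exact hc
      have h3 : (4 : ℝ) ^ (L.filter fun a => ¬ (lo ≤ g a ∧ g a ≤ hi)).length =
          2 ^ (2 * (L.filter fun a => ¬ (lo ≤ g a ∧ g a ≤ hi)).length) := by
        rw [pow_mul]; norm_num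
      rw [h3, one_div, inv_pow]
      have h4 : (2 : ℝ) ^ ℓ ≤ 2 ^ (2 * (L.filter fun a => ¬ (lo ≤ g a ∧ g a ≤ hi)).length) :=
        pow_le_pow_right₀ (by norm_num) h2
      rw [← div_eq_inv_mul, le_div_iff₀ (by positivity)]
      linarith
  refine h1.trans ?_
  rw [ev_mul_left, ev_iterate_prod, ← mul_pow]
  have h5 : (A.ev G D fun a => if ¬ (lo ≤ g a ∧ g a ≤ hi) then (4 : ℝ) else 1) =
      1 + 3 * A.ev G D fun a => if lo ≤ g a ∧ g a ≤ hi then 0 else 1 := by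
    have e : ∀ a, (if ¬ (lo ≤ g a ∧ g a ≤ hi) then (4 : ℝ) else 1) =
        1 + 3 * (if lo ≤ g a ∧ g a ≤ hi then 0 else 1) := by
      intro a
      by_cases hc : lo ≤ g a ∧ g a ≤ hi
      · simp [hc]
      · simp [hc]; norm_num
    rw [funext e, ev_add, ev_mul_left, ev_const]
  have h6 : 0 ≤ A.ev G D fun a => if lo ≤ g a ∧ g a ≤ hi then (0 : ℝ) else 1 :=
    ev_nonneg _ fun a => by split_ifs <;> norm_num
  rw [h5]
  exact pow_le_pow_left₀ (by linarith) (by linarith) ℓ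

end QueryAlg

/-! ### Replacing degree queries by a subroutine -/

namespace QueryAlg

variable {V : Type u} {α : Type v} {β : Type w}

lemma NoDegreeQueries.bind {A : QueryAlg V α} {g : α → QueryAlg V β} (h : A.NoDegreeQueries)
    (hg : ∀ a, (g a).NoDegreeQueries) : (A.bind g).NoDegreeQueries := by
  induction A with
  | ret a => exact hg a
  | vertex k ih => exact fun v => ih v (h v)
  | neighbor v k ih => exact fun v => ih v (h v)
  | degree v k ih => exact h.elim
  | sample p k ih => exact fun v => ih v (h v)

lemma OnlyNeighborsOf.bind {v : V} {A : QueryAlg V α} {g : α → QueryAlg V β}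
    (h : A.OnlyNeighborsOf v) (hg : ∀ a, (g a).OnlyNeighborsOf v) :
    (A.bind g).OnlyNeighborsOf v := by
  induction A with
  | ret a => exact hg a
  | vertex k ih => exact h.elim
  | neighbor w k ih => exact ⟨h.1, fun o => ih o (h.2 o)⟩
  | degree w k ih => exact h.elim
  | sample p k ih => exact fun w => ih w (h w)

lemma OnlyNeighborsOf.iterate {v : V} {A : QueryAlg V α} (h : A.OnlyNeighborsOf v) (t : ℕ) :
    (A.iterate t).OnlyNeighborsOf v := by
  induction t with
  | zero => trivial
  | succ t ih => exact h.bind fun a => ih.bind fun l => trivial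

lemma OnlyNeighborsOf.noDegreeQueries {v : V} {A : QueryAlg V α} (h : A.OnlyNeighborsOf v) :
    A.NoDegreeQueries := by
  induction A with
  | ret a => trivial
  | vertex k ih => exact h.elim
  | neighbor w k ih => exact fun o => ih o (h.2 o)
  | degree w k ih => exact h.elim
  | sample p k ih => exact fun w => ih w (h w)

lemma noDegreeQueries_simulateDegrees {deg : V → QueryAlg V ℝ≥0}
    (hdeg : ∀ v, (deg v).NoDegreeQueries) (A : QueryAlg V α) (c : V → Option ℝ≥0) :
    (A.simulateDegrees deg c).NoDegreeQueries := by
  induction A generalizing c with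
  | ret a => trivial
  | vertex k ih => exact fun v => ih v c
  | neighbor v k ih => exact fun v => ih v c
  | degree v k ih =>
    simp only [simulateDegrees]
    split
    · exact ih _ c
    · exact (hdeg v).bind fun x => ih x _
  | sample p k ih => exact fun v => ih v c

variable [Fintype V] [Nonempty V]
variable (G : SimpleGraph V) [DecidableRel G.Adj] (D : V → ℝ≥0)

open Classical in
/-- The probability that the degree of `v` is queried, when degree queries are answered from the
table `D`. -/
noncomputable def queryProb (v : V) : QueryAlg V α → ℝ
  | ret _ => 0
  | vertex k => (PMF.uniformOfFintype V).mean fun u => (k u).queryProb v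
  | neighbor u k => (neighborAnswer G u).mean fun o => (k o).queryProb v
  | degree u k => if u = v then 1 else (k (D u)).queryProb v
  | sample p k => p.mean fun u => (k u).queryProb v

variable {G D}

lemma queryProb_nonneg (v : V) (A : QueryAlg V α) : 0 ≤ A.queryProb G D v := by
  induction A with
  | ret a => exact le_rfl
  | vertex k ih => exact PMF.mean_nonneg _ ih
  | neighbor u k ih => exact PMF.mean_nonneg _ ih
  | degree u k ih => simp only [queryProb]; split_ifs; exacts [zero_le_one, ih _]
  | sample p k ih => exact PMF.mean_nonneg _ ih

lemma queryProb_le_one (v : V) (A : QueryAlg V α) : A.queryProb G D v ≤ 1 := by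
  induction A with
  | ret a => exact zero_le_one
  | vertex k ih => exact (PMF.mean_mono _ fun a _ => ih a).trans_eq (PMF.mean_const _ _)
  | neighbor u k ih => exact (PMF.mean_mono _ fun a _ => ih a).trans_eq (PMF.mean_const _ _)
  | degree u k ih => simp only [queryProb]; split_ifs; exacts [le_rfl, ih _]
  | sample p k ih => exact (PMF.mean_mono _ fun a _ => ih a).trans_eq (PMF.mean_const _ _)

lemma queryProb_bind_le (v : V) (A : QueryAlg V α) (g : α → QueryAlg V β) :
    (A.bind g).queryProb G D v ≤
      A.queryProb G D v + A.ev G D fun a => (g a).queryProb G D v := by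
  induction A with
  | ret a => simp [bind, queryProb, ev]
  | vertex k ih =>
    simp only [bind, queryProb, ev, ← PMF.mean_add]
    exact PMF.mean_mono _ fun a _ => ih a
  | neighbor u k ih =>
    simp only [bind, queryProb, ev, ← PMF.mean_add]
    exact PMF.mean_mono _ fun a _ => ih a
  | degree u k ih =>
    simp only [bind, queryProb, ev]
    split_ifs
    · linarith [ev_nonneg (G := G) (D := D) (k (D u))
        (f := fun a => (g a).queryProb G D v) fun a => queryProb_nonneg _ _]
    · exact ih _
  | sample p k ih =>
    simp only [bind, queryProb, ev, ← PMF.mean_add]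
    exact PMF.mean_mono _ fun a _ => ih a

lemma queryProb_iterate_le (v : V) (A : QueryAlg V α) (t : ℕ) :
    (A.iterate t).queryProb G D v ≤ t * A.queryProb G D v := by
  induction t with
  | zero => simp [iterate, queryProb]
  | succ t ih =>
    refine (queryProb_bind_le v A _).trans ?_
    have h : (A.ev G D fun a => ((A.iterate t).bind fun l => ret (a :: l)).queryProb G D v) ≤
        t * A.queryProb G D v := by
      refine ev_le_of_reach _ (reach_of_forall _ fun a => (queryProb_bind_le v _ _).trans ?_)
      simpa [queryProb, ev_const] using ih
    push_cast
    linarith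

/-- The table that answers a degree query from the stored values, and `0` where none is stored. -/
def storedTable (c : V → Option ℝ≥0) : V → ℝ≥0 := fun v => (c v).getD 0

variable (G D)

open Classical in
/-- The expectation of `F` of the table obtained from `c` by calling the subroutine `deg v` once
for every vertex `v` of a list for which no value is stored yet. -/
noncomputable def drawTable (deg : V → QueryAlg V ℝ≥0) :
    List V → (V → Option ℝ≥0) → ((V → Option ℝ≥0) → ℝ) → ℝ
  | [], c, F => F c
  | v :: l, c, F =>
    match c v with
    | some _ => drawTable deg l c F
    | none => (deg v).ev G D fun x => drawTable deg l (Function.update c v (some x)) F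

variable {G D} {deg : V → QueryAlg V ℝ≥0}

lemma drawTable_mono (l : List V) (c : V → Option ℝ≥0) {F F' : (V → Option ℝ≥0) → ℝ}
    (h : ∀ c', (∀ v x, c v = some x → c' v = some x) → F c' ≤ F' c') :
    drawTable G D deg l c F ≤ drawTable G D deg l c F' := by
  classical
  induction l generalizing c with
  | nil => exact h c fun _ _ => id
  | cons v l ih =>
    simp only [drawTable]
    split
    · exact ih c h
    · rename_i hv
      refine ev_mono _ fun x => ih _ fun c' hc' => h c' fun w y hw => hc' w y ?_
      rw [Function.update_of_ne, hw]
      rintro rfl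
      rw [hv] at hw
      exact Option.noConfusion rfl (heq_of_eq hw)

lemma drawTable_congr (l : List V) (c : V → Option ℝ≥0) {F F' : (V → Option ℝ≥0) → ℝ}
    (h : ∀ c', (∀ v x, c v = some x → c' v = some x) → F c' = F' c') :
    drawTable G D deg l c F = drawTable G D deg l c F' :=
  le_antisymm (drawTable_mono l c fun c' hc' => (h c' hc').le)
    (drawTable_mono l c fun c' hc' => (h c' hc').ge)

lemma drawTable_const (l : List V) (c : V → Option ℝ≥0) (a : ℝ) :
    drawTable G D deg l c (fun _ => a) = a := by
  induction l generalizing c with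
  | nil => rfl
  | cons v l ih =>
    simp only [drawTable]
    split
    · exact ih c
    · simp only [ih, ev_const]

lemma drawTable_add (l : List V) (c : V → Option ℝ≥0) (F F' : (V → Option ℝ≥0) → ℝ) :
    drawTable G D deg l c (fun c' => F c' + F' c') =
      drawTable G D deg l c F + drawTable G D deg l c F' := by
  induction l generalizing c with
  | nil => rfl
  | cons v l ih =>
    simp only [drawTable]
    split
    · exact ih c
    · simp only [ih, ev_add]

lemma drawTable_mul_left (l : List V) (c : V → Option ℝ≥0) (a : ℝ)
    (F : (V → Option ℝ≥0) → ℝ) :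
    drawTable G D deg l c (fun c' => a * F c') = a * drawTable G D deg l c F := by
  induction l generalizing c with
  | nil => rfl
  | cons v l ih =>
    simp only [drawTable]
    split
    · exact ih c
    · simp only [ih, ev_mul_left]

lemma drawTable_sum {ι : Type*} (l : List V) (c : V → Option ℝ≥0) (s : Finset ι)
    (F : ι → (V → Option ℝ≥0) → ℝ) :
    drawTable G D deg l c (fun c' => ∑ i ∈ s, F i c') = ∑ i ∈ s, drawTable G D deg l c (F i) := by
  classical
  induction s using Finset.induction_on with
  | empty => simp [drawTable_const]
  | insert i s hi ih => simp [Finset.sum_insert hi, drawTable_add, ih]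

lemma drawTable_mean {ι : Type*} [Fintype ι] (l : List V) (c : V → Option ℝ≥0) (p : PMF ι)
    (F : ι → (V → Option ℝ≥0) → ℝ) :
    drawTable G D deg l c (fun c' => p.mean fun i => F i c') =
      p.mean fun i => drawTable G D deg l c (F i) := by
  simp only [PMF.mean, drawTable_sum, drawTable_mul_left]

open Classical in
/-- The values in a table are independent, so any of them may be drawn first. -/
lemma drawTable_eq_ev (l : List V) (c : V → Option ℝ≥0) (F : (V → Option ℝ≥0) → ℝ) {v : V}
    (hv : v ∈ l) (hc : c v = none) :
    drawTable G D deg l c F =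
      (deg v).ev G D fun x => drawTable G D deg l (Function.update c v (some x)) F := by
  induction l generalizing c with
  | nil => simp at hv
  | cons w l ih =>
    by_cases hw : w = v
    · subst hw
      simp only [drawTable, hc, Function.update_self]
    · have hvl : v ∈ l := by
        rcases List.mem_cons.1 hv with h | h
        · exact absurd h.symm hw
        · exact h
      cases hcw : c w with
      | some y =>
        simp only [drawTable, hcw, Function.update_of_ne hw]
        exact ih c hvl hc
      | none =>
        simp only [drawTable, hcw, Function.update_of_ne hw]
        rw [ev_comm]
        congr 1
        funext y
        rw [ih _ hvl (by rw [Function.update_of_ne (Ne.symm hw), hc])]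
        congr 1
        funext x
        rw [Function.update_comm hw]

lemma drawTable_apply (l : List V) (c : V → Option ℝ≥0) (ψ : Option ℝ≥0 → ℝ) {v : V}
    (hv : v ∈ l) (hc : c v = none) :
    drawTable G D deg l c (fun c' => ψ (c' v)) = (deg v).ev G D fun x => ψ (some x) := by
  classical
  rw [drawTable_eq_ev l c _ hv hc]
  congr 1
  funext x
  rw [drawTable_congr (F' := fun _ => ψ (some x)) l _ fun c' hc' => by
    rw [hc' v x (Function.update_self ..)], drawTable_const]

/-- Lazy and eager evaluation agree: calling the subroutine on demand has the same effect as
running the algorithm with a table of values drawn beforehand. -/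
lemma ev_simulateDegrees {l : List V} (hl : ∀ v, v ∈ l) (A : QueryAlg V α)
    (c : V → Option ℝ≥0) (f : α → ℝ) :
    (A.simulateDegrees deg c).ev G D f =
      drawTable G D deg l c fun c' => A.ev G (storedTable c') f := by
  classical
  induction A generalizing c with
  | ret a => simp only [simulateDegrees, ev, drawTable_const]
  | vertex k ih => simp only [simulateDegrees, ev, ih, drawTable_mean]
  | neighbor v k ih => simp only [simulateDegrees, ev, ih, drawTable_mean]
  | sample p k ih => simp only [simulateDegrees, ev, ih, drawTable_mean]
  | degree v k ih =>
    cases hc : c v with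
    | some x =>
      simp only [simulateDegrees, hc, ev, ih]
      refine drawTable_congr l c fun c' hc' => ?_
      rw [storedTable, hc' v x hc, Option.getD_some]
    | none =>
      simp only [simulateDegrees, hc, ev, ev_bind, ih]
      rw [drawTable_eq_ev l c _ (hl v) hc]
      congr 1
      funext x
      refine drawTable_congr l _ fun c' hc' => ?_
      rw [storedTable, hc' v x (Function.update_self ..), Option.getD_some]

lemma drawTable_sum_mul_mean {ι : Type*} [Fintype ι] (l : List V) (c : V → Option ℝ≥0)
    (s : Finset V) (a : V → ℝ) (p : PMF ι) (k : ι → V → (V → Option ℝ≥0) → ℝ) :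
    drawTable G D deg l c (fun c' => ∑ v ∈ s, a v * p.mean fun u => k u v c') =
      p.mean fun u => drawTable G D deg l c fun c' => ∑ v ∈ s, a v * k u v c' := by
  rw [← drawTable_mean]
  congr 1
  funext c'
  simp only [PMF.mean, Finset.mul_sum]
  rw [Finset.sum_comm]
  exact Finset.sum_congr rfl fun u _ => Finset.sum_congr rfl fun v _ => by ring

open Classical in
/-- The expected cost of the algorithm with a subroutine: every vertex whose degree is queried
contributes the expected cost of one call. The cost and the result of a call may be correlated, but
whether the call is made does not depend on either. -/
lemma meanQueries_simulateDegrees_le {l : List V} (hl : ∀ v, v ∈ l) (A : QueryAlg V α)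
    (c : V → Option ℝ≥0) {b : ℕ} (hA : A.QueriesLE b) :
    (A.simulateDegrees deg c).meanQueries G D ≤
      b + drawTable G D deg l c fun c' => ∑ v with c v = none,
        (deg v).meanQueries G D * A.queryProb G (storedTable c') v := by
  have cast_pred : ∀ {n : ℕ}, 1 ≤ n → ((n - 1 : ℕ) : ℝ) = n - 1 := fun h => by
    rw [Nat.cast_sub h, Nat.cast_one]
  induction A generalizing c b with
  | ret a => simp [simulateDegrees, meanQueries, queryProb, drawTable_const]
  | vertex k ih =>
    simp only [simulateDegrees, meanQueries, queryProb, drawTable_sum_mul_mean]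
    have h := PMF.mean_mono (PMF.uniformOfFintype V) fun u _ => ih u c (hA.2 u)
    rw [PMF.mean_add, PMF.mean_const, cast_pred hA.1] at h
    linarith
  | neighbor w k ih =>
    simp only [simulateDegrees, meanQueries, queryProb, drawTable_sum_mul_mean]
    have h := PMF.mean_mono (neighborAnswer G w) fun u _ => ih u c (hA.2 u)
    rw [PMF.mean_add, PMF.mean_const, cast_pred hA.1] at h
    linarith
  | sample p k ih =>
    simp only [simulateDegrees, meanQueries, queryProb, drawTable_sum_mul_mean]
    have h := PMF.mean_mono p fun u _ => ih u c (hA u)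
    rwa [PMF.mean_add, PMF.mean_const] at h
  | degree w k ih =>
    cases hc : c w with
    | some x =>
      simp only [simulateDegrees, hc]
      refine (ih x c (hA.2 x)).trans ?_
      rw [cast_pred hA.1]
      have h : (drawTable G D deg l c fun c' => ∑ v with c v = none,
          (deg v).meanQueries G D * (k x).queryProb G (storedTable c') v) =
          drawTable G D deg l c fun c' => ∑ v with c v = none,
            (deg v).meanQueries G D * (degree w k).queryProb G (storedTable c') v := by
        refine drawTable_congr l c fun c' hc' => Finset.sum_congr rfl fun v hv => ?_
        have hwv : w ≠ v := by
          rintro rfl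
          rw [Finset.mem_filter, hc] at hv
          exact Option.noConfusion rfl (heq_of_eq hv.2)
        rw [queryProb, if_neg hwv, storedTable, hc' w x hc, Option.getD_some]
      linarith
    | none =>
      simp only [simulateDegrees, hc, meanQueries_bind]
      have h1 : ((deg w).ev G D fun x =>
          ((k x).simulateDegrees deg (Function.update c w (some x))).meanQueries G D) ≤
          (b - 1 : ℝ) + drawTable G D deg l c fun c' =>
            ∑ v ∈ ({v | c v = none} : Finset V).erase w,
              (deg v).meanQueries G D * (degree w k).queryProb G (storedTable c') v := by
        rw [drawTable_eq_ev l c _ (hl w) hc, ← ev_const (G := G) (D := D) (deg w) (b - 1 : ℝ),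
          ← ev_add]
        refine ev_mono _ fun x => (ih x _ (hA.2 x)).trans ?_
        rw [cast_pred hA.1]
        refine add_le_add le_rfl (drawTable_congr l _ fun c' hc' => ?_).le
        refine Finset.sum_congr ?_ fun v hv => ?_
        · ext v
          by_cases hv : v = w
          · subst hv
            simp only [Finset.mem_filter, Function.update_self, Finset.mem_erase, ne_eq,
              not_true_eq_false, false_and, iff_false, not_and]
            exact fun _ h => Option.noConfusion rfl (heq_of_eq h)
          · rw [Finset.mem_erase, Finset.mem_filter, Finset.mem_filter,
              Function.update_of_ne hv, and_iff_right hv]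
        · have hwv : w ≠ v := (Finset.ne_of_mem_erase hv).symm
          rw [queryProb, if_neg hwv, storedTable, hc' w x (Function.update_self ..),
            Option.getD_some]
      have h2 : (drawTable G D deg l c fun c' => ∑ v with c v = none,
            (deg v).meanQueries G D * (degree w k).queryProb G (storedTable c') v) =
          (deg w).meanQueries G D + drawTable G D deg l c fun c' =>
            ∑ v ∈ ({v | c v = none} : Finset V).erase w,
              (deg v).meanQueries G D * (degree w k).queryProb G (storedTable c') v := by
        rw [← drawTable_const (G := G) (D := D) (deg := deg) l c ((deg w).meanQueries G D),
          ← drawTable_add]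
        refine drawTable_congr l c fun c' _ => ?_
        rw [← Finset.add_sum_erase _ _ (a := w) (Finset.mem_filter.2 ⟨Finset.mem_univ _, hc⟩),
          queryProb, if_pos rfl, mul_one]
      linarith

end QueryAlg

/-! ### Exponential tail bounds -/

lemma Real.exp_sub_one_le_add_sq {a : ℝ} (ha : |a| ≤ 1) : Real.exp a - 1 ≤ a + a ^ 2 := by
  have := (abs_le.1 (Real.abs_exp_sub_one_sub_id_le ha)).2
  linarith

namespace QueryAlg

variable {V : Type u} {α : Type v} {β : Type w} [Fintype V] [Nonempty V]
variable {G : SimpleGraph V} [DecidableRel G.Adj] {D : V → ℝ≥0}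

/-- Chernoff's bound for the number of independent trials that satisfy `P`: the moment generating
function at `a` is at most `exp (t p (exp a - 1))`. -/
lemma ev_iterate_chernoff (A : QueryAlg V α) (t : ℕ) (P : α → Prop) [DecidablePred P] (a c : ℝ)
    (E : List α → Prop) [DecidablePred E]
    (hE : ∀ l : List α, E l → c ≤ a * (l.filter fun x => P x).length -
      t * (A.ev G D fun x => if P x then 1 else 0) * (Real.exp a - 1)) :
    ((A.iterate t).ev G D fun l => if E l then 1 else 0) ≤ Real.exp (-c) := by
  set p := A.ev G D fun x => if P x then (1 : ℝ) else 0 with hp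
  have h1 : ((A.iterate t).ev G D fun l => if E l then (1 : ℝ) else 0) ≤
      (A.iterate t).ev G D fun l => Real.exp (-c - t * p * (Real.exp a - 1)) *
        (l.map fun x => if P x then Real.exp a else 1).prod := by
    refine ev_mono _ fun l => ?_
    rw [List.prod_map_ite_one_right, ← Real.exp_nat_mul, ← Real.exp_add]
    split_ifs with h
    · have := hE l h
      rw [Real.one_le_exp_iff]
      linarith
    · positivity
  refine h1.trans ?_
  rw [ev_mul_left, ev_iterate_prod]
  have h2 : (A.ev G D fun x => if P x then Real.exp a else 1) = 1 + p * (Real.exp a - 1) := by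
    have e : ∀ x, (if P x then Real.exp a else 1) =
        1 + (if P x then (1 : ℝ) else 0) * (Real.exp a - 1) := by
      intro x; split_ifs <;> ring
    rw [funext e, ev_add, ev_const, ev_mul_right]
  have h3 : 0 ≤ 1 + p * (Real.exp a - 1) := by
    rw [← h2]
    exact ev_nonneg _ fun x => by split_ifs <;> positivity
  have h4 : 1 + p * (Real.exp a - 1) ≤ Real.exp (p * (Real.exp a - 1)) := by
    linarith [Real.add_one_le_exp (p * (Real.exp a - 1))]
  rw [h2]
  calc Real.exp (-c - t * p * (Real.exp a - 1)) * (1 + p * (Real.exp a - 1)) ^ t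
      ≤ Real.exp (-c - t * p * (Real.exp a - 1)) * Real.exp (p * (Real.exp a - 1)) ^ t := by
        gcongr
    _ = Real.exp (-c) := by
        rw [← Real.exp_nat_mul, ← Real.exp_add]
        congr 1; ring

lemma meanQueries_iterate (A : QueryAlg V α) (t : ℕ) :
    (A.iterate t).meanQueries G D = t * A.meanQueries G D := by
  induction t with
  | zero => simp [iterate, meanQueries]
  | succ t ih =>
    simp only [iterate, meanQueries_bind, meanQueries, ev_const, ih, add_zero]
    push_cast; ring

end QueryAlg

/-! ### Degree estimation from collisions -/

namespace QueryAlg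

variable {V : Type u} [Fintype V] [Nonempty V]

/-- A single neighbor query at `v`. -/
noncomputable def neighborSample (v : V) : QueryAlg V (Option V) := neighbor v ret

open Classical in
/-- Collision search for the degree of `v`, starting from scale `2 ^ i`. At every scale, `2 ^ i`
neighbors form a set `S`, and `T * 2 ^ i` further neighbors are tested for membership in `S`. If
there are at least `H` hits, `|S|` times the number of tests divided by the number of hits is
returned; otherwise the scale is doubled. The arguments after `H` and `T` are a bound for
the number of scales, and `i`. -/
noncomputable def degreeSearch (v : V) (H T : ℕ) : ℕ → ℕ → QueryAlg V ℝ≥0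
  | 0, _ => ret 0
  | s + 1, i =>
    ((neighborSample v).iterate (2 ^ i)).bind fun S =>
      ((neighborSample v).iterate (T * 2 ^ i)).bind fun Y =>
        if H ≤ (Y.filter fun y => y ∈ S).length then
          ret (S.toFinset.card * (T * 2 ^ i : ℕ) / (Y.filter fun y => y ∈ S).length)
        else degreeSearch v H T s (i + 1)

/-- The degree estimator: one query decides whether `v` is isolated, and the scales
`1, 2, …, 2 ^ n` are searched if it is not. -/
noncomputable def collisionDegree (H T : ℕ) (v : V) : QueryAlg V ℝ≥0 :=
  neighbor v fun o =>
    match o with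
    | none => ret 0
    | some _ => degreeSearch v H T (Fintype.card V + 1) 0

lemma onlyNeighborsOf_degreeSearch (v : V) (H T s i : ℕ) :
    (degreeSearch v H T s i).OnlyNeighborsOf v := by
  have h : (neighborSample v).OnlyNeighborsOf v := ⟨rfl, fun _ => trivial⟩
  induction s generalizing i with
  | zero => trivial
  | succ s ih =>
    refine (h.iterate _).bind fun S => (h.iterate _).bind fun Y => ?_
    split_ifs
    exacts [trivial, ih _]

lemma onlyNeighborsOf_collisionDegree (v : V) (H T : ℕ) :
    (collisionDegree H T v).OnlyNeighborsOf v := by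
  refine ⟨rfl, fun o => ?_⟩
  cases o
  exacts [trivial, onlyNeighborsOf_degreeSearch ..]

variable {G : SimpleGraph V} [DecidableRel G.Adj] {D : V → ℝ≥0} {v : V}

lemma reach_neighborSample (hv : G.degree v ≠ 0) :
    (neighborSample v).Reach G D fun o => ∃ u ∈ G.neighborFinset v, o = some u :=
  fun _ ho => neighborAnswer_ne_zero G hv ho

open Classical in
lemma ev_neighborSample_mem (hv : G.degree v ≠ 0) {S : List (Option V)}
    (hS : ∀ o ∈ S, ∃ u ∈ G.neighborFinset v, o = some u) :
    ((neighborSample v).ev G D fun o => if o ∈ S then 1 else 0) =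
      S.toFinset.card / G.degree v := by
  rw [neighborSample, ev]
  simp only [ev]
  rw [neighborAnswer_mean G hv, Finset.sum_boole]
  congr 2
  refine Finset.card_bij (fun u _ => some u) ?_ ?_ ?_
  · intro u hu
    simpa using (Finset.mem_filter.1 hu).2
  · intro a _ b _ h
    exact Option.some_injective _ h
  · intro o ho
    obtain ⟨u, hu, rfl⟩ := hS o (by simpa using ho)
    exact ⟨u, Finset.mem_filter.2 ⟨hu, by simpa using ho⟩, rfl⟩

open Classical in
/-- The expected number of repetitions among `s` random neighbors is at most the expected number
of coinciding pairs. -/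
lemma ev_repetitions_le (hv : G.degree v ≠ 0) (s : ℕ) :
    (((neighborSample v).iterate s).ev G D fun S => (s : ℝ) - S.toFinset.card) ≤
      s ^ 2 / (2 * G.degree v) := by
  have hd : (0 : ℝ) < G.degree v := by positivity
  induction s with
  | zero => simp [iterate, ev]
  | succ s ih =>
    rw [ev_iterate_succ, ev_comm]
    have h : (((neighborSample v).iterate s).ev G D fun l => (neighborSample v).ev G D fun a =>
        ((s + 1 : ℕ) : ℝ) - (a :: l).toFinset.card) ≤
        ((neighborSample v).iterate s).ev G D fun l =>
          ((s : ℝ) - l.toFinset.card) + s / G.degree v := by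
      refine ev_mono_of_reach _ ((reach_iterate _ (reach_neighborSample hv) s).mono ?_)
      rintro l ⟨hl, hlN⟩
      have e : ∀ a : Option V, ((s + 1 : ℕ) : ℝ) - (a :: l).toFinset.card =
          ((s : ℝ) - l.toFinset.card) + if a ∈ l then 1 else 0 := by
        intro a
        rw [List.toFinset_cons]
        split_ifs with ha
        · rw [Finset.insert_eq_self.2 (by simpa using ha)]
          push_cast; ring
        · rw [Finset.card_insert_of_notMem (by simpa using ha)]
          push_cast; ring
      simp only [e]
      rw [ev_add, ev_const, ev_neighborSample_mem hv hlN]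
      have : (l.toFinset.card : ℝ) ≤ s := by
        rw [← hl]; exact_mod_cast l.toFinset_card_le
      gcongr
    refine h.trans ?_
    rw [ev_add, ev_const]
    refine (add_le_add ih le_rfl).trans ?_
    rw [div_add_div _ _ (by positivity) (by positivity), div_le_div_iff₀ (by positivity)
      (by positivity)]
    push_cast
    nlinarith [mul_pos hd (mul_pos hd hd)]

open Classical in
lemma ev_card_lt_antitone (x : ℝ) : Antitone fun s =>
    ((neighborSample v).iterate s).ev G D fun S => if (S.toFinset.card : ℝ) < x then 1 else 0 := by
  refine antitone_nat_of_succ_le fun s => ?_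
  rw [ev_iterate_succ]
  refine ev_le_of_reach _ (reach_of_forall _ fun a => ev_mono _ fun l => ?_)
  have : (l.toFinset.card : ℝ) ≤ (a :: l).toFinset.card := by
    rw [List.toFinset_cons]
    exact_mod_cast Finset.card_le_card (Finset.subset_insert _ _)
  by_cases h : ((a :: l).toFinset.card : ℝ) < x
  · rw [if_pos h, if_pos (this.trans_lt h)]
  · rw [if_neg h]
    split_ifs <;> norm_num

open Classical in
/-- As soon as `s ≥ √d`, the number of distinct neighbors among `s` samples is at least a constant
fraction of `√d`, except with small probability. -/
lemma ev_card_lt_le (hv : G.degree v ≠ 0) {s : ℕ} (hs : √(G.degree v) ≤ s) :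
    (((neighborSample v).iterate s).ev G D fun S =>
      if 64 * (S.toFinset.card : ℝ) < √(G.degree v) then 1 else 0) ≤ 1 / 64 := by
  set q := √(G.degree v : ℝ) with hq
  have hd : (0 : ℝ) < G.degree v := by positivity
  have hq0 : 0 < q := Real.sqrt_pos.2 hd
  have hqq : q * q = G.degree v := Real.mul_self_sqrt hd.le
  set w := ⌈q⌉₊ with hw
  have hws : w ≤ s := Nat.ceil_le.2 hs
  have hw0 : 0 < w := Nat.ceil_pos.2 hq0
  have hw1 : q ≤ w := Nat.le_ceil q
  have hw2 : (w : ℝ) < q + 1 := Nat.ceil_lt_add_one hq0.le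
  have e : ∀ S : List (Option V), (64 * (S.toFinset.card : ℝ) < q) ↔
      ((S.toFinset.card : ℝ) < q / 64) := fun S => by
    rw [lt_div_iff₀ (by norm_num), mul_comm]
  simp only [e]
  refine (ev_card_lt_antitone (q / 64) hws).trans ?_
  rcases le_or_gt q 64 with hsmall | hbig
  · refine ev_le_of_reach _ ((reach_iterate (neighborSample v) (P := fun _ => True)
      (reach_of_forall _ fun _ => trivial) w).mono ?_)
    rintro S ⟨hS, -⟩
    have : 0 < S.toFinset.card := by
      rw [Finset.card_pos, List.toFinset_nonempty_iff]
      rintro rfl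
      simp at hS; omega
    have h1 : (1 : ℝ) ≤ S.toFinset.card := by exact_mod_cast this
    rw [if_neg (by linarith)]
    norm_num
  · have h1 : (((neighborSample v).iterate w).ev G D fun S =>
        if (S.toFinset.card : ℝ) < q / 64 then 1 else 0) ≤
        ((neighborSample v).iterate w).ev G D fun S =>
          (1 / 63) * ((w : ℝ) - S.toFinset.card) := by
      refine ev_mono_of_reach _ ((reach_iterate (neighborSample v) (P := fun _ => True)
        (reach_of_forall _ fun _ => trivial) w).mono ?_)
      rintro S ⟨hS, -⟩
      have : (S.toFinset.card : ℝ) ≤ w := by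
        rw [← hS]; exact_mod_cast S.toFinset_card_le
      split_ifs with h
      · linarith
      · linarith
    refine h1.trans ?_
    rw [ev_mul_left]
    have h2 := ev_repetitions_le (D := D) hv w
    have h3 : (w : ℝ) ^ 2 / (2 * G.degree v) ≤ 63 / 64 := by
      rw [← hqq, div_le_iff₀ (by positivity)]
      nlinarith
    linarith

section Phase

open Classical

variable {S : List (Option V)} {H t : ℕ} {a : ℝ}

/-- With enough expected hits, the search stops at the current scale. -/
lemma ev_hits_lt_le (hv : G.degree v ≠ 0)
    (hS : ∀ o ∈ S, ∃ u ∈ G.neighborFinset v, o = some u)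
    (ht : 4 * (H : ℝ) ≤ t * (S.toFinset.card / G.degree v)) :
    (((neighborSample v).iterate t).ev G D fun Y =>
      if (Y.filter fun y => y ∈ S).length < H then 1 else 0) ≤ Real.exp (-(H / 2 : ℝ)) := by
  refine ev_iterate_chernoff _ t (fun y => y ∈ S) (-1 / 2) _ _ fun Y hY => ?_
  rw [ev_neighborSample_mem hv hS]
  have h1 := Real.exp_sub_one_le_add_sq (a := -1 / 2) (by norm_num [abs_le])
  have h2 : ((Y.filter fun y => y ∈ S).length : ℝ) ≤ H := by exact_mod_cast hY.le
  have h3 : 0 ≤ (t : ℝ) * (S.toFinset.card / G.degree v) := by positivity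
  nlinarith

/-- Once there are `H` hits, their number is not much larger than expected. -/
lemma ev_hits_ge_le (hv : G.degree v ≠ 0)
    (hS : ∀ o ∈ S, ∃ u ∈ G.neighborFinset v, o = some u) (ha0 : 0 < a) (ha1 : a ≤ 1) :
    (((neighborSample v).iterate t).ev G D fun Y =>
      if H ≤ (Y.filter fun y => y ∈ S).length ∧
        (1 + a) * (t * (S.toFinset.card / G.degree v)) ≤ (Y.filter fun y => y ∈ S).length
        then 1 else 0) ≤ Real.exp (-(a ^ 2 * H / 8)) := by
  refine ev_iterate_chernoff _ t (fun y => y ∈ S) (a / 2) _ _ fun Y hY => ?_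
  rw [ev_neighborSample_mem hv hS]
  set M := (t : ℝ) * (S.toFinset.card / G.degree v) with hM
  set X := ((Y.filter fun y => y ∈ S).length : ℝ) with hX
  have h1 := Real.exp_sub_one_le_add_sq (a := a / 2) (by rw [abs_le]; constructor <;> linarith)
  have h2 : (H : ℝ) ≤ X := by rw [hX]; exact_mod_cast hY.1
  have h3 : 0 ≤ M := by positivity
  have h4 : M * (Real.exp (a / 2) - 1) ≤ M * (a / 2 + (a / 2) ^ 2) :=
    mul_le_mul_of_nonneg_left h1 h3
  have h5 : (a / 2 + (a / 2) ^ 2) * M ≤ (a / 2 + (a / 2) ^ 2) * (X / (1 + a)) := by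
    refine mul_le_mul_of_nonneg_left ?_ (by positivity)
    rw [le_div_iff₀ (by linarith)]
    linarith [hY.2]
  have h6 : (a / 2 + (a / 2) ^ 2) * (X / (1 + a)) ≤ a / 2 * X - a ^ 2 * X / 8 := by
    rw [← mul_div_assoc, div_le_iff₀ (by linarith)]
    have hX0 : 0 ≤ X := by positivity
    nlinarith [mul_nonneg (sq_nonneg a) hX0, mul_nonneg (mul_nonneg (sq_nonneg a) hX0)
      (sub_nonneg.2 ha1)]
  have h7 : a ^ 2 * H / 8 ≤ a ^ 2 * X / 8 := by gcongr
  linarith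

/-- Once there are `H` hits, their number is not much smaller than expected. -/
lemma ev_hits_le_le (hv : G.degree v ≠ 0)
    (hS : ∀ o ∈ S, ∃ u ∈ G.neighborFinset v, o = some u) (ha0 : 0 < a) (ha1 : a ≤ 1) :
    (((neighborSample v).iterate t).ev G D fun Y =>
      if H ≤ (Y.filter fun y => y ∈ S).length ∧
        ((Y.filter fun y => y ∈ S).length : ℝ) ≤ (1 - a) * (t * (S.toFinset.card / G.degree v))
        then 1 else 0) ≤ Real.exp (-(a ^ 2 * H / 8)) := by
  refine ev_iterate_chernoff _ t (fun y => y ∈ S) (-(a / 2)) _ _ fun Y hY => ?_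
  rw [ev_neighborSample_mem hv hS]
  set M := (t : ℝ) * (S.toFinset.card / G.degree v) with hM
  set X := ((Y.filter fun y => y ∈ S).length : ℝ) with hX
  have h1 := Real.exp_sub_one_le_add_sq (a := -(a / 2)) (by rw [abs_le]; constructor <;> linarith)
  have h2 : (H : ℝ) ≤ X := by rw [hX]; exact_mod_cast hY.1
  have h3 : 0 ≤ M := by positivity
  have h4 : M * (Real.exp (-(a / 2)) - 1) ≤ M * (-(a / 2) + (-(a / 2)) ^ 2) :=
    mul_le_mul_of_nonneg_left h1 h3
  have h5 : a / 2 * X ≤ a / 2 * ((1 - a) * M) :=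
    mul_le_mul_of_nonneg_left hY.2 (by positivity)
  have h6 : (H : ℝ) ≤ M := by nlinarith [hY.2]
  have h7 : a ^ 2 * H ≤ a ^ 2 * M := mul_le_mul_of_nonneg_left h6 (sq_nonneg a)
  nlinarith [mul_nonneg (sq_nonneg a) h3]

end Phase

lemma ratio_mem_of_hits {a M X d : ℝ} (ha0 : 0 < a) (ha1 : a ≤ 1 / 2) (hX : 0 < X) (hd : 0 < d)
    (h1 : X < (1 + a) * M) (h2 : (1 - a) * M < X) :
    (1 - 2 * a) * d ≤ M * d / X ∧ M * d / X ≤ (1 + 2 * a) * d := by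
  have hM : 0 < M := by nlinarith
  rw [le_div_iff₀ hX, div_le_iff₀ hX]
  constructor
  · have : (1 - 2 * a) * X ≤ M := by
      nlinarith [mul_nonneg (sub_nonneg.2 ha1) (sub_pos.2 h1).le, mul_pos ha0 hM]
    nlinarith
  · have : M ≤ (1 + 2 * a) * X := by
      nlinarith [mul_nonneg (sub_nonneg.2 ha1) hM.le,
        mul_lt_mul_of_pos_left h2 (by linarith : 0 < 1 + 2 * a)]
    nlinarith

open Classical in
/-- The tests of one scale of the collision search, for a fixed set `S` of neighbors: a wrong value
is returned only if the number of hits deviates from its mean. -/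
lemma ev_searchTests_le (hv : G.degree v ≠ 0) {H t : ℕ} {a : ℝ} (ha0 : 0 < a) (ha1 : a ≤ 1 / 2)
    (hH : 1 ≤ H) {S : List (Option V)} (hS : ∀ o ∈ S, ∃ u ∈ G.neighborFinset v, o = some u)
    (W : QueryAlg V ℝ≥0) {bad : ℝ≥0 → ℝ} (hbad : bad = fun x : ℝ≥0 =>
      if (1 - 2 * a) * (G.degree v : ℝ) ≤ x ∧ (x : ℝ) ≤ (1 + 2 * a) * G.degree v
        then (0 : ℝ) else 1) :
    (((neighborSample v).iterate t).ev G D fun Y =>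
      (if H ≤ (Y.filter fun y => y ∈ S).length then
        (ret (S.toFinset.card * (t : ℕ) / (Y.filter fun y => y ∈ S).length) :
          QueryAlg V ℝ≥0) else W).ev G D bad) ≤
    2 * Real.exp (-(a ^ 2 * H / 8)) + (((neighborSample v).iterate t).ev G D fun Y =>
      if (Y.filter fun y => y ∈ S).length < H then 1 else 0) * W.ev G D bad := by
  have hd0 : (0 : ℝ) < G.degree v := by positivity
  have hbad1 : ∀ x, bad x ≤ 1 := fun x => by simp only [hbad]; split_ifs <;> norm_num
  have hup := ev_hits_ge_le (D := D) (H := H) (t := t) hv hS ha0 (by linarith)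
  have hlo := ev_hits_le_le (D := D) (H := H) (t := t) hv hS ha0 (by linarith)
  rw [← ev_mul_right, two_mul]
  refine le_trans ?_ (add_le_add_left (add_le_add hup hlo) _)
  rw [← ev_add, ← ev_add]
  refine ev_mono _ fun Y => ?_
  generalize hX : (Y.filter fun y => y ∈ S).length = X
  generalize hM : (t : ℝ) * (S.toFinset.card / G.degree v) = M
  have hite : ∀ (P : Prop) [Decidable P], (0 : ℝ) ≤ if P then 1 else 0 := fun P _ => by
    split_ifs <;> norm_num
  by_cases hHX : H ≤ X
  · have hX0 : (0 : ℝ) < X := by exact_mod_cast (by omega : 0 < X)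
    rw [if_pos hHX, if_neg (not_lt.2 hHX), zero_mul, add_zero, ev]
    by_cases h1 : (1 + a) * M ≤ X
    · rw [if_pos ⟨hHX, h1⟩]
      exact (hbad1 _).trans (le_add_of_nonneg_right (hite _))
    by_cases h2 : (X : ℝ) ≤ (1 - a) * M
    · rw [if_pos (⟨hHX, h2⟩ : H ≤ X ∧ (X : ℝ) ≤ (1 - a) * M)]
      exact (hbad1 _).trans (le_add_of_nonneg_left (hite _))
    have hval : ((S.toFinset.card * (t : ℕ) / X : ℝ≥0) : ℝ) = M * G.degree v / X := by
      rw [← hM]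
      push_cast
      field_simp
    have hgood : bad (S.toFinset.card * (t : ℕ) / X : ℝ≥0) = 0 := by
      rw [hbad]
      dsimp only
      rw [if_pos]
      rw [hval]
      exact ratio_mem_of_hits ha0 ha1 hX0 hd0 (not_le.1 h1) (not_le.1 h2)
    rw [hgood]
    exact add_nonneg (hite _) (hite _)
  · rw [if_neg hHX, if_pos (not_le.1 hHX), if_neg (fun h => hHX h.1), if_neg (fun h => hHX h.1)]
    linarith

open Classical in
/-- The probability that the collision search returns a value off by more than a factor
`1 ± 2 a`, provided that its last scale reaches the degree. -/
lemma ev_degreeSearch_le (hv : G.degree v ≠ 0) {H T : ℕ} {a : ℝ} (ha0 : 0 < a) (ha1 : a ≤ 1 / 2)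
    (hH : 1 ≤ H) (hT : 4 * H ≤ T) (s i : ℕ) (hsi : G.degree v ≤ 2 ^ (i + s)) :
    ((degreeSearch v H T (s + 1) i).ev G D fun x =>
      if (1 - 2 * a) * (G.degree v : ℝ) ≤ x ∧ (x : ℝ) ≤ (1 + 2 * a) * G.degree v then 0 else 1) ≤
      3 * (s + 1) * Real.exp (-(a ^ 2 * H / 8)) := by
  set d : ℝ := (G.degree v : ℝ) with hd
  have hd0 : 0 < d := by rw [hd]; positivity
  set ε := Real.exp (-(a ^ 2 * H / 8)) with hε
  set bad : ℝ≥0 → ℝ := fun x => if (1 - 2 * a) * d ≤ x ∧ (x : ℝ) ≤ (1 + 2 * a) * d then 0 else 1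
    with hbad
  have hbad0 : ∀ x, 0 ≤ bad x := fun x => by simp only [hbad]; split_ifs <;> norm_num
  have hbad1 : ∀ x, bad x ≤ 1 := fun x => by simp only [hbad]; split_ifs <;> norm_num
  induction s generalizing i with
  | zero =>
    rw [degreeSearch, ev_bind]
    refine ev_le_of_reach _ ((reach_iterate _ (reach_neighborSample hv) _).mono ?_)
    rintro S ⟨hSl, hS⟩
    rw [ev_bind]
    refine (ev_searchTests_le hv ha0 ha1 hH hS _ hbad).trans ?_
    have hσ : 1 ≤ (S.toFinset.card : ℝ) := by
      have : 0 < S.toFinset.card := by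
        rw [Finset.card_pos, List.toFinset_nonempty_iff]
        rintro rfl
        have : 0 < 2 ^ i := by positivity
        simp at hSl; omega
      exact_mod_cast this
    have h1 : d ≤ 2 ^ i := by rw [hd]; exact_mod_cast hsi
    have h2 : (4 * H : ℝ) ≤ T := by exact_mod_cast hT
    have hhits := ev_hits_lt_le (D := D) (H := H) (t := T * 2 ^ i) hv hS (by
      rw [← hd, ← mul_div_assoc, le_div_iff₀ hd0]
      push_cast
      calc 4 * (H : ℝ) * d ≤ T * 2 ^ i := by gcongr
        _ ≤ T * 2 ^ i * S.toFinset.card := le_mul_of_one_le_right (by positivity) hσ)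
    have h3 : Real.exp (-(H / 2 : ℝ)) ≤ ε := by
      refine Real.exp_le_exp.2 (neg_le_neg ?_)
      have : (0 : ℝ) ≤ H := by positivity
      nlinarith [mul_le_mul_of_nonneg_right (show a ^ 2 ≤ 1 by nlinarith) this]
    have h4 : (degreeSearch v H T 0 (i + 1)).ev G D bad ≤ 1 :=
      ev_le_of_reach _ (reach_of_forall _ hbad1)
    have h5 : 0 ≤ (degreeSearch v H T 0 (i + 1)).ev G D bad := ev_nonneg _ hbad0
    have h6 := mul_le_mul (hhits.trans h3) h4 h5 (Real.exp_pos _).le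
    norm_num
    linarith
  | succ s ih =>
    rw [degreeSearch, ev_bind]
    refine ev_le_of_reach _ ((reach_iterate _ (reach_neighborSample hv) _).mono ?_)
    rintro S ⟨hSl, hS⟩
    rw [ev_bind]
    refine (ev_searchTests_le hv ha0 ha1 hH hS _ hbad).trans ?_
    have h1 := ih (i + 1) (by rwa [show i + 1 + s = i + (s + 1) by ring])
    have h2 : (((neighborSample v).iterate (T * 2 ^ i)).ev G D fun Y =>
        if (Y.filter fun y => y ∈ S).length < H then (1 : ℝ) else 0) ≤ 1 :=
      ev_le_of_reach _ (reach_of_forall _ fun Y => by split_ifs <;> norm_num)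
    have h3 : 0 ≤ (degreeSearch v H T (s + 1) (i + 1)).ev G D bad := ev_nonneg _ hbad0
    have h4 := mul_le_of_le_one_left h3 h2
    have h5 : 0 < ε := Real.exp_pos _
    push_cast
    linarith

open Classical in
/-- The expected cost of the collision search is of order `√d`: at every scale above `√d` the
search stops with probability more than `1 / 2`, so that the costs of the further scales form a
geometric series. -/
lemma meanQueries_degreeSearch_le (hv : G.degree v ≠ 0) {H T : ℕ} (hH : 4 ≤ H) (hT : 256 * H ≤ T)
    (s i : ℕ) :
    (degreeSearch v H T s i).meanQueries G D ≤ (T + 1) *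
      if √(G.degree v) ≤ 2 ^ i then 4 * 2 ^ i else 10 * √(G.degree v) - 2 ^ i := by
  set q := √(G.degree v : ℝ) with hq
  have hd : (0 : ℝ) < G.degree v := by positivity
  have hq0 : 0 < q := Real.sqrt_pos.2 hd
  have hqq : q * q = G.degree v := Real.mul_self_sqrt hd.le
  have hone : (neighborSample v).meanQueries G D = 1 := by
    simp only [neighborSample, meanQueries, PMF.mean_const]; norm_num
  induction s generalizing i with
  | zero =>
    rw [degreeSearch, meanQueries]
    refine mul_nonneg (by positivity) ?_
    split_ifs with h
    · positivity
    · push Not at h; linarith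
  | succ s ih =>
    set W := (degreeSearch v H T s (i + 1)).meanQueries G D with hW
    have hW0 : 0 ≤ W := meanQueries_nonneg _
    set p := (((neighborSample v).iterate (2 ^ i)).ev G D fun S =>
      ((neighborSample v).iterate (T * 2 ^ i)).ev G D fun Y =>
        if (Y.filter fun y => y ∈ S).length < H then (1 : ℝ) else 0) with hp
    have hp1 : p ≤ 1 :=
      ev_le_of_reach _ (reach_of_forall _ fun S =>
        ev_le_of_reach _ (reach_of_forall _ fun Y => by split_ifs <;> norm_num))
    have hcost : (degreeSearch v H T (s + 1) i).meanQueries G D = (T + 1) * 2 ^ i + p * W := by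
      rw [degreeSearch, meanQueries_bind]
      simp only [meanQueries_bind, meanQueries_iterate, hone]
      have e : ∀ (S Y : List (Option V)),
          ((if H ≤ (Y.filter fun y => y ∈ S).length then
            (ret (S.toFinset.card * (T * 2 ^ i : ℕ) / (Y.filter fun y => y ∈ S).length) :
              QueryAlg V ℝ≥0) else degreeSearch v H T s (i + 1)).meanQueries G D) =
          (if (Y.filter fun y => y ∈ S).length < H then (1 : ℝ) else 0) * W := by
        intro S Y
        by_cases h : H ≤ (Y.filter fun y => y ∈ S).length
        · rw [if_pos h, if_neg (not_lt.2 h), zero_mul, meanQueries]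
        · rw [if_neg h, if_pos (not_le.1 h), one_mul]
      simp only [e, ev_add, ev_const, ev_mul_right]
      push_cast
      ring
    have hih := ih (i + 1)
    rw [← hW] at hih
    rw [hcost]
    have hTp : (0 : ℝ) < T + 1 := by positivity
    have hpow : (2 : ℝ) ^ (i + 1) = 2 * 2 ^ i := by ring
    by_cases hi : q ≤ 2 ^ i
    · rw [if_pos hi]
      rw [if_pos (by rw [hpow]; linarith [pow_pos (two_pos : (0 : ℝ) < 2) i])] at hih
      have hp2 : p ≤ 3 / 8 := by
        have h1 : p ≤ ((neighborSample v).iterate (2 ^ i)).ev G D fun S =>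
            Real.exp (-2) + if 64 * (S.toFinset.card : ℝ) < q then 1 else 0 := by
          refine ev_mono_of_reach _ ((reach_iterate _ (reach_neighborSample hv) _).mono ?_)
          rintro S ⟨hSl, hS⟩
          split_ifs with hσ
          · have : (((neighborSample v).iterate (T * 2 ^ i)).ev G D fun Y =>
                if (Y.filter fun y => y ∈ S).length < H then (1 : ℝ) else 0) ≤ 1 :=
              ev_le_of_reach _ (reach_of_forall _ fun Y => by split_ifs <;> norm_num)
            linarith [Real.exp_pos (-2)]
          · push Not at hσ
            rw [add_zero]
            refine (ev_hits_lt_le hv hS ?_).trans (Real.exp_le_exp.2 ?_)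
            · rw [← hqq, ← mul_div_assoc, le_div_iff₀ (by positivity)]
              have hT' : (256 * H : ℝ) ≤ T := by exact_mod_cast hT
              push_cast
              calc 4 * (H : ℝ) * (q * q)
                  ≤ 4 * H * (2 ^ i * (64 * S.toFinset.card)) := by gcongr
                _ = 256 * H * 2 ^ i * S.toFinset.card := by ring
                _ ≤ T * 2 ^ i * S.toFinset.card := by gcongr
            · have : (4 : ℝ) ≤ H := by exact_mod_cast hH
              linarith
        rw [ev_add, ev_const] at h1
        have h2 := ev_card_lt_le (D := D) hv (s := 2 ^ i) (by push_cast; exact hi)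
        have h3 : Real.exp (-2) ≤ 1 / 3 := by
          rw [Real.exp_neg, inv_le_comm₀ (Real.exp_pos _) (by norm_num)]
          have := Real.add_one_le_exp (2 : ℝ)
          norm_num at this ⊢
          linarith
        linarith
      have : p * W ≤ 3 / 8 * ((T + 1) * (4 * 2 ^ (i + 1))) :=
        mul_le_mul hp2 hih hW0 (by norm_num)
      rw [hpow] at this
      linarith
    · rw [if_neg hi]
      push Not at hi
      have h1 : p * W ≤ W := mul_le_of_le_one_left hW0 hp1
      refine (add_le_add le_rfl (h1.trans hih)).trans ?_
      rw [← mul_add]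
      refine mul_le_mul_of_nonneg_left ?_ hTp.le
      rw [hpow]
      split_ifs <;> linarith

/-- The expected cost of the degree estimator. -/
lemma meanQueries_collisionDegree_le {H T : ℕ} (hH : 4 ≤ H) (hT : 256 * H ≤ T) (v : V) :
    (collisionDegree H T v).meanQueries G D ≤ 1 + 10 * (T + 1) * √(G.degree v) := by
  rw [collisionDegree, meanQueries]
  refine add_le_add le_rfl ?_
  by_cases hv : G.degree v = 0
  · rw [neighborAnswer_of_degree_eq_zero G hv]
    have : (PMF.pure (none : Option V)).mean (fun o => QueryAlg.meanQueries G D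
        (match o with
        | none => ret 0
        | some _ => degreeSearch v H T (Fintype.card V + 1) 0 : QueryAlg V ℝ≥0)) = 0 := by
      rw [PMF.mean, Fintype.sum_option]
      simp [meanQueries]
    refine this.trans_le (by positivity)
  · rw [neighborAnswer_mean G hv]
    simp only [Finset.sum_const, G.card_neighborFinset_eq_degree, nsmul_eq_mul]
    rw [mul_div_cancel_left₀ _ (by exact_mod_cast hv)]
    refine (meanQueries_degreeSearch_le hv hH hT _ 0).trans ?_
    have hd : (1 : ℝ) ≤ G.degree v := by exact_mod_cast Nat.one_le_iff_ne_zero.2 hv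
    have h1 : 1 ≤ √(G.degree v : ℝ) := Real.one_le_sqrt.2 hd
    have hT0 : (0 : ℝ) < T + 1 := by positivity
    rw [show 10 * ((T : ℝ) + 1) * √(G.degree v) = (T + 1) * (10 * √(G.degree v)) by ring]
    refine mul_le_mul_of_nonneg_left ?_ hT0.le
    split_ifs <;> norm_num
    linarith

open Classical in
/-- The failure probability of the degree estimator. -/
lemma ev_collisionDegree_le {H T : ℕ} {a : ℝ} (ha0 : 0 < a) (ha1 : a ≤ 1 / 2)
    (hH : 1 ≤ H) (hT : 4 * H ≤ T) (v : V) :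
    ((collisionDegree H T v).ev G D fun x =>
      if (1 - 2 * a) * (G.degree v : ℝ) ≤ x ∧ (x : ℝ) ≤ (1 + 2 * a) * G.degree v then 0 else 1) ≤
      3 * (Fintype.card V + 1) * Real.exp (-(a ^ 2 * H / 8)) := by
  rw [collisionDegree, ev]
  by_cases hv : G.degree v = 0
  · rw [neighborAnswer_of_degree_eq_zero G hv, PMF.mean, Fintype.sum_option]
    simp only [ev, hv]
    simp
    positivity
  · rw [neighborAnswer_mean G hv]
    simp only [Finset.sum_const, G.card_neighborFinset_eq_degree, nsmul_eq_mul]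
    rw [mul_div_cancel_left₀ _ (by exact_mod_cast hv)]
    refine ev_degreeSearch_le hv ha0 ha1 hH hT _ 0 ?_
    rw [zero_add]
    exact ((G.degree_lt_card_verts v).trans Nat.lt_two_pow_self).le

end QueryAlg

/-! ### Vertex and edge samples -/

lemma PMF.mean_map {ι κ : Type*} [Fintype ι] [Fintype κ] (p : PMF ι) (g : ι → κ) (F : κ → ℝ) :
    (p.map g).mean F = p.mean fun a => F (g a) := by
  classical
  have h : ∀ b, ((p.map g) b).toReal = ∑ a, if b = g a then (p a).toReal else 0 := by
    intro b
    rw [PMF.map_apply, tsum_fintype, ENNReal.toReal_sum]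
    · exact Finset.sum_congr rfl fun a _ => by
        by_cases hb : b = g a <;> simp [hb]
    · intro a _
      split_ifs
      exacts [p.apply_ne_top a, ENNReal.zero_ne_top]
  simp only [PMF.mean, h, Finset.sum_mul, ite_mul, zero_mul]
  rw [Finset.sum_comm]
  simp

lemma degreeWeighted_mean {V : Type u} [Fintype V] (R : List (V × ℝ≥0))
    (h : ∑' i : Fin R.length, ((R.get i).2 : ℝ≥0∞) ≠ 0) (F : V → ℝ) :
    (degreeWeighted R h).mean F =
      (R.map fun p => (p.2 : ℝ) * F p.1).sum / (R.map fun p => (p.2 : ℝ)).sum := by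
  have hs : (∑' i : Fin R.length, ((R.get i).2 : ℝ≥0∞)).toReal =
      (R.map fun p => (p.2 : ℝ)).sum := by
    rw [tsum_fintype, ENNReal.toReal_sum fun _ _ => ENNReal.coe_ne_top,
      ← Fin.sum_univ_fun_getElem]
    rfl
  rw [degreeWeighted, PMF.mean_map, PMF.mean]
  simp only [PMF.normalize_apply, ENNReal.toReal_mul, ENNReal.toReal_inv, hs, ENNReal.coe_toReal]
  rw [← Fin.sum_univ_fun_getElem R (fun p => (p.2 : ℝ) * F p.1), Finset.sum_div]
  refine Finset.sum_congr rfl fun i _ => ?_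
  simp only [List.get_eq_getElem]
  ring

/-- All entries of the table `D` are correct up to a factor `1 ± δ`. -/
def IsAccurate {V : Type u} [Fintype V] (G : SimpleGraph V) [DecidableRel G.Adj] (δ : ℝ)
    (D : V → ℝ≥0) : Prop :=
  ∀ v, (1 - δ) * (G.degree v : ℝ) ≤ D v ∧ (D v : ℝ) ≤ (1 + δ) * G.degree v

namespace QueryAlg

variable {V : Type u} [Fintype V] [Nonempty V]
variable {G : SimpleGraph V} [DecidableRel G.Adj] {D : V → ℝ≥0}

lemma ev_vertexSample (F : V × ℝ≥0 → ℝ) :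
    (vertexSample V).ev G D F = (∑ v, F (v, D v)) / Fintype.card V := by
  simp only [vertexSample, ev, PMF.mean_uniformOfFintype]

lemma reach_vertexSample : (vertexSample V).Reach G D fun p => p.2 = D p.1 :=
  fun _ => rfl

lemma sum_ne_zero_of_tsum_ne_zero {R : List (V × ℝ≥0)} :
    ∑' i : Fin R.length, ((R.get i).2 : ℝ≥0∞) ≠ 0 ↔ (R.map fun p => (p.2 : ℝ)).sum ≠ 0 := by
  have hs : (R.map fun p => (p.2 : ℝ)).sum =
      (∑' i : Fin R.length, ((R.get i).2 : ℝ≥0∞)).toReal := by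
    rw [tsum_fintype, ENNReal.toReal_sum fun _ _ => ENNReal.coe_ne_top,
      ← Fin.sum_univ_fun_getElem]
    rfl
  rw [hs, Ne, Ne, ENNReal.toReal_eq_zero_iff, not_or]
  refine ⟨fun h => ⟨h, ?_⟩, fun h => h.1⟩
  rw [tsum_fintype]
  exact ENNReal.sum_ne_top.2 fun _ _ => ENNReal.coe_ne_top

lemma _root_.IsAccurate.eq_zero_iff {δ : ℝ} (hD : IsAccurate G δ D) (hδ : δ < 1) (v : V) :
    D v = 0 ↔ G.degree v = 0 := by
  have h := hD v
  constructor
  · intro h0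
    rw [h0, NNReal.coe_zero] at h
    have : (G.degree v : ℝ) ≤ 0 := by nlinarith [h.1]
    exact_mod_cast le_antisymm this (Nat.cast_nonneg _)
  · intro h0
    rw [h0, Nat.cast_zero, mul_zero, mul_zero] at h
    exact_mod_cast le_antisymm h.2 h.1

/-- The expectation over an edge sample from `R`. -/
lemma ev_edgeSample {δ : ℝ} (hD : IsAccurate G δ D) (hδ : δ < 1) {R : List (V × ℝ≥0)}
    (hR : ∀ p ∈ R, p.2 = D p.1) (h0 : (R.map fun p => (p.2 : ℝ)).sum ≠ 0) (F : ℝ≥0 → ℝ) :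
    (edgeSample R).ev G D F =
      (R.map fun p => (D p.1 : ℝ) * ((∑ u ∈ G.neighborFinset p.1, F (D u)) /
        G.degree p.1)).sum / (R.map fun p => (p.2 : ℝ)).sum := by
  rw [edgeSample, dif_pos (sum_ne_zero_of_tsum_ne_zero.2 h0)]
  simp only [ev]
  rw [degreeWeighted_mean]
  congr 2
  refine List.map_congr_left fun p hp => ?_
  rw [hR p hp]
  by_cases hp0 : G.degree p.1 = 0
  · rw [(hD.eq_zero_iff hδ _).2 hp0]
    simp
  · rw [neighborAnswer_mean G hp0]
    simp only [ev]

/-- An edge sample returns the degree value of a vertex, or `0`. -/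
lemma reach_edgeSample (R : List (V × ℝ≥0)) :
    (edgeSample R).Reach G D fun y => y = 0 ∨ ∃ u, y = D u := by
  rw [edgeSample]
  split_ifs with h
  · intro v _ o _
    cases o with
    | none => exact Or.inl rfl
    | some u => exact Or.inr ⟨u, rfl⟩
  · exact Or.inl rfl

lemma queriesLE_saddlesSM (r q ℓ : ℕ) (cutoff : ℝ) :
    (saddlesSM V r q ℓ cutoff).QueriesLE (ℓ * (r * 2 + q * 2)) := by
  have h1 : (vertexSample V).QueriesLE 2 := ⟨by norm_num, fun v => ⟨le_rfl, fun _ => trivial⟩⟩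
  have h2 : ∀ R : List (V × ℝ≥0), (edgeSample R).QueriesLE 2 := by
    intro R
    rw [edgeSample]
    split_ifs
    · refine fun v => ⟨by norm_num, fun o => ?_⟩
      cases o
      exacts [trivial, ⟨le_rfl, fun _ => trivial⟩]
    · trivial
  have h3 : (saddlesRound V r q cutoff).QueriesLE (r * 2 + q * 2) :=
    (h1.iterate r).bind fun R => ((h2 R).iterate q).bind (b := 0) fun _ => trivial
  exact (h3.iterate ℓ).bind (b := 0) fun _ => trivial

/-! ### The accuracy of one round -/

/-- The number of vertices whose value in the table `D` is at least `d`. -/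
noncomputable def tableCcdh (D : V → ℝ≥0) (d : ℕ) : ℝ := ∑ u, if (d : ℝ≥0) ≤ D u then (1 : ℝ) else 0

/-- The contribution of an edge endpoint with degree value `y` to the estimate of `N(d)`. -/
noncomputable def endpointWeight (d : ℕ) (y : ℝ≥0) : ℝ := if (d : ℝ≥0) ≤ y then 1 / (y : ℝ) else 0

/-- The expected contribution of an edge sample that starts at `v`, times the weight of `v`. -/
noncomputable def vertexWeight (G : SimpleGraph V) [DecidableRel G.Adj] (D : V → ℝ≥0) (d : ℕ)
    (v : V) : ℝ :=
  (D v : ℝ) * ((∑ u ∈ G.neighborFinset v, endpointWeight d (D u)) / G.degree v)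

lemma endpointWeight_nonneg (d : ℕ) (y : ℝ≥0) : 0 ≤ endpointWeight d y := by
  rw [endpointWeight]; split_ifs <;> positivity

lemma endpointWeight_le {d : ℕ} (hd : 1 ≤ d) (y : ℝ≥0) :
    endpointWeight d y ≤ (if (d : ℝ≥0) ≤ y then (1 : ℝ) else 0) / d := by
  rw [endpointWeight]
  split_ifs with h
  · have h1 : (d : ℝ) ≤ y := by exact_mod_cast h
    have h2 : (0 : ℝ) < d := by exact_mod_cast hd
    exact one_div_le_one_div_of_le h2 h1
  · simp

lemma endpointWeight_sq_le {d : ℕ} (hd : 1 ≤ d) (y : ℝ≥0) :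
    endpointWeight d y ^ 2 ≤ 1 / d * endpointWeight d y := by
  rw [sq]
  refine mul_le_mul_of_nonneg_right ((endpointWeight_le hd y).trans ?_)
    (endpointWeight_nonneg d y)
  gcongr
  split_ifs <;> norm_num

lemma tableCcdh_nonneg (d : ℕ) : 0 ≤ tableCcdh D d :=
  Finset.sum_nonneg fun _ _ => by split_ifs <;> norm_num

lemma vertexWeight_nonneg (d : ℕ) (v : V) : 0 ≤ vertexWeight G D d v :=
  mul_nonneg (NNReal.coe_nonneg _)
    (div_nonneg (Finset.sum_nonneg fun _ _ => endpointWeight_nonneg _ _) (Nat.cast_nonneg _))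

variable {δ : ℝ} {d : ℕ}

lemma vertexWeight_bounds (hD : IsAccurate G δ D) (v : V) :
    (1 - δ) * ∑ u ∈ G.neighborFinset v, endpointWeight d (D u) ≤ vertexWeight G D d v ∧
    vertexWeight G D d v ≤ (1 + δ) * ∑ u ∈ G.neighborFinset v, endpointWeight d (D u) := by
  rw [vertexWeight]
  set s := ∑ u ∈ G.neighborFinset v, endpointWeight d (D u) with hs
  have hs0 : 0 ≤ s := Finset.sum_nonneg fun _ _ => endpointWeight_nonneg _ _
  by_cases hv : G.degree v = 0
  · have : G.neighborFinset v = ∅ := by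
      rw [← Finset.card_eq_zero, G.card_neighborFinset_eq_degree, hv]
    simp [hs, this]
  · have h0 : (0 : ℝ) < G.degree v := by positivity
    rw [← mul_div_assoc, le_div_iff₀ h0, div_le_iff₀ h0]
    constructor
    · nlinarith [mul_le_mul_of_nonneg_right (hD v).1 hs0]
    · nlinarith [mul_le_mul_of_nonneg_right (hD v).2 hs0]

lemma vertexWeight_le (hD : IsAccurate G δ D) (hδ : 0 ≤ δ) (hd : 1 ≤ d) (v : V) :
    vertexWeight G D d v ≤ (1 + δ) * (tableCcdh D d / d) := by
  refine (vertexWeight_bounds hD v).2.trans (mul_le_mul_of_nonneg_left ?_ (by linarith))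
  rw [tableCcdh, Finset.sum_div]
  refine (Finset.sum_le_sum fun u _ => endpointWeight_le hd (D u)).trans
    (Finset.sum_le_sum_of_subset_of_nonneg (Finset.subset_univ _) fun u _ _ => ?_)
  split_ifs <;> positivity

/-- Double counting: every vertex `u` with `D u ≥ d` is the endpoint of `degree u` ordered edges,
each of which carries weight `1 / D u`. -/
lemma sum_vertexWeight_bounds (hD : IsAccurate G δ D) (hδ0 : 0 ≤ δ) (hδ1 : δ < 1) (hd : 1 ≤ d) :
    (1 - δ) / (1 + δ) * tableCcdh D d ≤ ∑ v, vertexWeight G D d v ∧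
    ∑ v, vertexWeight G D d v ≤ (1 + δ) / (1 - δ) * tableCcdh D d := by
  have hswap : ∑ v, ∑ u ∈ G.neighborFinset v, endpointWeight d (D u) =
      ∑ u, G.degree u * endpointWeight d (D u) := by
    have : ∀ v, ∑ u ∈ G.neighborFinset v, endpointWeight d (D u) =
        ∑ u, if G.Adj v u then endpointWeight d (D u) else 0 := by
      intro v
      rw [← Finset.sum_filter]
      refine Finset.sum_congr ?_ fun _ _ => rfl
      ext u; simp
    simp only [this]
    rw [Finset.sum_comm]
    refine Finset.sum_congr rfl fun u _ => ?_
    rw [← Finset.sum_filter, Finset.sum_const, nsmul_eq_mul, ← G.card_neighborFinset_eq_degree]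
    congr 3
    ext v; simp [G.adj_comm]
  have hu : ∀ u, (if (d : ℝ≥0) ≤ D u then (1 : ℝ) else 0) / (1 + δ) ≤
        G.degree u * endpointWeight d (D u) ∧
      G.degree u * endpointWeight d (D u) ≤ (if (d : ℝ≥0) ≤ D u then (1 : ℝ) else 0) / (1 - δ) := by
    intro u
    rw [endpointWeight]
    split_ifs with h
    · have h1 : (d : ℝ) ≤ D u := by exact_mod_cast h
      have h2 : (1 : ℝ) ≤ d := by exact_mod_cast hd
      have h3 : (0 : ℝ) < D u := by linarith
      rw [mul_one_div, div_le_div_iff₀ (by linarith) h3, div_le_div_iff₀ h3 (by linarith)]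
      constructor <;> linarith [hD u]
    · simp
  have hlo := Finset.sum_le_sum fun u (_ : u ∈ Finset.univ) => (hu u).1
  have hhi := Finset.sum_le_sum fun u (_ : u ∈ Finset.univ) => (hu u).2
  rw [← Finset.sum_div] at hlo hhi
  constructor
  · refine le_trans ?_ (Finset.sum_le_sum fun v _ => (vertexWeight_bounds hD v).1)
    rw [← Finset.mul_sum, hswap, div_mul_eq_mul_div, mul_div_assoc]
    exact mul_le_mul_of_nonneg_left hlo (by linarith)
  · refine (Finset.sum_le_sum fun v _ => (vertexWeight_bounds hD v).2).trans ?_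
    rw [← Finset.mul_sum, hswap, div_mul_eq_mul_div, mul_div_assoc]
    exact mul_le_mul_of_nonneg_left hhi (by linarith)

lemma sum_accurate_le (hD : IsAccurate G δ D) :
    ∑ v, (D v : ℝ) ≤ (1 + δ) * ∑ v, (G.degree v : ℝ) := by
  rw [Finset.mul_sum]
  exact Finset.sum_le_sum fun v _ => (hD v).2

/-- Chebyshev's inequality for the endpoint estimate, given the vertex samples. -/
lemma ev_edgeSample_deviation_le (hD : IsAccurate G δ D) (hδ : δ < 1) (hd : 1 ≤ d)
    {R : List (V × ℝ≥0)} (hR : ∀ p ∈ R, p.2 = D p.1) {q : ℕ} (hq : 0 < q) {a : ℝ} (ha : 0 < a)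
    (hS : 0 < (R.map fun p => (p.2 : ℝ)).sum)
    (hZ : 0 < (R.map fun p => vertexWeight G D d p.1).sum) :
    (((edgeSample R).iterate q).ev G D fun Y =>
      if |(Y.map (endpointWeight d)).sum - q * ((R.map fun p => vertexWeight G D d p.1).sum /
          (R.map fun p => (p.2 : ℝ)).sum)| ≤
        a * (q * ((R.map fun p => vertexWeight G D d p.1).sum /
          (R.map fun p => (p.2 : ℝ)).sum)) then 0 else 1) ≤
      (R.map fun p => (p.2 : ℝ)).sum /
        (d * a ^ 2 * q * (R.map fun p => vertexWeight G D d p.1).sum) := by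
  set S := (R.map fun p => (p.2 : ℝ)).sum with hSdef
  set Z := (R.map fun p => vertexWeight G D d p.1).sum with hZdef
  have hmean : (edgeSample R).ev G D (endpointWeight d) = Z / S :=
    ev_edgeSample hD hδ hR hS.ne' _
  have hsq : ((edgeSample R).ev G D fun y => endpointWeight d y ^ 2) ≤ 1 / d * (Z / S) := by
    rw [← hmean, ← ev_mul_left]
    exact ev_mono _ fun y => endpointWeight_sq_le hd y
  have hvar := ev_iterate_sq_le (G := G) (D := D) (edgeSample R) q (endpointWeight d)
  rw [hmean] at hvar
  have hd0 : (0 : ℝ) < d := by exact_mod_cast hd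
  have hq0 : (0 : ℝ) < q := by exact_mod_cast hq
  have hη : 0 < q * (Z / S) := by positivity
  have h1 : (((edgeSample R).iterate q).ev G D fun Y =>
      if |(Y.map (endpointWeight d)).sum - q * (Z / S)| ≤ a * (q * (Z / S)) then (0 : ℝ) else 1) ≤
      ((edgeSample R).iterate q).ev G D fun Y =>
        ((Y.map (endpointWeight d)).sum - q * (Z / S)) ^ 2 / (a * (q * (Z / S))) ^ 2 := by
    refine ev_mono _ fun Y => ?_
    split_ifs with h
    · positivity
    · rw [one_le_div (by positivity), ← sq_abs (_ - _)]
      push Not at h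
      exact pow_le_pow_left₀ (by positivity) h.le 2
  refine h1.trans ?_
  rw [ev_div, div_le_iff₀ (by positivity)]
  refine hvar.trans ((mul_le_mul_of_nonneg_left hsq hq0.le).trans (le_of_eq ?_))
  field_simp

end QueryAlg

lemma abs_sub_le_mul_scale {x y a c : ℝ} (hc : 0 ≤ c) (h : |x - y| ≤ a * y) :
    |c * x - c * y| ≤ a * (c * y) := by
  rw [← mul_sub, abs_mul, abs_of_nonneg hc, mul_left_comm]
  exact mul_le_mul_of_nonneg_left h hc

lemma edge_estimate_mem {n r q S Z B W f δ : ℝ} (hn : 0 < n) (hr : 0 < r) (hq : 0 < q) (hS : 0 < S)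
    (hδ0 : 0 < δ) (hδ1 : δ ≤ 1 / 20) (hf : 0 ≤ f)
    (hB : |B - q * (Z / S)| ≤ δ * (q * (Z / S))) (hZ : |Z - r / n * W| ≤ δ * (r / n * W))
    (hW1 : (1 - δ) / (1 + δ) * f ≤ W) (hW2 : W ≤ (1 + δ) / (1 - δ) * f) :
    (1 - 5 * δ) * f ≤ n / r * (S / q) * B ∧ n / r * (S / q) * B ≤ (1 + 5 * δ) * f := by
  have h1 := abs_sub_le_mul_scale (c := n / r * (S / q)) (by positivity) hB
  have h2 := abs_sub_le_mul_scale (c := n / r) (by positivity) hZ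
  have e1 : n / r * (S / q) * (q * (Z / S)) = n / r * Z := by field_simp
  have e2 : n / r * (r / n * W) = W := by field_simp
  rw [e1] at h1
  rw [e2] at h2
  rw [abs_le] at h1 h2
  set E := n / r * (S / q) * B
  set Z' := n / r * Z
  rw [div_mul_eq_mul_div, div_le_iff₀ (by linarith)] at hW1
  rw [div_mul_eq_mul_div, le_div_iff₀ (by linarith)] at hW2
  have hW0 : 0 ≤ W := by nlinarith
  have l1 : (1 - δ) * ((1 - δ) * W) ≤ E := by nlinarith
  have u1 : E ≤ (1 + δ) * ((1 + δ) * W) := by nlinarith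
  constructor
  · refine le_trans ?_ l1
    have h3 : (1 - δ) ^ 2 * ((1 - δ) * f) ≤ (1 - δ) ^ 2 * (W * (1 + δ)) :=
      mul_le_mul_of_nonneg_left hW1 (sq_nonneg _)
    have h4 : (1 - 5 * δ) * (1 + δ) ≤ (1 - δ) ^ 3 := by nlinarith [pow_pos hδ0 3, pow_pos hδ0 2]
    have h5 := mul_le_mul_of_nonneg_right h4 hf
    by_contra hc
    push Not at hc
    nlinarith
  · refine u1.trans ?_
    have h3 : (1 + δ) ^ 2 * (W * (1 - δ)) ≤ (1 + δ) ^ 2 * ((1 + δ) * f) :=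
      mul_le_mul_of_nonneg_left hW2 (sq_nonneg _)
    have h4 : (1 + δ) ^ 3 ≤ (1 + 5 * δ) * (1 - δ) := by
      nlinarith [pow_pos hδ0 3, pow_pos hδ0 2, mul_pos hδ0 (pow_pos hδ0 2)]
    have h5 := mul_le_mul_of_nonneg_right h4 hf
    by_contra hc
    push Not at hc
    nlinarith

lemma vertex_estimate_mem {n r X f δ : ℝ} (hn : 0 < n) (hr : 0 < r)
    (hδf : 0 ≤ δ * f) (hX : |X - r * f / n| ≤ δ * (r * f / n)) :
    (1 - 5 * δ) * f ≤ n / r * X ∧ n / r * X ≤ (1 + 5 * δ) * f := by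
  have h1 := abs_sub_le_mul_scale (c := n / r) (by positivity) hX
  have e1 : n / r * (r * f / n) = f := by field_simp
  rw [e1, abs_le] at h1
  constructor <;> linarith

/-- The variance of the endpoint estimate is small compared with the square of its mean. -/
lemma edge_variance_le {n r q d m f δ S Z W : ℝ} (hn : 0 < n) (hr : 0 < r) (hq : 0 < q)
    (hd : 0 < d) (hδ1 : δ ≤ 1 / 20) (hm : 0 ≤ m)
    (hS : S ≤ 64 * (r * ((1 + δ) * m) / n)) (hZ : 9 / 10 * (r / n * W) ≤ Z) (hW : 9 / 10 * f ≤ W)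
    (hedge : 9600 * m ≤ q * d * f * δ ^ 2) : S ≤ 1 / 64 * (d * δ ^ 2 * q * Z) := by
  have h1 : 9 / 10 * (r / n * (9 / 10 * f)) ≤ Z := le_trans (by gcongr) hZ
  have h2 : d * δ ^ 2 * q * (9 / 10 * (r / n * (9 / 10 * f))) ≤ d * δ ^ 2 * q * Z :=
    mul_le_mul_of_nonneg_left h1 (by positivity)
  have h3 : r / n * (64 * (1 + δ) * m) ≤ r / n * (81 / 6400 * (q * d * f * δ ^ 2)) := by
    refine mul_le_mul_of_nonneg_left ?_ (by positivity)
    nlinarith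
  have e1 : 64 * (r * ((1 + δ) * m) / n) = r / n * (64 * (1 + δ) * m) := by ring
  have e2 : d * δ ^ 2 * q * (9 / 10 * (r / n * (9 / 10 * f))) =
      64 * (r / n * (81 / 6400 * (q * d * f * δ ^ 2))) := by ring
  linarith

lemma roundEstimate_eq {V : Type u} (n r q : ℕ) (c : ℝ) (R : List (V × ℝ≥0)) (Y : List ℝ≥0)
    (d : ℕ) : roundEstimate n r q c R Y d =
      if c ≤ (R.map fun p => if (d : ℝ≥0) ≤ p.2 then (1 : ℝ) else 0).sum then
        (n : ℝ) / r * (R.map fun p => if (d : ℝ≥0) ≤ p.2 then (1 : ℝ) else 0).sum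
      else (n : ℝ) / r * ((R.map fun p => (p.2 : ℝ)).sum / q) *
        (Y.map (QueryAlg.endpointWeight d)).sum := rfl

lemma one_le_sq_div_sq {x a : ℝ} (ha : 0 < a) (h : a < |x|) : 1 ≤ x ^ 2 / a ^ 2 := by
  rw [one_le_div (by positivity), ← sq_abs x]
  exact pow_le_pow_left₀ ha.le h.le 2

namespace QueryAlg

variable {V : Type u} [Fintype V] [Nonempty V]
variable {G : SimpleGraph V} [DecidableRel G.Adj] {D : V → ℝ≥0} {δ c : ℝ} {d r q : ℕ}

/-- The variance of the number of sampled vertices with degree value at least `d`. -/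
lemma ev_vertexCount_sq_le (D : V → ℝ≥0) (d r : ℕ) :
    (((vertexSample V).iterate r).ev G D fun R =>
      ((R.map fun p => if (d : ℝ≥0) ≤ p.2 then (1 : ℝ) else 0).sum -
        r * tableCcdh D d / Fintype.card V) ^ 2) ≤ r * tableCcdh D d / Fintype.card V := by
  have h := ev_iterate_sq_le (G := G) (D := D) (vertexSample V) r
    (fun p => if (d : ℝ≥0) ≤ p.2 then (1 : ℝ) else 0)
  have e : ∀ p : V × ℝ≥0, (if (d : ℝ≥0) ≤ p.2 then (1 : ℝ) else 0) ^ 2 =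
      if (d : ℝ≥0) ≤ p.2 then (1 : ℝ) else 0 := fun p => by split_ifs <;> norm_num
  simp only [e] at h
  rw [ev_vertexSample] at h
  rw [mul_div_assoc]
  exact h

/-- The variance of the total weight of the sampled vertices. -/
lemma ev_vertexWeight_sq_le (hD : IsAccurate G δ D) (hδ : 0 ≤ δ) (hd : 1 ≤ d) (r : ℕ) :
    (((vertexSample V).iterate r).ev G D fun R =>
      ((R.map fun p => vertexWeight G D d p.1).sum -
        r / Fintype.card V * ∑ v, vertexWeight G D d v) ^ 2) ≤
      (1 + δ) * (tableCcdh D d / d) * (r / Fintype.card V * ∑ v, vertexWeight G D d v) := by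
  have h := ev_iterate_sq_le (G := G) (D := D) (vertexSample V) r
    (fun p => vertexWeight G D d p.1)
  have h2 : ((vertexSample V).ev G D fun p => vertexWeight G D d p.1 ^ 2) ≤
      (1 + δ) * (tableCcdh D d / d) * (vertexSample V).ev G D fun p => vertexWeight G D d p.1 := by
    rw [← ev_mul_left]
    refine ev_mono _ fun p => ?_
    rw [sq]
    exact mul_le_mul_of_nonneg_right (vertexWeight_le hD hδ hd _) (vertexWeight_nonneg _ _)
  have h3 := h.trans (mul_le_mul_of_nonneg_left h2 (Nat.cast_nonneg r))
  rw [ev_vertexSample] at h3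
  have e : ∀ x : ℝ, (r : ℝ) * (x / Fintype.card V) = r / Fintype.card V * x := fun x => by ring
  simp only [e] at h3
  refine h3.trans (le_of_eq ?_)
  ring

lemma ev_degreeSum (D : V → ℝ≥0) (r : ℕ) :
    (((vertexSample V).iterate r).ev G D fun R => (R.map fun p => (p.2 : ℝ)).sum) =
      r * (∑ v, (D v : ℝ)) / Fintype.card V := by
  rw [ev_iterate_sum, ev_vertexSample, mul_div_assoc]

/-- When the number of samples above `d` is large in expectation, the vertex estimate is used and
is accurate with high probability. -/
lemma ev_saddlesRound_le_of_many (hδ0 : 0 < δ) (hδ1 : δ ≤ 1 / 20) (hr : 0 < r)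
    (hc0 : 0 < c) (hc : 512 ≤ c * δ ^ 2)
    (hmany : 2 * c ≤ r * tableCcdh D d / Fintype.card V) :
    ((saddlesRound V r q c).ev G D fun Nt =>
      if (1 - 5 * δ) * tableCcdh D d ≤ Nt d ∧ Nt d ≤ (1 + 5 * δ) * tableCcdh D d then 0 else 1) ≤
      1 / 8 := by
  set f := tableCcdh D d with hf
  set n : ℝ := (Fintype.card V : ℝ) with hn
  have hn0 : 0 < n := by rw [hn]; exact_mod_cast Fintype.card_pos
  have hr0 : (0 : ℝ) < r := by exact_mod_cast hr
  set μ := r * f / n with hμ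
  have hμ0 : 0 < μ := by linarith
  rw [saddlesRound, ev_bind]
  have h1 : (((vertexSample V).iterate r).ev G D fun R =>
      (((edgeSample R).iterate q).bind fun Y =>
        ret fun d => roundEstimate (Fintype.card V) r q c R Y d).ev G D fun Nt =>
          if (1 - 5 * δ) * f ≤ Nt d ∧ Nt d ≤ (1 + 5 * δ) * f then (0 : ℝ) else 1) ≤
      ((vertexSample V).iterate r).ev G D fun R =>
        ((R.map fun p => if (d : ℝ≥0) ≤ p.2 then (1 : ℝ) else 0).sum - μ) ^ 2 / (δ * μ) ^ 2 := by
    refine ev_mono _ fun R => ?_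
    rw [ev_bind]
    refine ev_le_of_reach _ (reach_of_forall _ fun Y => ?_)
    have e := roundEstimate_eq (Fintype.card V) r q c R Y d
    set X := (R.map fun p => if (d : ℝ≥0) ≤ p.2 then (1 : ℝ) else 0).sum with hX
    rw [ev]
    beta_reduce
    rw [e]
    by_cases hdev : |X - μ| ≤ δ * μ
    · have hcX : c ≤ X := by
        have := (abs_le.1 hdev).1
        nlinarith
      rw [if_pos hcX, if_pos (vertex_estimate_mem hn0 hr0
        (mul_nonneg hδ0.le (tableCcdh_nonneg d)) hdev)]
      positivity
    · have := one_le_sq_div_sq (by positivity) (not_le.1 hdev)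
      refine le_trans ?_ this
      split_ifs <;> norm_num
  refine h1.trans ?_
  rw [ev_div, div_le_iff₀ (by positivity)]
  refine (ev_vertexCount_sq_le D d r).trans ?_
  rw [← hf, ← hn, ← hμ]
  have : 512 * 2 ≤ μ * δ ^ 2 := by nlinarith [sq_nonneg δ]
  nlinarith

/-- The endpoint estimate for a fixed vertex sample whose statistics are close to their means. -/
lemma ev_roundEstimate_le (hD : IsAccurate G δ D) (hδ0 : 0 < δ) (hδ1 : δ ≤ 1 / 20)
    (hd : 1 ≤ d) (hr : 0 < r) (hq : 0 < q) (hc0 : 0 < c) (hf0 : 0 < tableCcdh D d)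
    (hedge : 9600 * ∑ v, (G.degree v : ℝ) ≤ q * d * tableCcdh D d * δ ^ 2)
    {R : List (V × ℝ≥0)} (hR : ∀ p ∈ R, p.2 = D p.1)
    (hX : |(R.map fun p => if (d : ℝ≥0) ≤ p.2 then (1 : ℝ) else 0).sum -
      r * tableCcdh D d / Fintype.card V| ≤ δ * c / 2)
    (hZ : |(R.map fun p => vertexWeight G D d p.1).sum -
      r / Fintype.card V * ∑ v, vertexWeight G D d v| ≤
        δ * (r / Fintype.card V * ∑ v, vertexWeight G D d v))
    (hS : (R.map fun p => (p.2 : ℝ)).sum ≤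
      64 * (r * ((1 + δ) * ∑ v, (G.degree v : ℝ)) / Fintype.card V)) :
    (((edgeSample R).iterate q).ev G D fun Y =>
      if (1 - 5 * δ) * tableCcdh D d ≤ roundEstimate (Fintype.card V) r q c R Y d ∧
        roundEstimate (Fintype.card V) r q c R Y d ≤ (1 + 5 * δ) * tableCcdh D d
        then 0 else 1) ≤ 1 / 64 := by
  have e := fun Y => roundEstimate_eq (Fintype.card V) r q c R Y d
  obtain ⟨hW1, hW2⟩ := sum_vertexWeight_bounds (d := d) hD hδ0.le (by linarith) hd
  have hdev := ev_edgeSample_deviation_le (q := q) hD (by linarith) hd hR hq hδ0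
  set f := tableCcdh D d
  set S := (R.map fun p => (p.2 : ℝ)).sum with hSd
  set Z := (R.map fun p => vertexWeight G D d p.1).sum with hZd
  set X := (R.map fun p => if (d : ℝ≥0) ≤ p.2 then (1 : ℝ) else 0).sum
  set W := ∑ v, vertexWeight G D d v
  have hn0 : (0 : ℝ) < Fintype.card V := by exact_mod_cast Fintype.card_pos
  set n := (Fintype.card V : ℝ)
  have hr0 : (0 : ℝ) < r := by exact_mod_cast hr
  have hq0 : (0 : ℝ) < q := by exact_mod_cast hq
  have hd0 : (0 : ℝ) < d := by exact_mod_cast hd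
  have hW9 : 9 / 10 * f ≤ W := by
    refine le_trans (mul_le_mul_of_nonneg_right ?_ hf0.le) hW1
    rw [le_div_iff₀ (by linarith)]
    linarith
  have hW0 : 0 < W := by linarith
  have hz0 : 0 < (r : ℝ) / n * W := by positivity
  have hδz : δ * (r / n * W) ≤ 1 / 10 * (r / n * W) :=
    mul_le_mul_of_nonneg_right (by linarith) hz0.le
  have hZlow : 9 / 10 * (r / n * W) ≤ Z := by linarith [(abs_le.1 hZ).1]
  have hZ0 : 0 < Z := by linarith
  have hS0 : 0 ≤ S := by
    refine List.sum_nonneg fun x hx => ?_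
    obtain ⟨p, _, rfl⟩ := List.mem_map.1 hx
    positivity
  have hSpos : 0 < S := by
    refine lt_of_le_of_ne hS0 fun h => hZ0.ne' ?_
    -- a sample of degree sum zero has weight zero
    refine List.sum_eq_zero fun x hx => ?_
    obtain ⟨p, hp, rfl⟩ := List.mem_map.1 hx
    have hp0 : (p.2 : ℝ) ≤ 0 := by
      rw [h]
      refine List.single_le_sum (fun y hy => ?_) _ (List.mem_map.2 ⟨p, hp, rfl⟩)
      obtain ⟨p', _, rfl⟩ := List.mem_map.1 hy
      positivity
    rw [hR p hp] at hp0
    have : (D p.1 : ℝ) = 0 := le_antisymm hp0 (NNReal.coe_nonneg _)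
    rw [vertexWeight, this, zero_mul]
  refine le_trans (ev_mono _ fun Y => ?_) ((hdev hSpos hZ0).trans ?_)
  · by_cases hY : |(Y.map (endpointWeight d)).sum - q * (Z / S)| ≤ δ * (q * (Z / S))
    · rw [if_pos hY, if_pos]
      rw [e]
      by_cases hcX : c ≤ X
      · rw [if_pos hcX]
        refine vertex_estimate_mem hn0 hr0 (by positivity) (hX.trans ?_)
        have hδc : δ * c ≤ 1 * c := mul_le_mul_of_nonneg_right (by linarith) hc0.le
        have hμc : c / 2 ≤ r * f / n := by linarith [(abs_le.1 hX).2]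
        rw [mul_div_assoc]
        exact mul_le_mul_of_nonneg_left hμc hδ0.le
      · rw [if_neg hcX]
        exact edge_estimate_mem hn0 hr0 hq0 hSpos hδ0 hδ1 hf0.le hY hZ hW1 hW2
    · rw [if_neg hY]
      split_ifs <;> norm_num
  · rw [div_le_iff₀ (by positivity)]
    exact edge_variance_le hn0 hr0 hq0 hd0 hδ1 (Finset.sum_nonneg fun _ _ => Nat.cast_nonneg _)
      hS hZlow hW9 hedge

/-- When the expected number of samples above `d` is small, the endpoint estimate is accurate with
probability bounded below: the weight of the sampled vertices and the endpoint average are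
controlled by Chebyshev's inequality, the degree sum of the sample by Markov's inequality. -/
lemma ev_saddlesRound_le_of_few (hD : IsAccurate G δ D) (hδ0 : 0 < δ) (hδ1 : δ ≤ 1 / 20)
    (hd : 1 ≤ d) (hr : 0 < r) (hq : 0 < q) (hc0 : 0 < c) (hc : 512 ≤ c * δ ^ 2)
    (hf0 : 0 < tableCcdh D d) (hm : 0 < ∑ v, (G.degree v : ℝ))
    (hfew : r * tableCcdh D d / Fintype.card V < 2 * c)
    (hvert : 128 * (Fintype.card V : ℝ) ≤ r * d * δ ^ 2)
    (hedge : 9600 * ∑ v, (G.degree v : ℝ) ≤ q * d * tableCcdh D d * δ ^ 2) :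
    ((saddlesRound V r q c).ev G D fun Nt =>
      if (1 - 5 * δ) * tableCcdh D d ≤ Nt d ∧ Nt d ≤ (1 + 5 * δ) * tableCcdh D d then 0 else 1) ≤
      1 / 8 := by
  set f := tableCcdh D d with hf
  set n : ℝ := (Fintype.card V : ℝ) with hn
  set m := ∑ v, (G.degree v : ℝ) with hmdef
  set W := ∑ v, vertexWeight G D d v with hW
  have hn0 : 0 < n := by rw [hn]; exact_mod_cast Fintype.card_pos
  have hr0 : (0 : ℝ) < r := by exact_mod_cast hr
  have hq0 : (0 : ℝ) < q := by exact_mod_cast hq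
  have hd0 : (0 : ℝ) < d := by exact_mod_cast hd
  obtain ⟨hW1, hW2⟩ := sum_vertexWeight_bounds (d := d) hD hδ0.le (by linarith) hd
  rw [← hf, ← hW] at hW1 hW2
  have hW9 : 9 / 10 * f ≤ W := by
    refine le_trans (mul_le_mul_of_nonneg_right ?_ hf0.le) hW1
    rw [le_div_iff₀ (by linarith)]
    linarith
  set μ := r * f / n with hμ
  set z := r / n * W with hz
  have hW0 : 0 < W := by nlinarith
  have hz0 : 0 < z := by positivity
  set M := 64 * (r * ((1 + δ) * m) / n) with hM
  have hM0 : 0 < M := by positivity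
  set X : List (V × ℝ≥0) → ℝ := fun R => (R.map fun p => if (d : ℝ≥0) ≤ p.2 then (1 : ℝ) else 0).sum
    with hX
  set Z : List (V × ℝ≥0) → ℝ := fun R => (R.map fun p => vertexWeight G D d p.1).sum with hZ
  set S : List (V × ℝ≥0) → ℝ := fun R => (R.map fun p => (p.2 : ℝ)).sum with hS
  have hS0 : ∀ R, 0 ≤ S R := fun R => List.sum_nonneg fun x hx => by
    obtain ⟨p, _, rfl⟩ := List.mem_map.1 hx
    positivity
  rw [saddlesRound, ev_bind]
  have h1 : (((vertexSample V).iterate r).ev G D fun R =>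
      (((edgeSample R).iterate q).bind fun Y =>
        ret fun d => roundEstimate (Fintype.card V) r q c R Y d).ev G D fun Nt =>
          if (1 - 5 * δ) * f ≤ Nt d ∧ Nt d ≤ (1 + 5 * δ) * f then (0 : ℝ) else 1) ≤
      ((vertexSample V).iterate r).ev G D fun R =>
        (X R - μ) ^ 2 / (δ * c / 2) ^ 2 + ((Z R - z) ^ 2 / (δ * z) ^ 2 + (S R / M + 1 / 64)) := by
    refine ev_mono_of_reach _ ((reach_iterate _ reach_vertexSample r).mono ?_)
    rintro R ⟨-, hR⟩
    rw [ev_bind]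
    have hone : ∀ (F : (ℕ → ℝ) → Prop) [DecidablePred F], (((edgeSample R).iterate q).ev G D
        fun Y => (ret fun d => roundEstimate (Fintype.card V) r q c R Y d : QueryAlg V (ℕ → ℝ)).ev
          G D fun Nt => if F Nt then (0 : ℝ) else 1) ≤ 1 := fun F _ =>
      ev_le_of_reach _ (reach_of_forall _ fun Y => by
        rw [ev]; split_ifs <;> norm_num)
    have p1 : 0 ≤ (X R - μ) ^ 2 / (δ * c / 2) ^ 2 := by positivity
    have p2 : 0 ≤ (Z R - z) ^ 2 / (δ * z) ^ 2 := by positivity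
    have p3 : 0 ≤ S R / M := div_nonneg (hS0 R) hM0.le
    by_cases hdX : δ * c / 2 < |X R - μ|
    · exact (hone _).trans (by linarith [one_le_sq_div_sq (by positivity) hdX])
    by_cases hdZ : δ * z < |Z R - z|
    · exact (hone _).trans (by linarith [one_le_sq_div_sq (by positivity) hdZ])
    by_cases hdS : M < S R
    · exact (hone _).trans (by linarith [(one_lt_div hM0).2 hdS])
    have h2 := ev_roundEstimate_le hD hδ0 hδ1 hd hr hq hc0 hf0 hedge hR (not_lt.1 hdX)
      (not_lt.1 hdZ) (not_lt.1 hdS)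
    refine le_trans (le_trans (le_of_eq ?_) h2) (by linarith)
    simp only [ev, ← hf]
  refine h1.trans ?_
  rw [ev_add, ev_add, ev_add, ev_const, ev_div, ev_div, ev_div]
  have b1 : (((vertexSample V).iterate r).ev G D fun R => (X R - μ) ^ 2) / (δ * c / 2) ^ 2 ≤
      1 / 64 := by
    rw [div_le_iff₀ (by positivity)]
    refine (ev_vertexCount_sq_le D d r).trans ?_
    rw [← hf, ← hn, ← hμ]
    nlinarith
  have b2 : (((vertexSample V).iterate r).ev G D fun R => (Z R - z) ^ 2) / (δ * z) ^ 2 ≤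
      1 / 64 := by
    rw [div_le_iff₀ (by positivity)]
    refine (ev_vertexWeight_sq_le hD hδ0.le hd r).trans ?_
    rw [← hf, ← hn, ← hW, ← hz]
    have e : 1 / 64 * (δ * z) ^ 2 = 1 / 64 * (δ ^ 2 * z) * z := by ring
    rw [e]
    refine mul_le_mul_of_nonneg_right ?_ hz0.le
    rw [← mul_div_assoc, div_le_iff₀ hd0]
    have h2 : δ ^ 2 * (r / n * (9 / 10 * f)) * d ≤ δ ^ 2 * z * d := by
      rw [hz]; gcongr
    have h3 : 128 * (9 / 10 * f) ≤ δ ^ 2 * (r / n * (9 / 10 * f)) * d := by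
      have e' : δ ^ 2 * (r / n * (9 / 10 * f)) * d = (r * d * δ ^ 2) / n * (9 / 10 * f) := by ring
      rw [e']
      refine mul_le_mul_of_nonneg_right ?_ (by positivity)
      rw [le_div_iff₀ hn0]
      exact hvert
    nlinarith
  have b3 : (((vertexSample V).iterate r).ev G D fun R => S R) / M ≤ 1 / 64 := by
    rw [div_le_iff₀ hM0, ev_degreeSum]
    have h2 := sum_accurate_le hD
    rw [← hmdef] at h2
    have h3 : r * (∑ v, (D v : ℝ)) / n ≤ r * ((1 + δ) * m) / n :=
      div_le_div_of_nonneg_right (mul_le_mul_of_nonneg_left h2 hr0.le) hn0.le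
    rw [← hn]
    linarith
  linarith

/-- For a degree that no vertex reaches, every round returns exactly `0`. -/
lemma reach_saddlesRound_zero (hc0 : 0 < c) :
    (saddlesRound V r q c).Reach G D fun Nt => ∀ d : ℕ, 1 ≤ d → (∀ v, ¬ (d : ℝ≥0) ≤ D v) → Nt d = 0 := by
  refine (reach_iterate _ reach_vertexSample r).bind ?_
  rintro R ⟨-, hR⟩
  refine (reach_iterate _ (reach_edgeSample R) q).bind ?_
  rintro Y ⟨-, hY⟩ d hd hD
  have hX : (R.map fun p => if (d : ℝ≥0) ≤ p.2 then (1 : ℝ) else 0).sum = 0 := by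
    refine List.sum_eq_zero fun x hx => ?_
    obtain ⟨p, hp, rfl⟩ := List.mem_map.1 hx
    rw [if_neg (by rw [hR p hp]; exact hD _)]
  have hY0 : (Y.map fun y => if (d : ℝ≥0) ≤ y then 1 / (y : ℝ) else 0).sum = 0 := by
    refine List.sum_eq_zero fun x hx => ?_
    obtain ⟨y, hy, rfl⟩ := List.mem_map.1 hx
    rw [if_neg]
    rcases hY y hy with rfl | ⟨u, rfl⟩
    · rw [not_le]
      exact_mod_cast Nat.lt_of_lt_of_le Nat.zero_lt_one hd
    · exact hD u
  simp only [roundEstimate, hX, hY0, if_neg (not_le.2 hc0), mul_zero]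

end QueryAlg

/-! ### The accuracy of the median -/

lemma ccdh_antitone {V : Type u} [Fintype V] (G : SimpleGraph V) [DecidableRel G.Adj] :
    Antitone (ccdh G) := fun _ _ hxy =>
  Finset.card_le_card fun v hv => by
    simp only [Finset.mem_filter, Finset.mem_univ, true_and] at hv ⊢
    exact hxy.trans hv

lemma IsCcdhEstimate.mono {V : Type u} [Fintype V] {G : SimpleGraph V} [DecidableRel G.Adj]
    {ε ε' : ℝ} {Nt : ℕ → ℝ} (h : IsCcdhEstimate G ε Nt) (h0 : 0 ≤ ε) (h1 : ε ≤ 1)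
    (hε : ε ≤ ε') : IsCcdhEstimate G ε' Nt := by
  intro d hd
  have hd0 : (0 : ℝ) ≤ d := Nat.cast_nonneg d
  obtain ⟨hl, hu⟩ := h d hd
  have a1 : (ccdh G ((1 + ε') * d) : ℝ) ≤ ccdh G ((1 + ε) * d) := by
    exact_mod_cast ccdh_antitone G (mul_le_mul_of_nonneg_right (by linarith) hd0)
  have a2 : (ccdh G ((1 - ε) * d) : ℝ) ≤ ccdh G ((1 - ε') * d) := by
    exact_mod_cast ccdh_antitone G (mul_le_mul_of_nonneg_right (by linarith) hd0)
  have c1 : (0 : ℝ) ≤ ccdh G ((1 + ε') * d) := Nat.cast_nonneg _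
  have c2 : (0 : ℝ) ≤ ccdh G ((1 - ε) * d) := Nat.cast_nonneg _
  constructor
  · refine le_trans ?_ hl
    nlinarith
  · refine hu.trans ?_
    nlinarith

namespace QueryAlg

variable {V : Type u} [Fintype V] [Nonempty V]
variable {G : SimpleGraph V} [DecidableRel G.Adj] {D : V → ℝ≥0} {δ c : ℝ} {d r q ℓ : ℕ}

lemma tableCcdh_eq_card (D : V → ℝ≥0) (d : ℕ) :
    tableCcdh D d = (Finset.univ.filter fun u => (d : ℝ≥0) ≤ D u).card := by
  rw [tableCcdh, Finset.sum_boole]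

lemma ccdh_le_tableCcdh (hD : IsAccurate G δ D) {x : ℝ} (hδ1 : δ ≤ 1)
    (hx : (d : ℝ) ≤ (1 - δ) * x) : (ccdh G x : ℝ) ≤ tableCcdh D d := by
  rw [tableCcdh_eq_card]
  refine Nat.cast_le.2 (Finset.card_le_card fun v hv => ?_)
  simp only [Finset.mem_filter, Finset.mem_univ, true_and] at hv ⊢
  have h1 : (d : ℝ) ≤ D v :=
    hx.trans ((mul_le_mul_of_nonneg_left hv (by linarith)).trans (hD v).1)
  exact_mod_cast h1

lemma tableCcdh_le_ccdh (hD : IsAccurate G δ D) {x : ℝ} (hδ0 : 0 ≤ δ)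
    (hx : (1 + δ) * x ≤ d) : tableCcdh D d ≤ ccdh G x := by
  rw [tableCcdh_eq_card]
  refine Nat.cast_le.2 (Finset.card_le_card fun v hv => ?_)
  simp only [Finset.mem_filter, Finset.mem_univ, true_and] at hv ⊢
  have h1 : (d : ℝ) ≤ D v := by exact_mod_cast hv
  have h2 := hx.trans (h1.trans (hD v).2)
  exact le_of_mul_le_mul_left h2 (by linarith)

/-- An accurate table costs a factor `1 ± δ` in the argument of the ccdh, the deviations of the
samples a factor `1 ± 5 δ` in its value. -/
lemma estimate_bounds (hD : IsAccurate G δ D) (hδ0 : 0 < δ) (hδ1 : δ ≤ 1 / 20) {x : ℝ}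
    (h1 : (1 - 5 * δ) * tableCcdh D d ≤ x) (h2 : x ≤ (1 + 5 * δ) * tableCcdh D d) :
    (1 - 10 * δ) * (ccdh G ((1 + 10 * δ) * d) : ℝ) ≤ x ∧
      x ≤ (1 + 10 * δ) * (ccdh G ((1 - 10 * δ) * d) : ℝ) := by
  have hd0 : (0 : ℝ) ≤ d := Nat.cast_nonneg d
  have a1 := ccdh_le_tableCcdh (d := d) (x := (1 + 10 * δ) * d) hD (by linarith) (by
    rw [← mul_assoc]
    exact le_mul_of_one_le_left hd0 (by nlinarith))
  have a2 := tableCcdh_le_ccdh (d := d) (x := (1 - 10 * δ) * d) hD hδ0.le (by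
    rw [← mul_assoc]
    exact mul_le_of_le_one_left hd0 (by nlinarith))
  have c1 : (0 : ℝ) ≤ ccdh G ((1 + 10 * δ) * d) := Nat.cast_nonneg _
  have c2 := tableCcdh_nonneg (D := D) d
  constructor
  · exact le_trans (mul_le_mul (by linarith) a1 c1 (by linarith)) h1
  · exact h2.trans (mul_le_mul (by linarith) a2 c2 (by linarith))

lemma ev_saddlesRound_le (hD : IsAccurate G δ D) (hδ0 : 0 < δ) (hδ1 : δ ≤ 1 / 20)
    (hd : 1 ≤ d) (hr : 0 < r) (hq : 0 < q) (hc0 : 0 < c) (hc : 512 ≤ c * δ ^ 2)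
    (hm : 0 < ∑ v, (G.degree v : ℝ))
    (hvert : 0 < tableCcdh D d → r * tableCcdh D d / Fintype.card V < 2 * c →
      128 * (Fintype.card V : ℝ) ≤ r * d * δ ^ 2)
    (hedge : 0 < tableCcdh D d →
      9600 * ∑ v, (G.degree v : ℝ) ≤ q * d * tableCcdh D d * δ ^ 2) :
    ((saddlesRound V r q c).ev G D fun Nt =>
      if (1 - 5 * δ) * tableCcdh D d ≤ Nt d ∧ Nt d ≤ (1 + 5 * δ) * tableCcdh D d then 0 else 1) ≤
      1 / 8 := by
  rcases (tableCcdh_nonneg (D := D) d).lt_or_eq with hf | hf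
  · by_cases hmany : 2 * c ≤ r * tableCcdh D d / Fintype.card V
    · exact ev_saddlesRound_le_of_many hδ0 hδ1 hr hc0 hc hmany
    · exact ev_saddlesRound_le_of_few hD hδ0 hδ1 hd hr hq hc0 hc hf hm (not_le.1 hmany)
        (hvert hf (not_le.1 hmany)) (hedge hf)
  · have hnone : ∀ v, ¬ (d : ℝ≥0) ≤ D v := by
      intro v hv
      rw [tableCcdh_eq_card] at hf
      have : (Finset.univ.filter fun u => (d : ℝ≥0) ≤ D u).card = 0 := by exact_mod_cast hf.symm
      rw [Finset.card_eq_zero] at this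
      exact Finset.notMem_empty v (this ▸ Finset.mem_filter.2 ⟨Finset.mem_univ v, hv⟩)
    refine ev_le_of_reach _ ((reach_saddlesRound_zero hc0).mono fun Nt hNt => ?_)
    rw [hNt d hd hnone, ← hf, if_pos (by simp)]
    norm_num

open Classical in
/-- SADDLES with an accurate table of degrees fails with probability exponentially small in the
number of rounds. -/
lemma ev_saddlesSM_le (hD : IsAccurate G δ D) (hδ0 : 0 < δ) (hδ1 : δ ≤ 1 / 20)
    (hr : 0 < r) (hq : 0 < q) (hℓ : 0 < ℓ) (hc0 : 0 < c) (hc : 512 ≤ c * δ ^ 2)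
    (hm : 0 < ∑ v, (G.degree v : ℝ))
    (hvert : ∀ d : ℕ, 1 ≤ d → 0 < tableCcdh D d →
      r * tableCcdh D d / Fintype.card V < 2 * c → 128 * (Fintype.card V : ℝ) ≤ r * d * δ ^ 2)
    (hedge : ∀ d : ℕ, 1 ≤ d → 0 < tableCcdh D d →
      9600 * ∑ v, (G.degree v : ℝ) ≤ q * d * tableCcdh D d * δ ^ 2) :
    ((saddlesSM V r q ℓ c).ev G D fun Nt => if IsCcdhEstimate G (10 * δ) Nt then 0 else 1) ≤
      2 * Fintype.card V * (11 / 16) ^ ℓ := by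
  rw [saddlesSM, ev_bind]
  set good : ℕ → List (ℕ → ℝ) → Prop := fun d L =>
    (1 - 5 * δ) * tableCcdh D d ≤ listMedian (L.map fun Nt => Nt d) ∧
      listMedian (L.map fun Nt => Nt d) ≤ (1 + 5 * δ) * tableCcdh D d with hgood
  have h1 : (((saddlesRound V r q c).iterate ℓ).ev G D fun L =>
      (ret fun d => listMedian (L.map fun Nt => Nt d) : QueryAlg V (ℕ → ℝ)).ev G D fun Nt =>
        if IsCcdhEstimate G (10 * δ) Nt then (0 : ℝ) else 1) ≤
      ((saddlesRound V r q c).iterate ℓ).ev G D fun L =>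
        ∑ d ∈ Finset.Icc 1 (2 * Fintype.card V), if good d L then (0 : ℝ) else 1 := by
    refine ev_mono_of_reach _ ((reach_iterate _ (reach_saddlesRound_zero hc0) ℓ).mono ?_)
    rintro L ⟨hL, hL0⟩
    rw [ev]
    have hterm : ∀ d ∈ Finset.Icc 1 (2 * Fintype.card V),
        (0 : ℝ) ≤ if good d L then (0 : ℝ) else 1 := fun d _ => by split_ifs <;> norm_num
    by_cases hall : ∀ d ∈ Finset.Icc 1 (2 * Fintype.card V), good d L
    · rw [if_pos]
      · exact Finset.sum_nonneg hterm
      intro d hd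
      by_cases hdn : d ≤ 2 * Fintype.card V
      · have := hall d (Finset.mem_Icc.2 ⟨hd, hdn⟩)
        exact estimate_bounds hD hδ0 hδ1 this.1 this.2
      · -- no degree value reaches `d`, and all estimates are `0`
        have hnone : ∀ v, ¬ (d : ℝ≥0) ≤ D v := by
          intro v hv
          have h2 : (d : ℝ) ≤ D v := by exact_mod_cast hv
          have h3 : (G.degree v : ℝ) ≤ Fintype.card V := by
            exact_mod_cast (G.degree_lt_card_verts v).le
          have h4 : 2 * (Fintype.card V : ℝ) < d := by exact_mod_cast not_le.1 hdn
          have h5 : (0 : ℝ) ≤ G.degree v := Nat.cast_nonneg _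
          nlinarith [(hD v).2]
        have hf : tableCcdh D d = 0 := by
          rw [tableCcdh]
          exact Finset.sum_eq_zero fun v _ => if_neg (hnone v)
        have hmed : 0 ≤ listMedian (L.map fun Nt => Nt d) ∧
            listMedian (L.map fun Nt => Nt d) ≤ 0 := by
          refine listMedian_mem ?_
          have : (L.map fun Nt : ℕ → ℝ => Nt d).filter (fun x => ¬ ((0 : ℝ) ≤ x ∧ x ≤ 0)) = [] := by
            rw [List.filter_eq_nil_iff]
            intro x hx
            obtain ⟨Nt, hNt, rfl⟩ := List.mem_map.1 hx
            rw [hL0 Nt hNt d hd hnone]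
            simp
          rw [this, List.length_map, hL]
          simpa using hℓ
        refine estimate_bounds hD hδ0 hδ1 ?_ ?_ <;> rw [hf, mul_zero]
        exacts [hmed.1, hmed.2]
    · push Not at hall
      obtain ⟨d, hd, hbad⟩ := hall
      refine le_trans ?_ (Finset.single_le_sum hterm hd)
      rw [if_neg hbad]
      split_ifs <;> norm_num
  refine h1.trans ?_
  rw [ev_sum]
  have h2 : ∀ d ∈ Finset.Icc 1 (2 * Fintype.card V),
      (((saddlesRound V r q c).iterate ℓ).ev G D fun L => if good d L then (0 : ℝ) else 1) ≤
        (11 / 16) ^ ℓ := by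
    intro d hd
    have hd1 := (Finset.mem_Icc.1 hd).1
    exact ev_median_le _ ℓ (fun Nt : ℕ → ℝ => Nt d) _ _ (ev_saddlesRound_le hD hδ0 hδ1 hd1 hr hq hc0 hc hm
      (hvert d hd1) (hedge d hd1))
  refine (Finset.sum_le_sum h2).trans (le_of_eq ?_)
  simp

/-! ### Power laws -/

variable {γ τ A : ℝ}

lemma floor_le_tableCcdh (hD : IsAccurate G δ D) (hδ1 : δ ≤ 1 / 2)
    (hG : PowerLawBelow G γ τ) (hd : 1 ≤ d) :
    τ * Fintype.card V / (2 * d : ℝ) ^ (γ - 1) < tableCcdh D d + 1 := by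
  have h1 := hG (2 * d) (by omega)
  push_cast at h1
  have hd0 : (0 : ℝ) ≤ d := Nat.cast_nonneg d
  have h2 := ccdh_le_tableCcdh (d := d) (x := 2 * d) hD (by linarith) (by nlinarith)
  have h3 : ((⌊τ * (Fintype.card V : ℝ) / (2 * d : ℝ) ^ (γ - 1)⌋₊ : ℕ) : ℝ) ≤ tableCcdh D d :=
    le_trans (by exact_mod_cast h1) h2
  exact (Nat.lt_floor_add_one _).trans_le (by linarith)

/-- If `n ^ (1 - 1 / γ)` samples contain few vertices above `d`, then `d` is of order at least
`n ^ (1 / γ)`, because a power law has many vertices above all smaller degrees. -/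
lemma vertex_sample_size (hγ : 2 < γ) (hτ : 0 < τ) (hD : IsAccurate G δ D) (hδ0 : 0 < δ)
    (hδ1 : δ ≤ 1 / 2) (hG : PowerLawBelow G γ τ) (hd : 1 ≤ d) (hA0 : 0 < A) (hAc : 2 * c ≤ A)
    (hA1 : 256 ≤ A * δ ^ 2) (hA2 : 512 ≤ τ * A * δ ^ 2)
    (hr : A * (Fintype.card V : ℝ) ^ (1 - 1 / γ) ≤ r)
    (hfew : r * tableCcdh D d / Fintype.card V < 2 * c) :
    128 * (Fintype.card V : ℝ) ≤ r * d * δ ^ 2 := by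
  by_contra hcon
  push Not at hcon
  have hn1 : (1 : ℝ) ≤ Fintype.card V := by exact_mod_cast Fintype.card_pos
  have hpl := floor_le_tableCcdh hD hδ1 hG hd
  set n := (Fintype.card V : ℝ)
  set f := tableCcdh D d
  have hn0 : 0 < n := by linarith
  have hd0 : (0 : ℝ) < d := by exact_mod_cast hd
  have hδ2 : 0 < δ ^ 2 := by positivity
  set b := n ^ (1 / γ) with hb
  have hb1 : 1 ≤ b := Real.one_le_rpow hn1 (by positivity)
  have hb0 : 0 < b := by linarith
  have hnb : n ^ (1 - 1 / γ) * b = n := by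
    rw [hb, ← Real.rpow_add hn0]; norm_num
  have hnb' : n ^ (1 - 1 / γ) = n / b := by rw [eq_div_iff hb0.ne', hnb]
  have hbγ : b ^ (γ - 1) = n ^ (1 - 1 / γ) := by
    rw [hb, ← Real.rpow_mul hn0.le]
    congr 1
    field_simp
  -- the degree is small compared with `n ^ (1 / γ)`
  have h1 : A * (n / b) * d * δ ^ 2 < 128 * n := by
    rw [hnb'] at hr
    exact lt_of_le_of_lt (by gcongr) hcon
  have h2 : 2 * d * (A * δ ^ 2 / 256) < b := by
    have e : A * (n / b) * d * δ ^ 2 = n / b * (A * d * δ ^ 2) := by ring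
    rw [e, div_mul_eq_mul_div, div_lt_iff₀ hb0] at h1
    have : A * d * δ ^ 2 < 128 * b := by nlinarith
    linarith
  set κ := A * δ ^ 2 / 256 with hκ
  have hκ1 : 1 ≤ κ := by rw [hκ, le_div_iff₀ (by norm_num)]; linarith
  have hκ0 : 0 < κ := by linarith
  -- hence the power law gives more than `2 n ^ (1 / γ)` vertices
  have h3 : (2 * d : ℝ) ^ (γ - 1) * κ ≤ n / b := by
    calc (2 * d : ℝ) ^ (γ - 1) * κ ≤ (2 * d : ℝ) ^ (γ - 1) * κ ^ (γ - 1) := by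
          refine mul_le_mul_of_nonneg_left ?_ (by positivity)
          calc κ = κ ^ (1 : ℝ) := (Real.rpow_one κ).symm
            _ ≤ κ ^ (γ - 1) := Real.rpow_le_rpow_of_exponent_le hκ1 (by linarith)
      _ = (2 * d * κ) ^ (γ - 1) := (Real.mul_rpow (by positivity) hκ0.le).symm
      _ ≤ b ^ (γ - 1) := Real.rpow_le_rpow (by positivity) h2.le (by linarith)
      _ = n / b := by rw [hbγ, hnb']
  have hp : 0 < (2 * d : ℝ) ^ (γ - 1) := by positivity
  have h4 : 2 * b ≤ τ * n / (2 * d : ℝ) ^ (γ - 1) := by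
    rw [le_div_iff₀ hp]
    rw [le_div_iff₀ hb0] at h3
    have hτκ : 2 ≤ τ * κ := by rw [hκ]; linarith
    have h5 : τ * ((2 * d : ℝ) ^ (γ - 1) * κ * b) ≤ τ * n := mul_le_mul_of_nonneg_left h3 hτ.le
    have h6 : 2 * ((2 * d : ℝ) ^ (γ - 1) * b) ≤ τ * κ * ((2 * d : ℝ) ^ (γ - 1) * b) :=
      mul_le_mul_of_nonneg_right hτκ (by positivity)
    linarith
  have h5 : f < b := by
    rw [div_lt_iff₀ hn0] at hfew
    rw [hnb'] at hr
    have hf0 : 0 ≤ f := tableCcdh_nonneg d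
    have h6 : A * (n / b) * f ≤ r * f := mul_le_mul_of_nonneg_right hr hf0
    have h7 : 2 * c * n ≤ A * n := mul_le_mul_of_nonneg_right hAc hn0.le
    have h8 : A * n * (f / b) < A * n * 1 := by
      have : A * n * (f / b) = A * (n / b) * f := by ring
      linarith
    have h9 := lt_of_mul_lt_mul_left h8 (by positivity)
    rwa [div_lt_one hb0] at h9
  linarith

/-- The fatness of a power law: `d N(d)` is of order at least `n ^ (1 / (γ - 1))`. -/
lemma fatness_le (hγ : 2 < γ) (hτ : 0 < τ) (hD : IsAccurate G δ D)
    (hδ1 : δ ≤ 1 / 2) (hG : PowerLawBelow G γ τ) (hd : 1 ≤ d) (hf : 0 < tableCcdh D d) :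
    min (1 / 2) (τ / 4) * (Fintype.card V : ℝ) ^ (1 / (γ - 1)) ≤ d * tableCcdh D d := by
  have hf1 : 1 ≤ tableCcdh D d := by
    rw [tableCcdh_eq_card] at hf ⊢
    exact_mod_cast hf
  have hpl := floor_le_tableCcdh hD hδ1 hG hd
  have hn1 : (1 : ℝ) ≤ Fintype.card V := by exact_mod_cast Fintype.card_pos
  set n := (Fintype.card V : ℝ)
  set f := tableCcdh D d
  have hn0 : 0 < n := by linarith
  have hd0 : (0 : ℝ) < d := by exact_mod_cast hd
  set ζ := n ^ (1 / (γ - 1)) with hζ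
  have hζ0 : 0 < ζ := by positivity
  have hζn : ζ * ζ ^ (γ - 2) = n := by
    have : ζ * ζ ^ (γ - 2) = ζ ^ (γ - 1) := by
      rw [show γ - 1 = 1 + (γ - 2) by ring, Real.rpow_add hζ0, Real.rpow_one]
    rw [this, hζ, ← Real.rpow_mul hn0.le, one_div_mul_cancel (by linarith), Real.rpow_one]
  rcases le_total ζ (2 * d) with h | h
  · calc min (1 / 2) (τ / 4) * ζ ≤ 1 / 2 * ζ :=
          mul_le_mul_of_nonneg_right (min_le_left _ _) hζ0.le
      _ ≤ d * 1 := by linarith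
      _ ≤ d * f := mul_le_mul_of_nonneg_left hf1 hd0.le
  · set w : ℝ := 2 * d with hw
    have hw0 : 0 < w := by positivity
    have hwγ : w ^ (γ - 1) ≤ w * ζ ^ (γ - 2) := by
      rw [show γ - 1 = 1 + (γ - 2) by ring, Real.rpow_add hw0, Real.rpow_one]
      exact mul_le_mul_of_nonneg_left (Real.rpow_le_rpow hw0.le h (by linarith)) hw0.le
    have hy : τ * ζ / w ≤ τ * n / w ^ (γ - 1) := by
      rw [div_le_div_iff₀ hw0 (by positivity), ← hζn]
      calc τ * ζ * w ^ (γ - 1) ≤ τ * ζ * (w * ζ ^ (γ - 2)) := by gcongr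
        _ = τ * (ζ * ζ ^ (γ - 2)) * w := by ring
    have h2f : τ * ζ / w ≤ 2 * f := by linarith
    rw [div_le_iff₀ hw0] at h2f
    calc min (1 / 2) (τ / 4) * ζ ≤ τ / 4 * ζ :=
          mul_le_mul_of_nonneg_right (min_le_right _ _) hζ0.le
      _ ≤ d * f := by rw [hw] at h2f; linarith

lemma edge_sample_size (hγ : 2 < γ) (hτ : 0 < τ) (hD : IsAccurate G δ D)
    (hδ1 : δ ≤ 1 / 2) (hG : PowerLawBelow G γ τ) (hd : 1 ≤ d) (hf : 0 < tableCcdh D d)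
    (hA : 9600 ≤ A * min (1 / 2) (τ / 4) * δ ^ 2)
    (hq : A * ((∑ v, (G.degree v : ℝ)) / (Fintype.card V : ℝ) ^ (1 / (γ - 1))) ≤ q) :
    9600 * ∑ v, (G.degree v : ℝ) ≤ q * d * tableCcdh D d * δ ^ 2 := by
  have h := fatness_le hγ hτ hD hδ1 hG hd hf
  have hn0 : (0 : ℝ) < Fintype.card V := by exact_mod_cast Fintype.card_pos
  set M := ∑ v, (G.degree v : ℝ) with hM
  have hM0 : 0 ≤ M := Finset.sum_nonneg fun _ _ => Nat.cast_nonneg _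
  set ζ := (Fintype.card V : ℝ) ^ (1 / (γ - 1))
  have hζ0 : 0 < ζ := by positivity
  have hκ : 0 < min (1 / 2) (τ / 4) := lt_min (by norm_num) (by positivity)
  set κ := min (1 / 2) (τ / 4)
  calc 9600 * M ≤ A * κ * δ ^ 2 * M := mul_le_mul_of_nonneg_right hA hM0
    _ = A * (M / ζ) * (κ * ζ) * δ ^ 2 := by field_simp
    _ ≤ q * (d * tableCcdh D d) * δ ^ 2 := by gcongr
    _ = q * d * tableCcdh D d * δ ^ 2 := by ring

end QueryAlg

/-! ### The degree sum of a vertex sample -/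

/-- The number of neighbors of `v` of degree at least that of `v`. -/
noncomputable def upDegree {V : Type u} [Fintype V] (G : SimpleGraph V) [DecidableRel G.Adj]
    (v : V) : ℕ := ((G.neighborFinset v).filter fun u => G.degree v ≤ G.degree u).card

section UpDegree

variable {V : Type u} [Fintype V] (G : SimpleGraph V) [DecidableRel G.Adj]

lemma upDegree_le_degree (v : V) : upDegree G v ≤ G.degree v := by
  rw [← G.card_neighborFinset_eq_degree]
  exact Finset.card_filter_le _ _

/-- Each of the `upDegree v` counted neighbors has degree at least `upDegree v`. -/
lemma upDegree_sq_le (v : V) : upDegree G v ^ 2 ≤ ∑ u, G.degree u := by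
  calc upDegree G v ^ 2 = ∑ _u ∈ (G.neighborFinset v).filter fun u => G.degree v ≤ G.degree u,
        upDegree G v := by rw [Finset.sum_const, smul_eq_mul, sq]; rfl
    _ ≤ ∑ u ∈ (G.neighborFinset v).filter fun u => G.degree v ≤ G.degree u, G.degree u :=
        Finset.sum_le_sum fun u hu =>
          (upDegree_le_degree G v).trans (Finset.mem_filter.1 hu).2
    _ ≤ ∑ u, G.degree u :=
        Finset.sum_le_sum_of_subset_of_nonneg (Finset.subset_univ _) fun _ _ _ => Nat.zero_le _

/-- Every edge is counted from at least one of its ends. -/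
lemma sum_degree_le_two_mul_sum_upDegree : ∑ v, G.degree v ≤ 2 * ∑ v, upDegree G v := by
  have h1 : ∀ v, G.degree v ≤ upDegree G v +
      ((G.neighborFinset v).filter fun u => G.degree u ≤ G.degree v).card := by
    intro v
    classical
    rw [upDegree, ← G.card_neighborFinset_eq_degree]
    refine le_trans (Finset.card_le_card fun u hu => ?_) (Finset.card_union_le _ _)
    rw [Finset.mem_union, Finset.mem_filter, Finset.mem_filter]
    exact (le_total _ _).imp (fun h => ⟨hu, h⟩) fun h => ⟨hu, h⟩
  have h2 : ∑ v, ((G.neighborFinset v).filter fun u => G.degree u ≤ G.degree v).card =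
      ∑ v, upDegree G v := by
    have e1 : ∀ v, ((G.neighborFinset v).filter fun u => G.degree u ≤ G.degree v).card =
        ∑ u, if G.Adj v u ∧ G.degree u ≤ G.degree v then 1 else 0 := by
      intro v
      rw [← Finset.sum_filter, Finset.sum_const, smul_eq_mul, mul_one]
      congr 1; ext u; simp
    have e2 : ∀ v, upDegree G v = ∑ u, if G.Adj v u ∧ G.degree v ≤ G.degree u then 1 else 0 := by
      intro v
      rw [← Finset.sum_filter, Finset.sum_const, smul_eq_mul, mul_one, upDegree]
      congr 1; ext u; simp
    simp only [e1, e2]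
    rw [Finset.sum_comm]
    simp only [G.adj_comm]
  calc ∑ v, G.degree v ≤ ∑ v, (upDegree G v +
        ((G.neighborFinset v).filter fun u => G.degree u ≤ G.degree v).card) :=
        Finset.sum_le_sum fun v _ => h1 v
    _ = 2 * ∑ v, upDegree G v := by rw [Finset.sum_add_distrib, h2, two_mul]

end UpDegree

namespace QueryAlg

variable {V : Type u} [Fintype V] [Nonempty V]
variable {G : SimpleGraph V} [DecidableRel G.Adj] {D : V → ℝ≥0} {δ c : ℝ} {d r q ℓ : ℕ}

/-- The degree sum of `r` random vertices is unlikely to be much smaller than its mean. A few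
vertices may carry most of the degree sum, which rules out concentration of the sum itself; but the
smaller sum of the up-degrees, which are at most `√M`, has a mean of the same order. -/
lemma ev_degreeSum_lower_tail (hM : 0 < ∑ v, (G.degree v : ℝ)) (r : ℕ) :
    (((vertexSample V).iterate r).ev G D fun R =>
      if (R.map fun p => (G.degree p.1 : ℝ)).sum ≤
        r * (∑ v, (G.degree v : ℝ)) / (8 * Fintype.card V) then 1 else 0) ≤
      Real.exp (-(r * √(∑ v, (G.degree v : ℝ)) / (16 * Fintype.card V))) := by
  set M := ∑ v, (G.degree v : ℝ) with hMdef
  have hn0 : (0 : ℝ) < Fintype.card V := by exact_mod_cast Fintype.card_pos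
  set n := (Fintype.card V : ℝ) with hn
  set B := √M with hB
  have hB0 : 0 < B := Real.sqrt_pos.2 hM
  have hBB : B * B = M := Real.mul_self_sqrt hM.le
  have hw : ∀ v, (upDegree G v : ℝ) ≤ B := by
    intro v
    refine Real.le_sqrt_of_sq_le ?_
    rw [hMdef]
    exact_mod_cast upDegree_sq_le G v
  have hsum : M ≤ 2 * ∑ v, (upDegree G v : ℝ) := by
    rw [hMdef]
    exact_mod_cast sum_degree_le_two_mul_sum_upDegree G
  have h1 : (((vertexSample V).iterate r).ev G D fun R =>
      if (R.map fun p => (G.degree p.1 : ℝ)).sum ≤ r * M / (8 * n) then (1 : ℝ) else 0) ≤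
      ((vertexSample V).iterate r).ev G D fun R => Real.exp (r * M / (8 * n) / (2 * B)) *
        (R.map fun p => Real.exp (-(upDegree G p.1 / (2 * B)))).prod := by
    refine ev_mono _ fun R => ?_
    have e : ∀ R : List (V × ℝ≥0), (R.map fun p => Real.exp (-(upDegree G p.1 / (2 * B)))).prod =
        Real.exp (-((R.map fun p => (upDegree G p.1 : ℝ)).sum / (2 * B))) := by
      intro R
      induction R with
      | nil => simp
      | cons p R ih =>
        rw [List.map_cons, List.prod_cons, ih, ← Real.exp_add, List.map_cons, List.sum_cons]
        congr 1; ring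
    rw [e, ← Real.exp_add]
    split_ifs with h
    · rw [Real.one_le_exp_iff]
      have h2 : (R.map fun p => (upDegree G p.1 : ℝ)).sum ≤
          (R.map fun p => (G.degree p.1 : ℝ)).sum :=
        List.sum_le_sum fun p _ => by exact_mod_cast upDegree_le_degree G p.1
      have h3 := div_le_div_of_nonneg_right (h2.trans h) (by positivity : 0 ≤ 2 * B)
      linarith
    · positivity
  refine h1.trans ?_
  rw [ev_mul_left, ev_iterate_prod, ev_vertexSample]
  have h2 : (∑ v, Real.exp (-(upDegree G v / (2 * B)))) / n ≤ Real.exp (-(M / (8 * n * B))) := by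
    have h3 : ∀ v, Real.exp (-(upDegree G v / (2 * B))) ≤ 1 - upDegree G v / (4 * B) := by
      intro v
      have hx0 : 0 ≤ (upDegree G v : ℝ) / (2 * B) := by positivity
      have hx1 : (upDegree G v : ℝ) / (2 * B) ≤ 1 / 2 := by
        rw [div_le_div_iff₀ (by positivity) (by norm_num)]
        linarith [hw v]
      have h4 := Real.exp_sub_one_le_add_sq (a := -(upDegree G v / (2 * B)))
        (by rw [abs_neg, abs_of_nonneg hx0]; linarith)
      have e : (upDegree G v : ℝ) / (4 * B) = 1 / 2 * (upDegree G v / (2 * B)) := by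
        field_simp; norm_num
      rw [e]
      nlinarith
    have h5 := Finset.sum_le_sum fun v (_ : v ∈ Finset.univ) => h3 v
    rw [Finset.sum_sub_distrib, ← Finset.sum_div] at h5
    simp only [Finset.sum_const, Finset.card_univ, nsmul_eq_mul, mul_one] at h5
    rw [← hn] at h5
    refine le_trans ?_ (Real.add_one_le_exp _)
    rw [div_le_iff₀ hn0]
    have h6 : M / (8 * B) ≤ (∑ v, (upDegree G v : ℝ)) / (4 * B) := by
      rw [div_le_div_iff₀ (by positivity) (by positivity)]
      nlinarith
    have e : (-(M / (8 * n * B)) + 1) * n = n - M / (8 * B) := by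
      field_simp; ring
    rw [e]
    linarith
  calc _ ≤ Real.exp (r * M / (8 * n) / (2 * B)) * Real.exp (-(M / (8 * n * B))) ^ r := by
        refine mul_le_mul_of_nonneg_left (pow_le_pow_left₀ ?_ h2 r) (Real.exp_pos _).le
        exact div_nonneg (Finset.sum_nonneg fun _ _ => (Real.exp_pos _).le) hn0.le
    _ = Real.exp (-(r * B / (16 * n))) := by
        rw [← Real.exp_nat_mul, ← Real.exp_add]
        congr 1
        rw [← hBB]
        field_simp
        ring

/-! ### The probability that a degree is queried -/

lemma queryProb_vertexSample (v : V) :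
    (vertexSample V).queryProb G D v = 1 / Fintype.card V := by
  classical
  simp only [vertexSample, queryProb, PMF.mean_uniformOfFintype]
  congr 1
  rw [Finset.sum_eq_single v]
  · simp
  · intro u _ hu; simp [hu]
  · simp

open Classical in
lemma queryProb_edgeSample_le (hD : IsAccurate G δ D) (hδ : δ ≤ 1 / 3)
    {R : List (V × ℝ≥0)} (hR : ∀ p ∈ R, p.2 = D p.1) (v : V) {b : ℝ} (hb : 0 < b) :
    (edgeSample R).queryProb G D v ≤
      (if (R.map fun p => (G.degree p.1 : ℝ)).sum ≤ b then 1 else 0) +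
        2 / b * (R.map fun p => if G.Adj p.1 v then (1 : ℝ) else 0).sum := by
  have hcnt : 0 ≤ (R.map fun p => if G.Adj p.1 v then (1 : ℝ) else 0).sum :=
    List.sum_nonneg fun x hx => by
      obtain ⟨p, _, rfl⟩ := List.mem_map.1 hx
      split_ifs <;> norm_num
  split_ifs with hsmall
  · exact (queryProb_le_one v _).trans (le_add_of_nonneg_right (by positivity))
  push Not at hsmall
  rw [zero_add]
  by_cases h0 : (R.map fun p => (p.2 : ℝ)).sum = 0
  · rw [edgeSample, dif_neg (fun h => sum_ne_zero_of_tsum_ne_zero.1 h h0), queryProb]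
    positivity
  rw [edgeSample, dif_pos (sum_ne_zero_of_tsum_ne_zero.2 h0)]
  simp only [queryProb]
  rw [degreeWeighted_mean]
  have hS : 2 / 3 * b ≤ (R.map fun p => (p.2 : ℝ)).sum := by
    have h1 : (R.map fun p => 2 / 3 * (G.degree p.1 : ℝ)).sum ≤ (R.map fun p => (p.2 : ℝ)).sum := by
      refine List.sum_le_sum fun p hp => ?_
      rw [hR p hp]
      refine le_trans ?_ (hD p.1).1
      exact mul_le_mul_of_nonneg_right (by linarith) (Nat.cast_nonneg _)
    rw [List.sum_map_mul_left] at h1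
    linarith
  have hnum : (R.map fun p => (p.2 : ℝ) * (neighborAnswer G p.1).mean fun o =>
      QueryAlg.queryProb G D v (match o with
        | some u => degree u fun y => ret y
        | none => (ret 0 : QueryAlg V ℝ≥0))).sum ≤
      (R.map fun p => 4 / 3 * (if G.Adj p.1 v then (1 : ℝ) else 0)).sum := by
    refine List.sum_le_sum fun p hp => ?_
    rw [hR p hp]
    by_cases hp0 : G.degree p.1 = 0
    · rw [(hD.eq_zero_iff (by linarith) _).2 hp0, NNReal.coe_zero, zero_mul]
      split_ifs <;> norm_num
    · rw [neighborAnswer_mean G hp0]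
      simp only [queryProb]
      have hd0 : (0 : ℝ) < G.degree p.1 := by positivity
      have e : (∑ u ∈ G.neighborFinset p.1, if u = v then (1 : ℝ) else 0) =
          if G.Adj p.1 v then (1 : ℝ) else 0 := by
        rw [Finset.sum_ite_eq']
        simp
      rw [e, ← mul_div_assoc, div_le_iff₀ hd0]
      have h1 := (hD p.1).2
      have h2 : (D p.1 : ℝ) ≤ 4 / 3 * G.degree p.1 :=
        h1.trans (mul_le_mul_of_nonneg_right (by linarith) hd0.le)
      split_ifs <;> linarith
  rw [List.sum_map_mul_left] at hnum
  rw [div_le_iff₀ (lt_of_lt_of_le (by positivity) hS)]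
  refine hnum.trans ?_
  have h3 : 2 / b * (R.map fun p => if G.Adj p.1 v then (1 : ℝ) else 0).sum * (2 / 3 * b) ≤
      2 / b * (R.map fun p => if G.Adj p.1 v then (1 : ℝ) else 0).sum *
        (R.map fun p => (p.2 : ℝ)).sum := mul_le_mul_of_nonneg_left hS (by positivity)
  have e : 2 / b * (R.map fun p => if G.Adj p.1 v then (1 : ℝ) else 0).sum * (2 / 3 * b) =
      4 / 3 * (R.map fun p => if G.Adj p.1 v then (1 : ℝ) else 0).sum := by
    field_simp; ring
  linarith

/-- The probability that SADDLES queries the degree of `v`: the vertex samples hit all vertices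
equally, the edge samples in proportion to their degrees. -/
lemma queryProb_saddlesSM_le (hD : IsAccurate G δ D) (hδ : δ ≤ 1 / 3)
    (hM : 0 < ∑ v, (G.degree v : ℝ)) (hr : 0 < r) (v : V) :
    (saddlesSM V r q ℓ c).queryProb G D v ≤ ℓ * (r / Fintype.card V +
      q * (Real.exp (-(r * √(∑ v, (G.degree v : ℝ)) / (16 * Fintype.card V))) +
        16 * (G.degree v / ∑ v, (G.degree v : ℝ)))) := by
  classical
  set M := ∑ v, (G.degree v : ℝ) with hMdef
  have htail := ev_degreeSum_lower_tail (D := D) hM r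
  rw [← hMdef] at htail
  have hn0 : (0 : ℝ) < Fintype.card V := by exact_mod_cast Fintype.card_pos
  have hr0 : (0 : ℝ) < r := by exact_mod_cast hr
  set η := Real.exp (-(r * √M / (16 * Fintype.card V)))
  have hb : 0 < r * M / (8 * Fintype.card V) := by positivity
  have hcount : (((vertexSample V).iterate r).ev G D fun R =>
      (R.map fun p => if G.Adj p.1 v then (1 : ℝ) else 0).sum) =
      r * (G.degree v / Fintype.card V) := by
    rw [ev_iterate_sum, ev_vertexSample]
    congr 2
    rw [Finset.sum_boole, ← G.card_neighborFinset_eq_degree]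
    congr 2
    ext u; simp [G.adj_comm]
  have hround : (saddlesRound V r q c).queryProb G D v ≤ r / Fintype.card V +
      q * (η + 16 * (G.degree v / M)) := by
    refine (queryProb_bind_le v _ _).trans (add_le_add ?_ ?_)
    · refine (queryProb_iterate_le v _ r).trans (le_of_eq ?_)
      rw [queryProb_vertexSample, mul_one_div]
    · have h1 : (((vertexSample V).iterate r).ev G D fun R =>
          (((edgeSample R).iterate q).bind fun Y =>
            (ret fun d => roundEstimate (Fintype.card V) r q c R Y d :
              QueryAlg V (ℕ → ℝ))).queryProb G D v) ≤
          ((vertexSample V).iterate r).ev G D fun R =>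
            q * ((if (R.map fun p => (G.degree p.1 : ℝ)).sum ≤
              r * M / (8 * Fintype.card V) then (1 : ℝ) else 0) +
              2 / (r * M / (8 * Fintype.card V)) *
                (R.map fun p => if G.Adj p.1 v then (1 : ℝ) else 0).sum) := by
        refine ev_mono_of_reach _ ((reach_iterate _ reach_vertexSample r).mono ?_)
        rintro R ⟨-, hR⟩
        refine (queryProb_bind_le v _ _).trans ?_
        simp only [queryProb, ev_const, add_zero]
        refine (queryProb_iterate_le v _ q).trans ?_
        exact mul_le_mul_of_nonneg_left (queryProb_edgeSample_le hD hδ hR v hb)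
          (Nat.cast_nonneg q)
      refine h1.trans ?_
      rw [ev_mul_left, ev_add, ev_mul_left, hcount]
      refine mul_le_mul_of_nonneg_left (add_le_add htail (le_of_eq ?_)) (Nat.cast_nonneg q)
      field_simp
      ring
  rw [saddlesSM]
  refine (queryProb_bind_le v _ _).trans ?_
  simp only [queryProb, ev_const, add_zero]
  exact (queryProb_iterate_le v _ ℓ).trans (mul_le_mul_of_nonneg_left hround (Nat.cast_nonneg ℓ))

/-- The total expected cost of the calls of a subroutine with cost `1 + a √d`. A vertex is queried
at most once, so that `min 1 x ≤ √x` applies to the probability that an edge sample hits it. -/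
lemma sum_cost_mul_le {p w : V → ℝ} {a x y : ℝ} (ha : 0 ≤ a) (hx : 0 ≤ x) (hy : 0 ≤ y)
    (hw0 : ∀ v, 0 ≤ w v) (hw : ∀ v, w v ≤ 1 + a * √(G.degree v))
    (hp1 : ∀ v, p v ≤ 1) (hp : ∀ v, p v ≤ x + y * G.degree v)
    (hM : (Fintype.card V : ℝ) ≤ ∑ v, (G.degree v : ℝ)) :
    ∑ v, w v * p v ≤ (1 + a) * (∑ v, (G.degree v : ℝ)) * (x + √y) := by
  have hterm : ∀ v, w v * p v ≤ x * (1 + a * G.degree v) + √y * ((1 + a) * G.degree v) := by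
    intro v
    have hd0 : (0 : ℝ) ≤ G.degree v := Nat.cast_nonneg _
    have hs0 := Real.sqrt_nonneg (G.degree v : ℝ)
    have hss : √(G.degree v : ℝ) * √(G.degree v) = G.degree v := Real.mul_self_sqrt hd0
    have hsd : √(G.degree v : ℝ) ≤ G.degree v := by
      rcases Nat.eq_zero_or_pos (G.degree v) with h | h
      · simp [h]
      · have : (1 : ℝ) ≤ √(G.degree v : ℝ) := Real.one_le_sqrt.2 (by exact_mod_cast h)
        nlinarith
    have hpv : p v ≤ x + √y * √(G.degree v) := by
      rw [← Real.sqrt_mul hy]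
      rcases le_total (y * G.degree v) 1 with h | h
      · refine (hp v).trans (add_le_add le_rfl ?_)
        refine Real.le_sqrt_of_sq_le ?_
        nlinarith [mul_nonneg hy hd0]
      · exact (hp1 v).trans (by linarith [Real.one_le_sqrt.2 h])
    have hy0 := Real.sqrt_nonneg y
    have h1 : w v * p v ≤ (1 + a * √(G.degree v)) * (x + √y * √(G.degree v)) :=
      (mul_le_mul_of_nonneg_left hpv (hw0 v)).trans
        (mul_le_mul_of_nonneg_right (hw v) (by positivity))
    have h2 : (1 + a * √(G.degree v)) * (x + √y * √(G.degree v)) =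
        x * (1 + a * √(G.degree v)) + √y * (√(G.degree v) + a * G.degree v) := by
      rw [← hss, Real.sqrt_mul_self hs0]; ring
    rw [h2] at h1
    refine h1.trans (add_le_add (mul_le_mul_of_nonneg_left ?_ hx)
      (mul_le_mul_of_nonneg_left ?_ hy0))
    · linarith [mul_le_mul_of_nonneg_left hsd ha]
    · linarith
  refine (Finset.sum_le_sum fun v _ => hterm v).trans ?_
  rw [Finset.sum_add_distrib, ← Finset.mul_sum, ← Finset.mul_sum, Finset.sum_add_distrib,
    ← Finset.mul_sum, ← Finset.mul_sum]
  simp only [Finset.sum_const, Finset.card_univ, nsmul_eq_mul, mul_one]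
  have := mul_le_mul_of_nonneg_left hM hx
  nlinarith

end QueryAlg

/-! ### SADDLES with estimated degrees -/

namespace QueryAlg

variable {V : Type u} {α : Type v} [Fintype V] [Nonempty V]
variable {G : SimpleGraph V} [DecidableRel G.Adj] {D : V → ℝ≥0} {δ c φ : ℝ} {d r q ℓ b : ℕ}
variable {deg : V → QueryAlg V ℝ≥0}

open Classical in
/-- The indicator that the stored value of `v` is not accurate. -/
noncomputable def inaccurate (G : SimpleGraph V) [DecidableRel G.Adj] (δ : ℝ) (v : V)
    (x : ℝ≥0) : ℝ :=
  if (1 - δ) * (G.degree v : ℝ) ≤ x ∧ (x : ℝ) ≤ (1 + δ) * G.degree v then 0 else 1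

lemma inaccurate_nonneg (v : V) (x : ℝ≥0) : 0 ≤ inaccurate G δ v x := by
  rw [inaccurate]; split_ifs <;> norm_num

lemma isAccurate_or_one_le (D : V → ℝ≥0) :
    IsAccurate G δ D ∨ 1 ≤ ∑ v, inaccurate G δ v (D v) := by
  by_cases h : IsAccurate G δ D
  · exact Or.inl h
  · right
    rw [IsAccurate, not_forall] at h
    obtain ⟨v, hv⟩ := h
    refine le_trans ?_ (Finset.single_le_sum (fun u _ => inaccurate_nonneg u (D u))
      (Finset.mem_univ v))
    rw [inaccurate, if_neg hv]

lemma drawTable_inaccurate_le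
    (hdeg : ∀ v, (deg v).ev G D (inaccurate G δ v) ≤ φ) :
    (drawTable G D deg Finset.univ.toList (fun _ => none) fun c' =>
      ∑ v, inaccurate G δ v (storedTable c' v)) ≤ Fintype.card V * φ := by
  rw [drawTable_sum]
  refine (Finset.sum_le_sum fun v _ => (?_ : _ ≤ φ)).trans (le_of_eq (by simp))
  refine (drawTable_apply Finset.univ.toList (fun _ => none)
    (fun o => inaccurate G δ v (o.getD 0)) (Finset.mem_toList.2 (Finset.mem_univ v)) rfl).trans_le ?_
  exact hdeg v

/-- The failure probability with a subroutine for the degrees: either some value in the table is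
not accurate, or the algorithm fails with an accurate table. -/
lemma ev_simulateDegrees_le (hdeg : ∀ v, (deg v).ev G D (inaccurate G δ v) ≤ φ)
    (A : QueryAlg V α) {f : α → ℝ} {p : ℝ} (hp : 0 ≤ p) (hf : ∀ a, f a ≤ 1)
    (hA : ∀ D', IsAccurate G δ D' → A.ev G D' f ≤ p) :
    (A.simulateDegrees deg fun _ => none).ev G D f ≤ p + Fintype.card V * φ := by
  rw [ev_simulateDegrees (l := Finset.univ.toList)
    (fun v => Finset.mem_toList.2 (Finset.mem_univ v))]
  refine le_trans (drawTable_mono _ _ (F' := fun c' =>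
    p + ∑ v, inaccurate G δ v (storedTable c' v)) fun c' _ => ?_) ?_
  · have h0 : 0 ≤ ∑ v, inaccurate G δ v (storedTable c' v) :=
      Finset.sum_nonneg fun v _ => inaccurate_nonneg v _
    rcases isAccurate_or_one_le (G := G) (δ := δ) (storedTable c') with h | h
    · exact (hA _ h).trans (le_add_of_nonneg_right h0)
    · exact (ev_le_of_reach _ (reach_of_forall _ hf)).trans (by linarith)
  · rw [drawTable_add, drawTable_const]
    exact add_le_add le_rfl (drawTable_inaccurate_le hdeg)

/-- The expected cost with a subroutine for the degrees. With a table that is not accurate, each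
vertex still costs at most one call. -/
lemma meanQueries_simulateDegrees_le' (hdeg : ∀ v, (deg v).ev G D (inaccurate G δ v) ≤ φ)
    {A : QueryAlg V α} (hA : A.QueriesLE b) {a x y : ℝ} (ha : 0 ≤ a) (hx : 0 ≤ x) (hy : 0 ≤ y)
    (hcost : ∀ v, (deg v).meanQueries G D ≤ 1 + a * √(G.degree v))
    (hprob : ∀ D', IsAccurate G δ D' → ∀ v, A.queryProb G D' v ≤ x + y * G.degree v)
    (hM : (Fintype.card V : ℝ) ≤ ∑ v, (G.degree v : ℝ)) :
    (A.simulateDegrees deg fun _ => none).meanQueries G D ≤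
      b + (1 + a) * (∑ v, (G.degree v : ℝ)) * (x + √y + Fintype.card V * φ) := by
  classical
  set M := ∑ v, (G.degree v : ℝ)
  have hM0 : 0 ≤ M := (Nat.cast_nonneg _).trans hM
  have h0 : ∀ v, 0 ≤ (deg v).meanQueries G D := fun v => meanQueries_nonneg _
  refine (meanQueries_simulateDegrees_le (l := Finset.univ.toList)
    (fun v => Finset.mem_toList.2 (Finset.mem_univ v)) A _ hA).trans (add_le_add le_rfl ?_)
  refine le_trans (drawTable_mono _ _ (F' := fun c' => (1 + a) * M * (x + √y) +
    (1 + a) * M * ∑ v, inaccurate G δ v (storedTable c' v)) fun c' _ => ?_) ?_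
  · have e : (Finset.univ.filter fun _ : V => (none : Option ℝ≥0) = none) = Finset.univ :=
      Finset.filter_true_of_mem fun _ _ => rfl
    rw [e]
    have h1 : 0 ≤ ∑ v, inaccurate G δ v (storedTable c' v) :=
      Finset.sum_nonneg fun v _ => inaccurate_nonneg v _
    rcases isAccurate_or_one_le (G := G) (δ := δ) (storedTable c') with h | h
    · refine (sum_cost_mul_le ha hx hy h0 hcost (fun v => queryProb_le_one v _) (hprob _ h)
        hM).trans (le_add_of_nonneg_right (by positivity))
    · have h2 := sum_cost_mul_le (p := fun v => A.queryProb G (storedTable c') v) ha zero_le_one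
        le_rfl h0 hcost (fun v => queryProb_le_one v _)
        (fun v => by rw [zero_mul, add_zero]; exact queryProb_le_one v _) hM
      rw [Real.sqrt_zero, add_zero, mul_one] at h2
      refine h2.trans (le_trans ?_ (le_add_of_nonneg_left (by positivity)))
      exact le_mul_of_one_le_right (by positivity) h
  · rw [drawTable_add, drawTable_const, drawTable_mul_left, mul_add _ (x + √y)]
    exact add_le_add le_rfl (mul_le_mul_of_nonneg_left (drawTable_inaccurate_le hdeg)
      (by positivity))

open Classical in
lemma ev_ite_eq_one_sub (A : QueryAlg V α) (P : α → Prop) :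
    (A.ev G D fun a => if P a then 1 else 0) = 1 - A.ev G D fun a => if P a then 0 else 1 := by
  rw [eq_sub_iff_add_eq, ← ev_add]
  refine Eq.trans (congrArg _ (funext fun a => ?_)) (A.ev_const 1)
  split_ifs <;> norm_num

open Classical in
lemma one_sub_ofReal_le_prob (A : QueryAlg V α) (P : α → Prop) {p : ℝ}
    (h : (A.ev G (degreeTable G) fun a => if P a then 0 else 1) ≤ p) :
    1 - ENNReal.ofReal p ≤ A.prob G P := by
  have hp : 0 ≤ p := le_trans (ev_nonneg _ fun a => by split_ifs <;> norm_num) h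
  rw [prob_eq_ofReal_ev, ev_ite_eq_one_sub, ← ENNReal.ofReal_one, ← ENNReal.ofReal_sub _ hp]
  exact ENNReal.ofReal_le_ofReal (by linarith)

/-! ### The choice of the parameters -/

lemma isAccurate_degreeTable (hδ : 0 ≤ δ) : IsAccurate G δ (degreeTable G) := by
  intro v
  have : (0 : ℝ) ≤ G.degree v := Nat.cast_nonneg _
  simp only [degreeTable, NNReal.coe_natCast]
  constructor <;> nlinarith

open Classical in
/-- The collision estimator is a degree estimator, with a failure probability as small as
desired. -/
lemma isDegreeEstimator_collisionDegree {ε : ℝ} (hδε : δ ≤ ε / 10) {H T : ℕ}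
    (hfail : ∀ (G : SimpleGraph V) [DecidableRel G.Adj] (v : V),
      (collisionDegree H T v).ev G (degreeTable G) (inaccurate G δ v) ≤ φ)
    (hφ : φ < ((Fintype.card V : ℝ) ^ 3)⁻¹) (hφ1 : φ < 1) :
    IsDegreeEstimator V (ε / 10) (collisionDegree H T) := by
  refine ⟨fun v => onlyNeighborsOf_collisionDegree v H T, fun G _ v => ?_⟩
  have hn0 : (0 : ℝ) < Fintype.card V := by exact_mod_cast Fintype.card_pos
  have e : 1 - ((Fintype.card V : ℝ≥0∞) ^ 3)⁻¹ =
      ENNReal.ofReal (1 - ((Fintype.card V : ℝ) ^ 3)⁻¹) := by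
    rw [ENNReal.ofReal_sub _ (by positivity), ENNReal.ofReal_one,
      ENNReal.ofReal_inv_of_pos (by positivity), ENNReal.ofReal_pow hn0.le,
      ENNReal.ofReal_natCast]
  obtain ⟨P, hP⟩ : ∃ P : ℝ≥0 → Prop, P = fun x : ℝ≥0 =>
    (1 - ε / 10) * (G.degree v : ℝ) ≤ x ∧ (x : ℝ) ≤ (1 + ε / 10) * G.degree v := ⟨_, rfl⟩
  have h1 : ((collisionDegree H T v).ev G (degreeTable G) fun x => if P x then (0 : ℝ) else 1) ≤
      φ := by
    refine le_trans (ev_mono _ fun x => ?_) (hfail G v)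
    have hd0 : (0 : ℝ) ≤ G.degree v := Nat.cast_nonneg _
    rw [inaccurate]
    by_cases h : (1 - δ) * (G.degree v : ℝ) ≤ x ∧ (x : ℝ) ≤ (1 + δ) * G.degree v
    · rw [if_pos h, if_pos]
      rw [hP]
      constructor
      · exact le_trans (mul_le_mul_of_nonneg_right (by linarith) hd0) h.1
      · exact h.2.trans (mul_le_mul_of_nonneg_right (by linarith) hd0)
    · rw [if_neg h]
      split_ifs <;> norm_num
  rw [← hP, e, prob_eq_ofReal_ev, ev_ite_eq_one_sub]
  refine (ENNReal.ofReal_lt_ofReal_iff ?_).2 ?_ <;> linarith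

end QueryAlg

lemma degree_failure_le {n K t : ℝ} (hn : 1 ≤ n) (hK : 0 < K) (ht : (K + 8) * (1 + Real.log n) ≤ t) :
    3 * (n + 1) * Real.exp (-t) ≤ 1 / 4 * n ^ (-(K + 4)) := by
  have hn0 : 0 < n := by linarith
  have hl : 0 ≤ Real.log n := Real.log_nonneg hn
  rw [Real.rpow_def_of_pos hn0]
  have h1 : Real.exp (-t) ≤ Real.exp (-8) * Real.exp (-Real.log n) *
      Real.exp (Real.log n * -(K + 4)) := by
    rw [← Real.exp_add, ← Real.exp_add, Real.exp_le_exp]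
    nlinarith
  have h2 : Real.exp (-8) ≤ 1 / 24 := by
    rw [Real.exp_neg, inv_le_comm₀ (Real.exp_pos _) (by norm_num)]
    have h3 := Real.add_one_le_exp (4 : ℝ)
    have h4 : Real.exp 8 = Real.exp 4 * Real.exp 4 := by rw [← Real.exp_add]; norm_num
    rw [h4]
    nlinarith
  have h3 : 3 * (n + 1) * Real.exp (-Real.log n) ≤ 6 := by
    rw [Real.exp_neg, Real.exp_log hn0, ← div_eq_mul_inv, div_le_iff₀ hn0]
    linarith
  set x := Real.exp (Real.log n * -(K + 4))
  have hx : 0 < x := Real.exp_pos _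
  have h5 : 0 ≤ 3 * (n + 1) * Real.exp (-Real.log n) := by positivity
  calc 3 * (n + 1) * Real.exp (-t)
      ≤ 3 * (n + 1) * (Real.exp (-8) * Real.exp (-Real.log n) * x) := by gcongr
    _ = 3 * (n + 1) * Real.exp (-Real.log n) * Real.exp (-8) * x := by ring
    _ ≤ 6 * (1 / 24) * x := by gcongr
    _ = 1 / 4 * x := by ring

lemma median_failure_le {n K : ℝ} {ℓ : ℕ} (hn : 1 ≤ n) (hK : 0 < K)
    (hℓ : 4 * (K + 4) * (1 + Real.log n) ≤ ℓ) :
    2 * n * (11 / 16) ^ ℓ ≤ 1 / 4 * n ^ (-K) := by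
  have hn0 : 0 < n := by linarith
  have hl : 0 ≤ Real.log n := Real.log_nonneg hn
  rw [Real.rpow_def_of_pos hn0]
  have h0 : (11 / 16 : ℝ) ≤ Real.exp (-(5 / 16)) := by
    have := Real.add_one_le_exp (-(5 / 16) : ℝ)
    linarith
  have h1 : (11 / 16 : ℝ) ^ ℓ ≤ Real.exp (-4) * Real.exp (-Real.log n) *
      Real.exp (Real.log n * -K) := by
    refine (pow_le_pow_left₀ (by norm_num) h0 ℓ).trans ?_
    rw [← Real.exp_nat_mul, ← Real.exp_add, ← Real.exp_add, Real.exp_le_exp]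
    nlinarith
  have h2 : Real.exp (-4) ≤ 1 / 8 := by
    rw [Real.exp_neg, inv_le_comm₀ (Real.exp_pos _) (by norm_num)]
    have h3 := Real.add_one_le_exp (2 : ℝ)
    have h4 : Real.exp 4 = Real.exp 2 * Real.exp 2 := by rw [← Real.exp_add]; norm_num
    rw [h4]
    nlinarith
  have h3 : 2 * n * Real.exp (-Real.log n) = 2 := by
    rw [Real.exp_neg, Real.exp_log hn0]
    field_simp
  set x := Real.exp (Real.log n * -K)
  have hx : 0 < x := Real.exp_pos _
  calc 2 * n * (11 / 16) ^ ℓ ≤ 2 * n * (Real.exp (-4) * Real.exp (-Real.log n) * x) := by gcongr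
    _ = 2 * n * Real.exp (-Real.log n) * Real.exp (-4) * x := by ring
    _ ≤ 2 * (1 / 8) * x := by rw [h3]; gcongr
    _ = 1 / 4 * x := by ring

/-- The number of vertex samples makes the failure term of the degree sum negligible: `N` is at least
`√n`, and the degree sum `M` at least `n`. -/
lemma lower_tail_le {n M A N r : ℝ} (hn : 1 ≤ n) (hM : n ≤ M) (hA : 32 * (1 + Real.log n) ≤ A)
    (hN : √n ≤ N) (hr : A * N ≤ r) : Real.exp (-(r * √M / (16 * n))) ≤ 1 / n ^ 2 := by
  have hn0 : 0 < n := by linarith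
  have hl : 0 ≤ Real.log n := Real.log_nonneg hn
  have e : 1 / n ^ 2 = Real.exp (-(2 * Real.log n)) := by
    rw [Real.exp_neg, two_mul, Real.exp_add, Real.exp_log hn0]
    field_simp
  rw [e, Real.exp_le_exp, neg_le_neg_iff, le_div_iff₀ (by positivity)]
  have hA0 : 0 ≤ A := by linarith
  have h1 : n ≤ N * √M := by
    calc n = √n * √n := (Real.mul_self_sqrt hn0.le).symm
      _ ≤ N * √M := mul_le_mul hN (Real.sqrt_le_sqrt hM) (Real.sqrt_nonneg _)
          ((Real.sqrt_nonneg _).trans hN)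
  calc 2 * Real.log n * (16 * n) ≤ A * n := by nlinarith
    _ ≤ A * (N * √M) := mul_le_mul_of_nonneg_left h1 hA0
    _ = A * N * √M := by ring
    _ ≤ r * √M := mul_le_mul_of_nonneg_right hr (Real.sqrt_nonneg _)

/-- The cost of the degree estimates at the ends of edge samples. -/
lemma mul_sqrt_div_le {M s A' ℓ q : ℝ} (hM : 0 < M) (hs : 0 < s) (hA' : 1 ≤ A') (hℓ : 1 ≤ ℓ)
    (hq : q ≤ 2 * A' * (M / (s * s))) : M * √(ℓ * q * 16 / M) ≤ 32 * ℓ * A' * (M / s) := by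
  have hw : 1 ≤ ℓ * A' := one_le_mul_of_one_le_of_one_le hℓ hA'
  have h2 : q * (s * s) ≤ 2 * A' * M := by
    have := mul_le_mul_of_nonneg_right hq (mul_nonneg hs.le hs.le)
    have e : 2 * A' * (M / (s * s)) * (s * s) = 2 * A' * M := by field_simp
    linarith
  have h1 : √(ℓ * q * 16 / M) ≤ 32 * ℓ * A' / s := by
    refine (Real.sqrt_le_left (by positivity)).2 ?_
    rw [div_pow, div_le_div_iff₀ hM (by positivity)]
    calc ℓ * q * 16 * s ^ 2 = 16 * ℓ * (q * (s * s)) := by ring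
      _ ≤ 16 * ℓ * (2 * A' * M) := by gcongr
      _ = 32 * (ℓ * A') * M := by ring
      _ ≤ (32 * ℓ * A') ^ 2 * M := mul_le_mul_of_nonneg_right (by nlinarith) hM.le
  calc M * √(ℓ * q * 16 / M) ≤ M * (32 * ℓ * A' / s) := by gcongr
    _ = 32 * ℓ * A' * (M / s) := by ring

/-- The expected number of queries with estimated degrees, up to polylogarithmic factors. Here `M` is
the degree sum, `N` stands for `n ^ (1 - 1 / γ)` and `s` for `n ^ (1 / (2 (γ - 1)))`, the square root
of the fatness; `η` bounds the probability that the sample `R` is light, and `φ` the failure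
probability of one degree estimate. -/
lemma total_cost_le {n M s A A' N ℓ r q η φ a : ℝ} (hn : 1 ≤ n) (hM : n ≤ M) (hM2 : M ≤ n ^ 2)
    (hs : 1 ≤ s) (hsn : s * s ≤ n) (hN : 1 ≤ N) (hNs : N * s ≤ n) (hA : 1 ≤ A) (hA' : 1 ≤ A')
    (hℓ : 1 ≤ ℓ) (hq0 : 0 ≤ q) (hr : r ≤ A * N + 1) (hq : q ≤ A' * (M / (s * s)) + 1)
    (hη : η ≤ 1 / n ^ 2) (hφ : n * φ ≤ 1 / n) (ha : 0 ≤ a) :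
    ℓ * (r * 2 + q * 2) + (1 + a) * M * (ℓ * (r / n + q * η) + √(ℓ * q * 16 / M) + n * φ) ≤
      40 * (1 + a) * ℓ * (A + A') * (M / s) := by
  have hn0 : 0 < n := by linarith
  have hM0 : 0 < M := by linarith
  have hs0 : 0 < s := by linarith
  set U := M / s with hU
  have hUs : U * s = M := by rw [hU]; field_simp
  have hU1 : 1 ≤ U := by rw [hU, one_le_div hs0]; nlinarith
  have hsU : M / (s * s) = U / s := by rw [hU]; field_simp
  have hnU : n / s ≤ U := div_le_div_of_nonneg_right hM hs0.le
  have hNn : N ≤ n / s := by rwa [le_div_iff₀ hs0]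
  have hr2 : r ≤ 2 * A * (n / s) := by nlinarith
  have hUss : 1 ≤ U / s := by
    rw [← hsU, one_le_div (by positivity)]
    linarith
  have hUsU : U / s ≤ U := div_le_self (by linarith) hs
  have hq2 : q ≤ 2 * A' * (U / s) := by
    rw [hsU] at hq
    nlinarith
  have hqU : q ≤ 2 * A' * U := hq2.trans (mul_le_mul_of_nonneg_left hUsU (by linarith))
  have hrU : r ≤ 2 * A * U := hr2.trans (mul_le_mul_of_nonneg_left hnU (by linarith))
  -- Vertex samples, edge samples from a light `R`, edge samples from a typical `R`, and inaccurate
  -- tables contribute the terms bounded in `t1`, `t2`, `t3` and `t4`.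
  have t1 : M * (r / n) ≤ 2 * A * U := by
    calc M * (r / n) ≤ M * (2 * A * (n / s) / n) := by gcongr
      _ = 2 * A * U := by rw [hU]; field_simp
  have t2 : M * (q * η) ≤ 2 * A' * U := by
    calc M * (q * η) ≤ n ^ 2 * (q * (1 / n ^ 2)) := by
          refine (mul_le_mul_of_nonneg_left (mul_le_mul_of_nonneg_left hη hq0) hM0.le).trans ?_
          exact mul_le_mul_of_nonneg_right hM2 (by positivity)
      _ = q := by field_simp
      _ ≤ _ := hqU
  have t3 : M * √(ℓ * q * 16 / M) ≤ 32 * ℓ * A' * U :=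
    mul_sqrt_div_le hM0 hs0 hA' hℓ (by rwa [hsU])
  have t4 : M * (n * φ) ≤ U := by
    calc M * (n * φ) ≤ M * (1 / n) := by gcongr
      _ ≤ M * (1 / s) := by
          refine mul_le_mul_of_nonneg_left (one_div_le_one_div_of_le hs0 ?_) hM0.le
          nlinarith
      _ = U := by rw [hU]; ring
  have hU0 : 0 < U := by linarith
  have t1' : ℓ * (M * (r / n)) ≤ ℓ * (2 * A * U) := by gcongr
  have t2' : ℓ * (M * (q * η)) ≤ ℓ * (2 * A' * U) := mul_le_mul_of_nonneg_left t2 (by linarith)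
  have t4' : U ≤ ℓ * A * U := le_mul_of_one_le_left hU0.le (one_le_mul_of_one_le_of_one_le hℓ hA)
  have hB : M * (ℓ * (r / n + q * η) + √(ℓ * q * 16 / M) + n * φ) ≤
      34 * ℓ * (A + A') * U := by
    have hpos : 0 ≤ ℓ * A * U := by positivity
    calc _ = ℓ * (M * (r / n)) + ℓ * (M * (q * η)) + M * √(ℓ * q * 16 / M) + M * (n * φ) := by ring
      _ ≤ ℓ * (2 * A * U) + ℓ * (2 * A' * U) + 32 * ℓ * A' * U + ℓ * A * U :=
          add_le_add (add_le_add (add_le_add t1' t2') t3) (t4.trans t4')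
      _ ≤ 34 * ℓ * (A + A') * U := by nlinarith
  have hdirect : ℓ * (r * 2 + q * 2) ≤ 4 * ℓ * (A + A') * U := by
    calc ℓ * (r * 2 + q * 2) ≤ ℓ * (2 * A * U * 2 + 2 * A' * U * 2) := by gcongr
      _ = _ := by ring
  have hW : 0 ≤ ℓ * (A + A') * U := by positivity
  calc _ = ℓ * (r * 2 + q * 2) +
        (1 + a) * (M * (ℓ * (r / n + q * η) + √(ℓ * q * 16 / M) + n * φ)) := by ring
    _ ≤ 4 * ℓ * (A + A') * U + (1 + a) * (34 * ℓ * (A + A') * U) := by gcongr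
    _ ≤ _ := by nlinarith [mul_nonneg ha hW]

/-- The polylogarithmic factors are bounded by a fixed power of `E = 1 + 1 / ε` and `L = log n`. -/
lemma polylog_le {E L δ a₁ a₂ K A A' ℓ H : ℝ} (hE : 1 ≤ E) (hL : 1 ≤ L)
    (hδE : 1 / δ ^ 2 ≤ 400 * E ^ 2) (ha₁ : 0 ≤ a₁) (ha₂ : 0 ≤ a₂) (hK : 0 < K)
    (hA : A = a₁ * (1 + L) / δ ^ 2) (hA' : A' = a₂ / δ ^ 2)
    (hℓ : ℓ ≤ 4 * (K + 4) * (1 + L) + 1) (hH : H ≤ 32 * (K + 8) * (1 + L) / δ ^ 2 + 1)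
    (hℓ1 : 1 ≤ ℓ) (hH1 : 1 ≤ H) :
    40 * (1 + 10 * (256 * H + 1)) * ℓ * (A + A') ≤
      (40 * 2571 * (25600 * (K + 8) + 1) * (8 * (K + 4) + 1) * (800 * a₁ + 400 * a₂)) *
        E ^ 4 * L ^ 4 := by
  have hE2 : 1 ≤ E ^ 2 := one_le_pow₀ hE
  have hLE : 1 ≤ L * E ^ 2 := one_le_mul_of_one_le_of_one_le hL hE2
  have hA0 : 0 ≤ A := by rw [hA]; positivity
  have hA'0 : 0 ≤ A' := by rw [hA']; positivity
  have b1 : A ≤ 800 * a₁ * (L * E ^ 2) := by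
    calc A = a₁ * (1 + L) * (1 / δ ^ 2) := by rw [hA]; ring
      _ ≤ a₁ * (2 * L) * (400 * E ^ 2) := by gcongr; linarith
      _ = 800 * a₁ * (L * E ^ 2) := by ring
  have b2 : A' ≤ 400 * a₂ * (L * E ^ 2) := by
    calc A' = a₂ * (1 / δ ^ 2) := by rw [hA']; ring
      _ ≤ a₂ * (400 * E ^ 2) := by gcongr
      _ ≤ a₂ * (400 * (L * E ^ 2)) := by
          gcongr
          exact le_mul_of_one_le_left (by positivity) hL
      _ = _ := by ring
  have b3 : ℓ ≤ (8 * (K + 4) + 1) * L := by nlinarith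
  have b4 : H ≤ (25600 * (K + 8) + 1) * (L * E ^ 2) := by
    calc H ≤ 32 * (K + 8) * (1 + L) * (1 / δ ^ 2) + 1 := by
          refine hH.trans (le_of_eq ?_); ring
      _ ≤ 32 * (K + 8) * (2 * L) * (400 * E ^ 2) + L * E ^ 2 := by gcongr; linarith
      _ = _ := by ring
  have b5 : 1 + 10 * (256 * H + 1) ≤ 2571 * ((25600 * (K + 8) + 1) * (L * E ^ 2)) := by linarith
  calc 40 * (1 + 10 * (256 * H + 1)) * ℓ * (A + A')
      ≤ 40 * (2571 * ((25600 * (K + 8) + 1) * (L * E ^ 2))) * ((8 * (K + 4) + 1) * L) *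
          (800 * a₁ * (L * E ^ 2) + 400 * a₂ * (L * E ^ 2)) := by gcongr
    _ = (40 * 2571 * (25600 * (K + 8) + 1) * (8 * (K + 4) + 1) * (800 * a₁ + 400 * a₂)) *
          E ^ 4 * L ^ 3 := by ring
    _ ≤ _ := mul_le_mul_of_nonneg_left (pow_le_pow_right₀ hL (by norm_num)) (by positivity)

/-- A graph with at least as many edges as vertices has at least three vertices. -/
lemma three_le_card_of_card_le_edges {V : Type u} [Fintype V] [Nonempty V] (G : SimpleGraph V)
    [DecidableRel G.Adj] (h : Fintype.card V ≤ G.edgeFinset.card) : 3 ≤ Fintype.card V := by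
  have h1 := G.sum_degrees_eq_twice_card_edges
  have h2 : ∑ v, G.degree v ≤ Fintype.card V * (Fintype.card V - 1) := by
    calc ∑ v, G.degree v ≤ ∑ _v : V, (Fintype.card V - 1) :=
          Finset.sum_le_sum fun v _ => Nat.le_sub_one_of_lt (G.degree_lt_card_verts v)
      _ = _ := by simp
  have h3 : 0 < Fintype.card V := Fintype.card_pos
  by_contra hc
  have : Fintype.card V * (Fintype.card V - 1) ≤ Fintype.card V * 1 :=
    Nat.mul_le_mul_left _ (by omega)
  omega

/-- The relations between the powers of `n` in the sample sizes and in the query bounds. -/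
lemma rpow_exponent_bounds {n γ : ℝ} (hn : 1 ≤ n) (hγ : 2 < γ) :
    n ^ (1 / (2 * (γ - 1))) * n ^ (1 / (2 * (γ - 1))) = n ^ (1 / (γ - 1)) ∧
      n ^ (1 / (γ - 1)) ≤ n ∧ 1 ≤ n ^ (1 / (2 * (γ - 1))) ∧ √n ≤ n ^ (1 - 1 / γ) ∧
      n ^ (1 - 1 / γ) * n ^ (1 / (2 * (γ - 1))) ≤ n := by
  have hn0 : 0 < n := by linarith
  have h1 : 0 < γ - 1 := by linarith
  have hγi : 1 / γ ≤ 1 / 2 := one_div_le_one_div_of_le (by norm_num) hγ.le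
  have hγj : 1 / (2 * (γ - 1)) ≤ 1 / γ := one_div_le_one_div_of_le (by linarith) (by linarith)
  refine ⟨?_, ?_, Real.one_le_rpow hn (by positivity), ?_, ?_⟩
  · rw [← Real.rpow_add hn0]
    congr 1
    field_simp
    norm_num
  · calc n ^ (1 / (γ - 1)) ≤ n ^ (1 : ℝ) :=
          Real.rpow_le_rpow_of_exponent_le hn ((div_le_one h1).2 (by linarith))
      _ = n := Real.rpow_one n
  · rw [Real.sqrt_eq_rpow]
    exact Real.rpow_le_rpow_of_exponent_le hn (by linarith)
  · rw [← Real.rpow_add hn0]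
    calc _ ≤ n ^ (1 : ℝ) := Real.rpow_le_rpow_of_exponent_le hn (by linarith)
      _ = n := Real.rpow_one n

open QueryAlg

set_option maxHeartbeats 2000000 in
theorem theorem1p2 (γ τ K : ℝ) (hγ : 2 < γ) (hτ : 0 < τ) (hK : 0 < K) :
    ∃ (C : ℝ) (k : ℕ), 0 < C ∧
      ∀ (V : Type u) [Fintype V] [Nonempty V] (ε : ℝ), 0 < ε →
        ∃ deg : V → QueryAlg V ℝ≥0, IsDegreeEstimator V (ε / 10) deg ∧
          ∀ m : ℕ, Fintype.card V ≤ m →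
            ∃ (r q ℓ : ℕ) (cutoff : ℝ),
              ∀ (G : SimpleGraph V) [DecidableRel G.Adj],
                G.edgeFinset.card = m → PowerLawBelow G γ τ →
                  -- Standard Model
                  (1 - ENNReal.ofReal ((Fintype.card V : ℝ) ^ (-K)) ≤
                      (saddlesSM V r q ℓ cutoff).prob G (IsCcdhEstimate G ε) ∧
                    (saddlesSM V r q ℓ cutoff).QueriesAtMost G
                      (C * (1 + 1 / ε) ^ k * Real.log (Fintype.card V) ^ k *
                        ((Fintype.card V : ℝ) ^ (1 - 1 / γ) +
                          (Fintype.card V : ℝ) ^ (1 - 1 / (γ - 1)) * avgDegree G))) ∧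
                  -- Hidden Degrees Model
                  ((saddlesHDM V deg r q ℓ cutoff).NoDegreeQueries ∧
                    1 - ENNReal.ofReal ((Fintype.card V : ℝ) ^ (-K)) ≤
                      (saddlesHDM V deg r q ℓ cutoff).prob G (IsCcdhEstimate G ε) ∧
                    (saddlesHDM V deg r q ℓ cutoff).expectedQueries G ≤
                      ENNReal.ofReal
                        (C * (1 + 1 / ε) ^ k * Real.log (Fintype.card V) ^ k *
                          ((Fintype.card V : ℝ) ^ (1 - 1 / (2 * (γ - 1))) * avgDegree G))) := by
  classical
  set κ := min (1 / 2) (τ / 4) with hκ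
  have hκ0 : 0 < κ := lt_min (by norm_num) (by positivity)
  have hκ1 : κ ≤ 1 / 2 := min_le_left _ _
  set a₁ := 1024 + 512 / τ with ha₁
  have ha₁0 : 1024 ≤ a₁ := by rw [ha₁]; linarith [show 0 < 512 / τ by positivity]
  set a₂ := 9600 / κ with ha₂
  have ha₂0 : 1 ≤ a₂ := by rw [ha₂, one_le_div hκ0]; linarith
  set C := 40 * 2571 * (25600 * (K + 8) + 1) * (8 * (K + 4) + 1) * (800 * a₁ + 400 * a₂) with hC
  have hC0 : 0 < C := by positivity
  refine ⟨C, 4, hC0, ?_⟩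
  intro V _ _ ε hε
  -- An estimate for a smaller `ε` is also one for `ε`, so the precision is capped at `1 / 2`; the
  -- factor `10` is the loss in `ev_saddlesSM_le`.
  set δ := min ε (1 / 2) / 10 with hδ
  have hδ0 : 0 < δ := div_pos (lt_min hε (by norm_num)) (by norm_num)
  have hδ1 : δ ≤ 1 / 20 := by rw [hδ]; linarith [min_le_right ε (1 / 2)]
  have hδε : δ ≤ ε / 10 := by rw [hδ]; linarith [min_le_left ε (1 / 2)]
  have hδ2 : 0 < δ ^ 2 := by positivity
  have hδ21 : δ ^ 2 ≤ 1 := by nlinarith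
  set E := 1 + 1 / ε with hE
  have hE1 : 1 ≤ E := by rw [hE]; linarith [show 0 < 1 / ε by positivity]
  have hδE : 1 / δ ^ 2 ≤ 400 * E ^ 2 := by
    have h1 : 1 / δ ≤ 20 * E := by
      rw [div_le_iff₀ hδ0]
      have hEε : E * ε = ε + 1 := by rw [hE]; field_simp
      rcases min_cases ε (1 / 2) with ⟨h, _⟩ | ⟨h, _⟩
      · rw [hδ, h]; linarith
      · rw [hδ, h]; linarith
    calc 1 / δ ^ 2 = (1 / δ) ^ 2 := by rw [one_div_pow]
      _ ≤ (20 * E) ^ 2 := pow_le_pow_left₀ (by positivity) h1 2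
      _ = _ := by ring
  have hn1 : (1 : ℝ) ≤ Fintype.card V := by exact_mod_cast Fintype.card_pos
  set n := (Fintype.card V : ℝ) with hn
  have hn0 : 0 < n := by linarith
  have hl0 : 0 ≤ Real.log n := Real.log_nonneg hn1
  set L := Real.log n with hL
  -- `H` hits give relative error `δ` with failure probability `exp (-δ ^ 2 H / 32)`, up to a factor
  -- of order `n`.
  set H := ⌈32 * (K + 8) * (1 + L) / δ ^ 2⌉₊ with hH
  have hH1 : 32 * (K + 8) * (1 + L) / δ ^ 2 ≤ H := Nat.le_ceil _
  have hH2 : (H : ℝ) ≤ 32 * (K + 8) * (1 + L) / δ ^ 2 + 1 :=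
    (Nat.ceil_lt_add_one (by positivity)).le
  have hH256 : (256 : ℝ) ≤ H := by
    refine le_trans ?_ hH1
    rw [le_div_iff₀ hδ2]
    nlinarith
  have hH4 : 4 ≤ H := by
    have : (4 : ℝ) ≤ H := by linarith
    exact_mod_cast this
  set φ := 1 / 4 * n ^ (-(K + 4)) with hφ
  have hφ4 : φ ≤ 1 / 4 * n ^ (-4 : ℝ) :=
    mul_le_mul_of_nonneg_left (Real.rpow_le_rpow_of_exponent_le hn1 (by linarith)) (by norm_num)
  have hn4 : n ^ (-4 : ℝ) = (n ^ 4)⁻¹ := by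
    rw [Real.rpow_neg hn0.le]
    norm_cast
  rw [hn4] at hφ4
  have hfail : ∀ (G : SimpleGraph V) [DecidableRel G.Adj] (v : V),
      (collisionDegree H (256 * H) v).ev G (degreeTable G) (inaccurate G δ v) ≤ φ := by
    intro G _ v
    have h1 := ev_collisionDegree_le (G := G) (D := degreeTable G) (H := H) (T := 256 * H)
      (a := δ / 2) (by positivity) (by linarith) (by omega) (by omega) v
    have e : 2 * (δ / 2) = δ := by ring
    rw [e] at h1
    refine le_trans (le_of_eq ?_) (h1.trans (degree_failure_le hn1 hK ?_))
    · congr 1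
    · rw [div_le_iff₀ hδ2] at hH1
      rw [le_div_iff₀ (by norm_num)]
      rw [← hL]
      nlinarith
  have hn4' : (n ^ 4)⁻¹ ≤ (n ^ 3)⁻¹ :=
    inv_anti₀ (by positivity) (pow_le_pow_right₀ hn1 (by norm_num))
  have hn3 : (n ^ 3)⁻¹ ≤ 1 := inv_le_one_of_one_le₀ (one_le_pow₀ hn1)
  have hn3' : 0 < (n ^ 3)⁻¹ := by positivity
  refine ⟨collisionDegree H (256 * H), isDegreeEstimator_collisionDegree hδε hfail
    (by rw [← hn]; linarith) (by linarith), ?_⟩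
  intro m hm
  -- `A` and `A'` are what `vertex_sample_size` and `edge_sample_size` ask for; the logarithm in `A`
  -- is there for the lower tail of the degree sum only.
  set A := a₁ * (1 + L) / δ ^ 2 with hA
  set A' := a₂ / δ ^ 2 with hA'
  set N := n ^ (1 - 1 / γ) with hN
  set s := n ^ (1 / (2 * (γ - 1))) with hs
  set ζ := n ^ (1 / (γ - 1)) with hζ
  set ℓ := ⌈4 * (K + 4) * (1 + L)⌉₊ with hℓ
  set r := ⌈A * N⌉₊ with hr
  set q := ⌈A' * ((2 * m : ℕ) / ζ)⌉₊ with hq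
  set c := 512 / δ ^ 2 with hc
  refine ⟨r, q, ℓ, c, ?_⟩
  intro G _ hGm hG
  -- As `m ≥ n` forces `n ≥ 3`, the factor `log n` is at least `1`.
  have hMsum : ∑ v, (G.degree v : ℝ) = ((2 * m : ℕ) : ℝ) := by
    have h := G.sum_degrees_eq_twice_card_edges
    rw [hGm] at h
    exact_mod_cast h
  have hcard3 : 3 ≤ Fintype.card V := three_le_card_of_card_le_edges G (by rw [hGm]; exact hm)
  have hn3R : (3 : ℝ) ≤ n := by rw [hn]; exact_mod_cast hcard3
  have hL1 : 1 ≤ L := by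
    rw [hL, Real.le_log_iff_exp_le hn0]
    linarith [Real.exp_one_lt_d9]
  set M := ((2 * m : ℕ) : ℝ) with hM
  have hmn : n ≤ M := by
    rw [hn, hM]
    exact_mod_cast (by omega : Fintype.card V ≤ 2 * m)
  have hM0 : 0 < M := by linarith
  have hMn : M ≤ n ^ 2 := by
    rw [← hMsum]
    calc ∑ v, (G.degree v : ℝ) ≤ ∑ _v : V, n :=
          Finset.sum_le_sum fun v _ => by
            rw [hn]; exact_mod_cast (G.degree_lt_card_verts v).le
      _ = n ^ 2 := by simp [hn, sq]
  obtain ⟨hss, hζn, hs1, hsqN, hNs⟩ := rpow_exponent_bounds hn1 hγ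
  rw [← hs, ← hζ] at hss
  rw [← hζ] at hζn
  rw [← hs] at hs1
  rw [← hN] at hsqN
  rw [← hN, ← hs] at hNs
  have hN1 : 1 ≤ N := (Real.one_le_sqrt.2 hn1).trans hsqN
  have hζ0 : 0 < ζ := by positivity
  have hs0 : 0 < s := by linarith
  have hMζ : 1 ≤ M / ζ := by rw [one_le_div hζ0]; linarith
  have hAδ : A * δ ^ 2 = a₁ * (1 + L) := by rw [hA]; field_simp
  have hA'δ : A' * δ ^ 2 = a₂ := by rw [hA']; field_simp
  have hA1 : 32 * (1 + L) ≤ A := by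
    rw [hA, le_div_iff₀ hδ2]
    nlinarith [mul_nonneg (by linarith : 0 ≤ 1 + L) (by linarith : 0 ≤ a₁ - 32)]
  have hA'1 : 1 ≤ A' := by rw [hA', le_div_iff₀ hδ2]; linarith
  have hA1' : 1 ≤ A := by linarith
  have hcA : 2 * c ≤ A := by
    rw [hc, hA, ← mul_div_assoc, div_le_div_iff_of_pos_right hδ2]
    nlinarith
  have hc0 : 0 < c := by positivity
  have hcδ : 512 ≤ c * δ ^ 2 := by rw [hc]; exact le_of_eq (by field_simp)
  have hA256 : 256 ≤ A * δ ^ 2 := by rw [hAδ]; nlinarith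
  have hA512 : 512 ≤ τ * A * δ ^ 2 := by
    rw [mul_assoc, hAδ]
    have e : τ * a₁ = 1024 * τ + 512 := by rw [ha₁]; field_simp
    have : 512 ≤ τ * a₁ := by linarith
    calc (512 : ℝ) ≤ τ * a₁ * 1 := by linarith
      _ ≤ τ * a₁ * (1 + L) := mul_le_mul_of_nonneg_left (by linarith) (by linarith)
      _ = _ := by ring
  have hA9600 : 9600 ≤ A' * min (1 / 2) (τ / 4) * δ ^ 2 := by
    rw [← hκ, mul_right_comm, hA'δ, ha₂]
    exact le_of_eq (by field_simp)
  have hrl : A * N ≤ r := Nat.le_ceil _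
  have hql : A' * (M / ζ) ≤ q := Nat.le_ceil _
  have hℓl : 4 * (K + 4) * (1 + L) ≤ ℓ := Nat.le_ceil _
  have hru : (r : ℝ) ≤ A * N + 1 := (Nat.ceil_lt_add_one (by positivity)).le
  have hqu : (q : ℝ) ≤ A' * (M / ζ) + 1 := (Nat.ceil_lt_add_one (by positivity)).le
  have hℓu : (ℓ : ℝ) ≤ 4 * (K + 4) * (1 + L) + 1 := (Nat.ceil_lt_add_one (by positivity)).le
  have hr0 : 0 < r := Nat.ceil_pos.2 (by positivity)
  have hq0 : 0 < q := Nat.ceil_pos.2 (by positivity)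
  have hℓ0 : 0 < ℓ := Nat.ceil_pos.2 (by positivity)
  have hℓ1 : (1 : ℝ) ≤ ℓ := by exact_mod_cast hℓ0
  have hHR1 : (1 : ℝ) ≤ H := by linarith
  have hpoly := polylog_le hE1 hL1 hδE (by linarith : 0 ≤ a₁) (by linarith : 0 ≤ a₂) hK hA hA'
    hℓu hH2 hℓ1 hHR1
  rw [← hC] at hpoly
  have hAA : 0 ≤ ℓ * (A + A') := by positivity
  have havg : avgDegree G = M / n := by rw [avgDegree, hMsum]
  have hφn : n * φ ≤ 1 / 4 * n ^ (-K) := by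
    rw [hφ]
    calc n * (1 / 4 * n ^ (-(K + 4))) = 1 / 4 * (n ^ (1 : ℝ) * n ^ (-(K + 4))) := by
          rw [Real.rpow_one]; ring
      _ = 1 / 4 * n ^ (1 + -(K + 4)) := by rw [Real.rpow_add hn0]
      _ ≤ 1 / 4 * n ^ (-K) := mul_le_mul_of_nonneg_left
          (Real.rpow_le_rpow_of_exponent_le hn1 (by linarith)) (by norm_num)
  have hφn' : n * φ ≤ 1 / n := by
    calc n * φ ≤ n * (1 / 4 * (n ^ 4)⁻¹) := mul_le_mul_of_nonneg_left hφ4 hn0.le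
      _ = 1 / 4 * (n ^ 3)⁻¹ := by field_simp
      _ ≤ 1 * (n ^ 1)⁻¹ := mul_le_mul (by norm_num)
          (inv_anti₀ (by positivity) (pow_le_pow_right₀ hn1 (by norm_num))) hn3'.le (by norm_num)
      _ = 1 / n := by rw [pow_one, one_mul, one_div]
  have hnK : 0 < n ^ (-K) := by positivity
  -- This serves both models: the true degrees are accurate, and so are the estimated ones outside of
  -- an event of probability at most `n φ`.
  have hacc : ∀ D : V → ℝ≥0, IsAccurate G δ D →
      ((saddlesSM V r q ℓ c).ev G D fun Nt => if IsCcdhEstimate G ε Nt then 0 else 1) ≤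
        1 / 4 * n ^ (-K) := by
    intro D hD
    refine le_trans (ev_mono _ fun Nt => ?_) ((ev_saddlesSM_le hD hδ0 hδ1 hr0 hq0 hℓ0 hc0 hcδ
      (by rw [hMsum]; exact hM0)
      (fun d hd _ hfew => vertex_sample_size hγ hτ hD hδ0 (by linarith) hG hd (by linarith) hcA
        hA256 hA512 hrl hfew)
      (fun d hd hf => edge_sample_size hγ hτ hD (by linarith) hG hd hf hA9600
        (by rw [hMsum]; exact hql))).trans (median_failure_le hn1 hK hℓl))
    by_cases h : IsCcdhEstimate G (10 * δ) Nt
    · have h' : IsCcdhEstimate G ε Nt := h.mono (by linarith) (by linarith) (by linarith)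
      rw [if_pos h, if_pos h']
    · rw [if_neg h]
      split_ifs <;> norm_num
  refine ⟨⟨?_, ?_⟩, ?_, ?_, ?_⟩
  · refine one_sub_ofReal_le_prob _ _ ((hacc _ (isAccurate_degreeTable hδ0.le)).trans ?_)
    linarith
  · intro x hx
    refine ((queriesLE_saddlesSM r q ℓ c).queriesAtMost G x hx).trans ?_
    have e : n ^ (1 - 1 / (γ - 1)) * avgDegree G = M / ζ := by
      rw [havg, Real.rpow_sub hn0, Real.rpow_one, ← hζ]
      field_simp
    rw [e]
    push_cast
    have hAN : 1 ≤ A * N := one_le_mul_of_one_le_of_one_le hA1' hN1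
    have hAM : 1 ≤ A' * (M / ζ) := one_le_mul_of_one_le_of_one_le hA'1 hMζ
    have hB : 0 ≤ N + M / ζ := by linarith
    have hcross : 0 ≤ A * (M / ζ) + A' * N := by positivity
    calc (ℓ : ℝ) * (r * 2 + q * 2) ≤ ℓ * (4 * ((A + A') * (N + M / ζ))) := by
          refine mul_le_mul_of_nonneg_left ?_ (by linarith)
          linarith [show (A + A') * (N + M / ζ) =
            A * N + A' * (M / ζ) + (A * (M / ζ) + A' * N) by ring]
      _ = 4 * (ℓ * (A + A')) * (N + M / ζ) := by ring
      _ ≤ 40 * (1 + 10 * (256 * H + 1)) * (ℓ * (A + A')) * (N + M / ζ) := by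
          refine mul_le_mul_of_nonneg_right (mul_le_mul_of_nonneg_right ?_ hAA) hB
          linarith
      _ = 40 * (1 + 10 * (256 * H + 1)) * ℓ * (A + A') * (N + M / ζ) := by ring
      _ ≤ _ := mul_le_mul_of_nonneg_right hpoly hB
  · exact noDegreeQueries_simulateDegrees
      (fun v => (onlyNeighborsOf_collisionDegree v H (256 * H)).noDegreeQueries) _ _
  · refine one_sub_ofReal_le_prob _ _ ((ev_simulateDegrees_le (hfail G) _ (by positivity)
      (fun Nt => by split_ifs <;> norm_num) hacc).trans ?_)
    rw [← hn]
    linarith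
  · rw [expectedQueries_eq]
    refine ENNReal.ofReal_le_ofReal ?_
    set η := Real.exp (-(r * √M / (16 * n))) with hη
    have hη0 : 0 ≤ η := (Real.exp_pos _).le
    have e : n ^ (1 - 1 / (2 * (γ - 1))) * avgDegree G = M / s := by
      rw [havg, Real.rpow_sub hn0, Real.rpow_one, ← hs]
      field_simp
    rw [e]
    have h1 := meanQueries_simulateDegrees_le' (hfail G) (queriesLE_saddlesSM (V := V) r q ℓ c)
      (a := 10 * (256 * H + 1)) (x := ℓ * (r / n + q * η)) (y := ℓ * q * 16 / M) (by positivity)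
      (by positivity) (by positivity)
      (fun v => by
        have := meanQueries_collisionDegree_le (G := G) (D := degreeTable G) hH4 le_rfl v
        exact_mod_cast this)
      (fun D' hD' v => by
        refine (queryProb_saddlesSM_le hD' (by linarith) (by rw [hMsum]; exact hM0) hr0 v).trans
          (le_of_eq ?_)
        rw [hMsum, ← hn, ← hη]
        ring)
      (by rw [hMsum]; exact hmn)
    rw [hMsum, ← hn] at h1
    push_cast at h1
    refine h1.trans ((total_cost_le hn1 hmn hMn hs1 (by rw [hss]; exact hζn) hN1 hNs hA1' hA'1 hℓ1
      (Nat.cast_nonneg q) hru (by rw [hss]; exact hqu)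
      (lower_tail_le hn1 hmn hA1 hsqN hrl) hφn' (by positivity)).trans ?_)
    exact mul_le_mul_of_nonneg_right hpoly (by positivity)
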